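/- **Setting.** Let $E$ be a finite set of modes, $\lambda:E\to[0,\infty)$ jump rates, and $Q(\gamma,\cdot)$ ($\gamma\in E$) probability measures on $E$ with $Q(\gamma,\{\gamma\})=0$. Let $\gamma_0\in E$ and let $M\ge 1$ be an integer. Let $\Gamma$ be the pure jump process on a probability space $(\Omega,\mathcal F,\mathbb P)$ with initial mode $\gamma_0$, jump times $0=T_0<T_1<T_2<\dots$ (a jump that does not happen has time $\infty$) and successive modes $\gamma^0=\gamma_0,\gamma^1,\gamma^2,\dots$, i.e. $\Gamma_t=\gamma^n$ for $T_n\le t<T_{n+1}$, such that $T_{M+1}=\infty$ and, for $n<M$, on $\{T_n<\infty\}$: given $(T_k,\gamma^k)_{k\le n}$, the variable $T_{n+1}-T_n$ satisfies $\mathbb P(T_{n+1}-T_n\ge t\mid\cdot)=e^{-\lambda(\gamma^n)t}$ for all $t\ge0$; and given moreover $T_{n+1}<\infty$, the mode $\gamma^{n+1}$ has law $Q(\gamma^n,\cdot)$. Let $\mathbb F=(\mathcal F_t)_{t\ge0}$, $\mathcal F_t=\sigma(\Gamma_r:r\le t)$, be its natural filtration, $q=\sum_{k\ge1,\,T_k<\infty}\delta_{(T_k,\gamma^k)}$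 its jump measure, $\widehat q(dt,d\theta)=1_{\{t\le T_M\}}\lambda(\Gamma_{t-})Q(\Gamma_{t-},d\theta)\,dt$ the compensator of $q$, and $\widetilde q=q-\widehat q$. Let $N,d\ge1$, and let $A(\gamma),C(\gamma,\theta)\in\mathbb R^{N\times N}$ and $B(\gamma)\in\mathbb R^{N\times d}$ for $\gamma,\theta\in E$. For $x\in\mathbb R^N$ and an admissible control $u$, i.e. an $\mathbb F$-progressively measurable $\mathbb R^d$-valued process with $\mathbb E\int_0^{S}|u_t|^2dt<\infty$ for all $S<\infty$, let $X^{x,u}$ be the solution of $$dX_s=\left[A(\Gamma_s)X_s+B(\Gamma_s)u_s\right]ds+\int_E C(\Gamma_{s-},\theta)X_{s-}\,\widetilde q(ds,d\theta),\qquad X_0=x.$$ Given $T>0$, this system is *exactly null-controllable at time $T$* (with initial mode $\gamma_0$) if for every $x\in\mathbb R^N$ there is an admissible control $u$ with $X^{x,u}_T=0$ $\mathbb P$-almost surely. Let $\mathcal L^2(q;\mathbb R^N)$ be the set of $\mathbb R^N$-valued functions $v_t(\omega,\theta)$ on $\Omega\times[0,\infty)\times E$ that are measurable with respect to the product of the $\mathbb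 F$-predictable $\sigma$-field and the Borel $\sigma$-field of $E$, with $\mathbb E\int_0^{S}\int_E|v_t(\theta)|^2\,\widehat q(dt,d\theta)<\infty$ for all $S<\infty$. For $y\in\mathbb R^N$ and $v\in\mathcal L^2(q;\mathbb R^N)$ let $Y^{y,v}$ be the solution of the controlled dual system $$dY_t=\int_E v_t(\theta)\,\widetilde q(dt,d\theta)-A^*(\Gamma_t)Y_t\,dt-\int_E C^*(\Gamma_t,\theta)v_t(\theta)\,\widehat q(dt,d\theta),\qquad Y_0=y.$$ For $T>0$ and $y\in\mathbb R^N$ let $p(y)\ge0$ be defined by $$p(y)^2=\inf_{v\in\mathcal L^2(q;\mathbb R^N)}\mathbb E\left[\int_0^T\left|\Pi_{(\ker B^*(\Gamma_t))^\perp}Y_t^{y,v}\right|^2dt\right],$$ where $\Pi_V$ is the orthogonal projection onto $V$. **Proposition.** Let $T>0$. The infimum is finite for every $y\in\mathbb R^N$, and $p$ is a pseudonorm on $\mathbb R^N$ (that is, $p\ge0$, $p(ay)=|a|\,p(y)$ and $p(y+z)\le p(y)+p(z)$ for all $a\in\mathbb R$ and $y,z\in\mathbb R^N$). The system is exactly null-controllable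 at time $T$ if and only if $p$ is a norm, i.e. a pseudonorm such that $p(y)=0$ only for $y=0$. -/

import Mathlib

open MeasureTheory ENNReal NNReal

/-- The characteristics `(λ, Q)` of a pure jump Markov process on a finite set `E` of modes:
jump rates `λ(γ) ≥ 0` and post-jump distributions `Q(γ, ·)` with `Q(γ, {γ}) = 0`. -/
structure JumpCharacteristics (E : Type*) [Fintype E] where
  rate : E → ℝ≥0
  Q : E → E → ℝ≥0
  sum_Q : ∀ γ, ∑ θ, Q γ θ = 1
  Q_self : ∀ γ, Q γ γ = 0

/-- The mode-dependent coefficients of the linear system: `A(γ), C(γ,θ) ∈ ℝ^{N×N}` and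
`B(γ) ∈ ℝ^{N×d}`, seen as operators between Euclidean spaces. -/
structure SwitchCoefficients (E : Type*) (N d : ℕ) where
  A : E → EuclideanSpace ℝ (Fin N) →L[ℝ] EuclideanSpace ℝ (Fin N)
  B : E → EuclideanSpace ℝ (Fin d) →L[ℝ] EuclideanSpace ℝ (Fin N)
  C : E → E → EuclideanSpace ℝ (Fin N) →L[ℝ] EuclideanSpace ℝ (Fin N)

/-- The switch process with characteristics `(λ, Q)`, initial mode `γ₀` and at most `M` jumps, on
the probability space `(Ω, μ)`: the jump times `T_0 = 0 < T_1 < T_2 < ⋯` (a jump that never happens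
has jump time `∞`) and the modes `mark n` entered at these times.  Given the history
`(T_0, γ^0), …, (T_n, γ^n)` with `n < M` and `T_n < ∞`, the waiting time `T_{n+1} - T_n` is
exponential of parameter `λ(γ^n)`; given moreover `T_{n+1} < ∞`, the next mode has law
`Q(γ^n, ·)`.  The jump `M + 1` never happens. -/
structure SwitchProcess {E : Type*} [Fintype E] [MeasurableSpace E]
    (c : JumpCharacteristics E) (γ₀ : E) (M : ℕ)
    {Ω : Type*} [MeasurableSpace Ω] (μ : Measure Ω) where
  time : ℕ → Ω → ℝ≥0∞
  mark : ℕ → Ω → E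
  measurable_time : ∀ n, Measurable (time n)
  measurable_mark : ∀ n, Measurable (mark n)
  time_zero : ∀ ω, time 0 ω = 0
  mark_zero : ∀ ω, mark 0 ω = γ₀
  time_mono : ∀ ω, Monotone fun n => time n ω
  time_lt : ∀ n ω, time n ω < ∞ → time n ω < time (n + 1) ω
  time_last : ∀ ω, time (M + 1) ω = ∞
  /-- the mode really changes at a jump time -/
  mark_ne : ∀ n ω, time (n + 1) ω < ∞ → mark (n + 1) ω ≠ mark n ω
  /-- `P(T_{n+1} - T_n ≥ t ∣ (T_0, γ^0), …, (T_n, γ^n)) = exp(-λ(γ^n) t)` on `{T_n < ∞}` -/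
  law_time : ∀ n < M, ∀ t : ℝ≥0, ∀ D : Set (Fin (n + 1) → ℝ≥0∞ × E), MeasurableSet D →
    μ {ω | (fun k : Fin (n + 1) => (time k ω, mark k ω)) ∈ D ∧ time n ω < ∞ ∧
        time n ω + t ≤ time (n + 1) ω} =
      ∫⁻ ω in {ω | (fun k : Fin (n + 1) => (time k ω, mark k ω)) ∈ D ∧ time n ω < ∞},
        ENNReal.ofReal (Real.exp (-((c.rate (mark n ω) : ℝ) * t))) ∂μ
  /-- `P(γ^{n+1} = θ ∣ (T_0, γ^0), …, (T_n, γ^n), T_{n+1}) = Q(γ^n, θ)` on `{T_{n+1} < ∞}` -/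
  law_mark : ∀ n < M, ∀ θ : E, ∀ D : Set ((Fin (n + 1) → ℝ≥0∞ × E) × ℝ≥0∞), MeasurableSet D →
    μ {ω | ((fun k : Fin (n + 1) => (time k ω, mark k ω)), time (n + 1) ω) ∈ D ∧
        time (n + 1) ω < ∞ ∧ mark (n + 1) ω = θ} =
      ∫⁻ ω in {ω | ((fun k : Fin (n + 1) => (time k ω, mark k ω)), time (n + 1) ω) ∈ D ∧
        time (n + 1) ω < ∞}, (c.Q (mark n ω) θ : ℝ≥0∞) ∂μ

namespace SwitchProcess

variable {E : Type*} [Fintype E] [MeasurableSpace E]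
  {c : JumpCharacteristics E} {γ₀ : E} {M : ℕ}
  {Ω : Type*} [MeasurableSpace Ω] {μ : Measure Ω} (G : SwitchProcess c γ₀ M μ)

/-- The number of jumps up to (and including) time `t`. -/
noncomputable def jumpCount (t : ℝ≥0) (ω : Ω) : ℕ :=
  ∑ k ∈ Finset.Icc 1 M, if G.time k ω ≤ t then 1 else 0

/-- The mode process: `Γ_t = γ^n` for `T_n ≤ t < T_{n+1}`. -/
noncomputable def mode (t : ℝ≥0) (ω : Ω) : E :=
  G.mark (G.jumpCount t ω) ω

lemma measurable_mode (t : ℝ≥0) : Measurable (G.mode t) := by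
  have h1 : Measurable (G.jumpCount t) := by
    unfold jumpCount
    refine Finset.measurable_sum _ fun k _ => ?_
    exact Measurable.ite (measurableSet_le (G.measurable_time k) measurable_const)
      measurable_const measurable_const
  have h2 : Measurable (fun p : ℕ × Ω => G.mark p.1 p.2) :=
    measurable_from_prod_countable_right fun n => G.measurable_mark n
  exact h2.comp (h1.prodMk measurable_id)

/-- The natural filtration `ℱ_{[0,t]} = σ(Γ_r : r ∈ [0,t])` of the mode process. -/
noncomputable def filtration : Filtration ℝ≥0 (inferInstance : MeasurableSpace Ω) where
  seq t := ⨆ r : ℝ≥0, ⨆ _ : r ≤ t, MeasurableSpace.comap (G.mode r) inferInstance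
  mono' _ _ hst := iSup_mono fun _ => iSup_mono' fun hr => ⟨hr.trans hst, le_rfl⟩
  le' _ := iSup_le fun r => iSup_le fun _ => (G.measurable_mode r).comap_le

/-- The density of the compensator: `q̂(dt, {θ}) = intensity t θ dt`, which is
`λ(Γ_t) Q(Γ_t, θ) dt` until the `M`-th jump and `0` afterwards (the predictable version, with
`Γ_{t-}`, differs from this one only at the finitely many jump times). -/
noncomputable def intensity (t : ℝ≥0) (ω : Ω) (θ : E) : ℝ≥0 :=
  if G.time M ω ≤ t then 0 else c.rate (G.mode t ω) * c.Q (G.mode t ω) θ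

/-- The admissible controls of the state equation: progressively measurable for the natural
filtration of the mode, and square integrable on `Ω × [0, S]` for every `S < ∞`. -/
def AdmissibleControl {d : ℕ} (u : ℝ≥0 → Ω → EuclideanSpace ℝ (Fin d)) : Prop :=
  IsStronglyProgressive G.filtration u ∧
    ∀ S : ℝ≥0, ∫⁻ ω, (∫⁻ t in Set.Icc (0 : ℝ) S, ‖u t.toNNReal ω‖ₑ ^ 2) ∂μ < ∞

/-- The space `ℒ²(q; ℝ^N)` of controls `v_t(θ)` of the dual equation: predictable (since `E` is
finite, measurability for `𝒫 ⊗ ℬ(E)` is predictability of each `v(θ)`), with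
`E ∫_0^S ∫_E |v_t(θ)|² q̂(dt, dθ) < ∞` for every `S < ∞`. -/
def AdmissibleDualControl {N : ℕ} (v : ℝ≥0 → Ω → E → EuclideanSpace ℝ (Fin N)) : Prop :=
  (∀ θ, IsStronglyPredictable G.filtration fun t ω => v t ω θ) ∧
    ∀ S : ℝ≥0, ∫⁻ ω, (∫⁻ t in Set.Icc (0 : ℝ) S,
      ∑ θ, (G.intensity t.toNNReal ω θ : ℝ≥0∞) * ‖v t.toNNReal ω θ‖ₑ ^ 2) ∂μ < ∞

variable {N d : ℕ} (S : SwitchCoefficients E N d)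

/-- The total `ds`-part of the state equation: `A(Γ_s) X_s + B(Γ_s) u_s`, minus the compensator
`∑_θ λ(Γ_s) Q(Γ_s, θ) C(Γ_s, θ) X_s` of the jump part. -/
noncomputable def stateDrift (u : ℝ≥0 → Ω → EuclideanSpace ℝ (Fin d))
    (X : ℝ≥0 → Ω → EuclideanSpace ℝ (Fin N)) (s : ℝ≥0) (ω : Ω) : EuclideanSpace ℝ (Fin N) :=
  S.A (G.mode s ω) (X s ω) + S.B (G.mode s ω) (u s ω)
    - ∑ θ, (G.intensity s ω θ : ℝ) • S.C (G.mode s ω) θ (X s ω)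

/-- `X` solves
`dX_s = [A(Γ_s) X_s + B(Γ_s) u_s] ds + ∫_E C(Γ_{s-}, θ) X_{s-} (q - q̂)(ds, dθ)`, `X_0 = x`.
The integral against `q` is the sum over the jump times `T_k ≤ t`, and there `Γ_{T_k -} = γ^{k-1}`.
The equation is solved path by path; it forces the paths to be càdlàg and determines them. -/
def IsStateSolution (x : EuclideanSpace ℝ (Fin N)) (u : ℝ≥0 → Ω → EuclideanSpace ℝ (Fin d))
    (X : ℝ≥0 → Ω → EuclideanSpace ℝ (Fin N)) : Prop :=
  ∀ᵐ ω ∂μ, ∀ t : ℝ≥0,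
    IntervalIntegrable (fun s : ℝ => G.stateDrift S u X s.toNNReal ω) volume 0 t ∧
    X t ω = x + (∫ s in (0 : ℝ)..t, G.stateDrift S u X s.toNNReal ω) +
      ∑ k ∈ Finset.Icc 1 M, if G.time k ω ≤ t then
        S.C (G.mark (k - 1) ω) (G.mark k ω)
          (Function.leftLim (fun r : ℝ≥0 => X r ω) (G.time k ω).toNNReal) else 0

/-- The total `ds`-part of the dual equation: `-A*(Γ_s) Y_s`, minus the compensator
`∑_θ λ(Γ_s) Q(Γ_s, θ) v_s(θ)` of the jump part, minus
`∑_θ λ(Γ_s) Q(Γ_s, θ) C*(Γ_s, θ) v_s(θ)`. -/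
noncomputable def dualDrift (v : ℝ≥0 → Ω → E → EuclideanSpace ℝ (Fin N))
    (Y : ℝ≥0 → Ω → EuclideanSpace ℝ (Fin N)) (s : ℝ≥0) (ω : Ω) : EuclideanSpace ℝ (Fin N) :=
  - (S.A (G.mode s ω)).adjoint (Y s ω)
    - ∑ θ, (G.intensity s ω θ : ℝ) • v s ω θ
    - ∑ θ, (G.intensity s ω θ : ℝ) • (S.C (G.mode s ω) θ).adjoint (v s ω θ)

/-- `Y` solves the controlled dual equation
`dY_t = ∫_E v_t(θ) (q - q̂)(dt, dθ) - A*(Γ_t) Y_t dt - ∫_E C*(Γ_t, θ) v_t(θ) q̂(dt, dθ)`,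
`Y_0 = y` (path by path, as for the state equation). -/
def IsDualSolution (y : EuclideanSpace ℝ (Fin N)) (v : ℝ≥0 → Ω → E → EuclideanSpace ℝ (Fin N))
    (Y : ℝ≥0 → Ω → EuclideanSpace ℝ (Fin N)) : Prop :=
  ∀ᵐ ω ∂μ, ∀ t : ℝ≥0,
    IntervalIntegrable (fun s : ℝ => G.dualDrift S v Y s.toNNReal ω) volume 0 t ∧
    Y t ω = y + (∫ s in (0 : ℝ)..t, G.dualDrift S v Y s.toNNReal ω) +
      ∑ k ∈ Finset.Icc 1 M, if G.time k ω ≤ t then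
        v (G.time k ω).toNNReal ω (G.mark k ω) else 0

/-- Exact null-controllability at time `T`: every initial condition can be steered to `0` at time
`T`, almost surely, by an admissible control. -/
def ExactlyNullControllable (T : ℝ≥0) : Prop :=
  ∀ x : EuclideanSpace ℝ (Fin N), ∃ u : ℝ≥0 → Ω → EuclideanSpace ℝ (Fin d),
    G.AdmissibleControl u ∧ ∃ X : ℝ≥0 → Ω → EuclideanSpace ℝ (Fin N),
      G.IsStateSolution S x u X ∧ ∀ᵐ ω ∂μ, X T ω = 0

/-- `p(y)² = inf_v E ∫_0^T |Π_{(ker B*(Γ_t))^⊥} Y_t^{y,v}|² dt`, as an element of `[0, ∞]`. -/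
noncomputable def dualCost (T : ℝ≥0) (y : EuclideanSpace ℝ (Fin N)) : ℝ≥0∞ :=
  ⨅ (v : ℝ≥0 → Ω → E → EuclideanSpace ℝ (Fin N)) (_ : G.AdmissibleDualControl v)
    (Y : ℝ≥0 → Ω → EuclideanSpace ℝ (Fin N)) (_ : G.IsDualSolution S y v Y),
    ∫⁻ ω, (∫⁻ t in Set.Icc (0 : ℝ) T,
      ‖(LinearMap.ker (S.B (G.mode t.toNNReal ω)).adjoint.toLinearMap)ᗮ.starProjection
        (Y t.toNNReal ω)‖ₑ ^ 2) ∂μ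

/-- The map `p`; it is only meaningful where `dualCost` is finite. -/
noncomputable def dualGauge (T : ℝ≥0) (y : EuclideanSpace ℝ (Fin N)) : ℝ :=
  Real.sqrt (G.dualCost S T y).toReal

end SwitchProcess

/-- A pseudonorm (seminorm) on a real vector space. -/
structure IsPseudonorm {V : Type*} [AddCommGroup V] [Module ℝ V] (p : V → ℝ) : Prop where
  nonneg : ∀ y, 0 ≤ p y
  smul : ∀ (a : ℝ) (y : V), p (a • y) = |a| * p y
  add_le : ∀ y z : V, p (y + z) ≤ p y + p z

/-- A norm on a real vector space. -/
structure IsNormFunction {V : Type*} [AddCommGroup V] [Module ℝ V] (p : V → ℝ) : Prop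
    extends IsPseudonorm p where
  eq_zero : ∀ y, p y = 0 → y = 0

/-! The dual equation is designed to pair with the state equation. Along a path, the terms in `A` in
d⟨X,Y⟩ cancel by adjointness, and everything produced by the jumps is an integral against the
compensated jump measure, which has mean zero. Hence E⟨X_T,Y_T⟩ = ⟨x,y⟩ + E∫₀ᵀ⟨u_t, B*(Γ_t)Y_t⟩dt
for all controls u and v (`inner_state_dual` pathwise, `integral_inner_eq` in expectation). There
are finitely many modes, so |B*(γ)z| and |Πz| are comparable uniformly in γ: p(y) measures how small
the observation B*Y can be made in L² by the choice of v.

Pseudonorm. The map (y,v) ↦ ΠY is linear into an L² space and p is the quotient seminorm of its norm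
along (y,v) ↦ y (`dualCost_eq`, `isPseudonorm_fibreGauge`). The choice v = 0 makes the infimum
finite.

Controllability implies norm. Steer x = y to 0 by some u. The duality gives |y|² = −E∫⟨u,B*Y⟩ ≤
K‖u‖‖ΠY‖ for every v, and the infimum over v gives |y|² ≤ K‖u‖p(y).

Norm implies controllability. In finite dimension a norm p satisfies |y| ≤ C p(y), so the functional
(y,v) ↦ −⟨x,y⟩ is dominated by ‖B*Y‖. By Hahn–Banach and Riesz (`exists_inner_eq_of_le`) it is the
pairing of B*Y with some u in L². For this u, E⟨X_T,Y_T⟩ = 0 for all (y,v). It remains to see that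
the Y_T are rich enough. Every bounded measurable function of the history up to T is some Y_T
(`exists_dualValue_eq`): with at most M jumps, the backward equation is solved explicitly by
recursion on the number of jumps still possible. The choice Y_T = X_T/(1+|X_T|²) forces X_T = 0
almost surely.

The probabilistic content is reduced to functions of histories, that is, of sequences of jump times
and marks. The natural filtration is generated by the stopped history, so progressive controls are
functions of (history up to t, t) and predictable ones of (history strictly before t, t)
(`exists_eq_upTo`, `exists_eq_before`). The L² space above is taken over the joint law of stopped
history and time, so that its elements are nonanticipating controls from the outset. Both equations
become linear differential equations with impulses, solved path by path through variation of
constants. The mean-zero property is the compensator formula `lintegral_compensator`, derived from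
the prescribed laws of waiting times and marks. -/

set_option linter.unusedSectionVars false

/-! ### Linear differential equations with integrable right-hand side -/

section LinearFlow

variable {F₁ F₂ F₃ : Type*} [NormedAddCommGroup F₁] [NormedSpace ℝ F₁] [CompleteSpace F₁]
  [NormedAddCommGroup F₂] [NormedSpace ℝ F₂] [CompleteSpace F₂]
  [NormedAddCommGroup F₃] [NormedSpace ℝ F₃] [CompleteSpace F₃]

/-- Fubini for `B (f r) (g s)` on the square `(a,b]²`, cut along the diagonal: the part `s ≤ r`
yields the first integral, the part `r < s` the second. Only integrability of `f` and `g` is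
available, so the classical product rule does not apply. -/
lemma setIntegral_bilin_primitive (B : F₁ →L[ℝ] F₂ →L[ℝ] F₃) {f : ℝ → F₁} {g : ℝ → F₂} {a b : ℝ}
    (hf : IntegrableOn f (Set.Ioc a b)) (hg : IntegrableOn g (Set.Ioc a b)) :
    IntegrableOn (fun r => B (f r) (∫ s in Set.Ioc a r, g s)) (Set.Ioc a b) ∧
    IntegrableOn (fun r => B (∫ s in Set.Ioc a r, f s) (g r)) (Set.Ioc a b) ∧
    (∫ r in Set.Ioc a b, B (f r) (∫ s in Set.Ioc a r, g s)) +
      (∫ r in Set.Ioc a b, B (∫ s in Set.Ioc a r, f s) (g r)) =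
      B (∫ r in Set.Ioc a b, f r) (∫ r in Set.Ioc a b, g r) := by
  set μ : Measure ℝ := volume.restrict (Set.Ioc a b) with hμ
  have hk : Integrable (fun z : ℝ × ℝ => B (f z.1) (g z.2)) (μ.prod μ) := by
    refine Integrable.op_fst_snd (op := fun x y => B x y) ?_ ⟨‖B‖, fun x y => B.le_opNorm₂ x y⟩ hf hg
    exact B.isBoundedBilinearMap.continuous
  set S : Set (ℝ × ℝ) := {z | z.2 ≤ z.1} with hS
  have hSm : MeasurableSet S := measurableSet_le measurable_snd measurable_fst
  have h1 : ∀ r ∈ Set.Ioc a b, ∫ s, S.indicator (fun z => B (f z.1) (g z.2)) (r, s) ∂μ =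
      B (f r) (∫ s in Set.Ioc a r, g s) := by
    intro r hr
    have e : (fun s => S.indicator (fun z => B (f z.1) (g z.2)) (r, s)) =
        (Set.Iic r).indicator (fun s => B (f r) (g s)) := by
      ext s; simp [Set.indicator, hS]
    rw [e, integral_indicator measurableSet_Iic, hμ, Measure.restrict_restrict measurableSet_Iic]
    have e2 : Set.Iic r ∩ Set.Ioc a b = Set.Ioc a r := by
      ext s; simp only [Set.mem_inter_iff, Set.mem_Iic, Set.mem_Ioc] at *; grind
    rw [e2]
    exact (B (f r)).integral_comp_comm (hg.mono_set (Set.Ioc_subset_Ioc_right hr.2))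
  have h2 : ∀ s ∈ Set.Ioc a b, ∫ r, Sᶜ.indicator (fun z => B (f z.1) (g z.2)) (r, s) ∂μ =
      B (∫ r in Set.Ioc a s, f r) (g s) := by
    intro s hs
    have e : (fun r => Sᶜ.indicator (fun z => B (f z.1) (g z.2)) (r, s)) =
        (Set.Iio s).indicator (fun r => B.flip (g s) (f r)) := by
      ext r; simp [Set.indicator, hS]
    rw [e, integral_indicator measurableSet_Iio, hμ, Measure.restrict_restrict measurableSet_Iio]
    have e2 : Set.Iio s ∩ Set.Ioc a b = Set.Ioo a s := by
      ext r; simp only [Set.mem_inter_iff, Set.mem_Iio, Set.mem_Ioc, Set.mem_Ioo] at *; grind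
    -- The diagonal was given to the first half of the square, so an open interval appears here; the
    -- end point is null.
    rw [e2, ← integral_Ioc_eq_integral_Ioo]
    exact (B.flip (g s)).integral_comp_comm (hf.mono_set (Set.Ioc_subset_Ioc_right hs.2))
  have i1 := hk.indicator hSm
  have i2 := hk.indicator hSm.compl
  have j1 := i1.integral_prod_left
  have j2 := i2.swap.integral_prod_left
  have c1 : (fun r => ∫ s, S.indicator (fun z => B (f z.1) (g z.2)) (r, s) ∂μ) =ᵐ[μ]
      fun r => B (f r) (∫ s in Set.Ioc a r, g s) :=
    (ae_restrict_iff' measurableSet_Ioc).2 (ae_of_all _ h1)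
  have c2 : (fun s => ∫ r, Sᶜ.indicator (fun z => B (f z.1) (g z.2)) (r, s) ∂μ) =ᵐ[μ]
      fun s => B (∫ r in Set.Ioc a s, f r) (g s) :=
    (ae_restrict_iff' measurableSet_Ioc).2 (ae_of_all _ h2)
  refine ⟨j1.congr c1, j2.congr c2, ?_⟩
  rw [← integral_congr_ae c1, ← integral_congr_ae c2, ← integral_prod _ i1]
  have : ∫ s, ∫ r, Sᶜ.indicator (fun z => B (f z.1) (g z.2)) (r, s) ∂μ ∂μ =
      ∫ z, Sᶜ.indicator (fun z => B (f z.1) (g z.2)) z ∂(μ.prod μ) := by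
    rw [integral_prod_symm _ i2]
  rw [this, ← integral_add i1 i2]
  have e3 : ∀ z, S.indicator (fun z => B (f z.1) (g z.2)) z +
      Sᶜ.indicator (fun z => B (f z.1) (g z.2)) z = B (f z.1) (g z.2) := fun z =>
    Set.indicator_self_add_compl_apply S _ z
  simp_rw [e3]
  rw [integral_prod _ hk]
  have e4 : ∀ r, ∫ s, B (f r) (g s) ∂μ = B.flip (∫ s, g s ∂μ) (f r) := fun r =>
    (B (f r)).integral_comp_comm hg
  simp_rw [e4]
  exact (B.flip (∫ s, g s ∂μ)).integral_comp_comm hf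

lemma bilin_primitive_of_le (B : F₁ →L[ℝ] F₂ →L[ℝ] F₃) {f f' : ℝ → F₁} {g g' : ℝ → F₂} {a b : ℝ}
    (hab : a ≤ b) (hf' : IntervalIntegrable f' volume a b) (hg' : IntervalIntegrable g' volume a b)
    (hf : ∀ r ∈ Set.uIcc a b, f r = f a + ∫ s in a..r, f' s)
    (hg : ∀ r ∈ Set.uIcc a b, g r = g a + ∫ s in a..r, g' s) :
    IntervalIntegrable (fun r => B (f' r) (g r) + B (f r) (g' r)) volume a b ∧
    B (f b) (g b) = B (f a) (g a) + ∫ r in a..b, (B (f' r) (g r) + B (f r) (g' r)) := by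
  rw [intervalIntegrable_iff_integrableOn_Ioc_of_le hab] at hf' hg' ⊢
  obtain ⟨k1, k2, k3⟩ := setIntegral_bilin_primitive B hf' hg'
  have l1 : IntegrableOn (fun r => B (f' r) (g a)) (Set.Ioc a b) :=
    (B.flip (g a)).integrable_comp hf'
  have l2 : IntegrableOn (fun r => B (f a) (g' r)) (Set.Ioc a b) := (B (f a)).integrable_comp hg'
  have e : ∀ r ∈ Set.Ioc a b, (B (f' r) (g a) + B (f' r) (∫ s in Set.Ioc a r, g' s)) +
      (B (f a) (g' r) + B (∫ s in Set.Ioc a r, f' s) (g' r)) =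
      B (f' r) (g r) + B (f r) (g' r) := by
    intro r hr
    have hr' : r ∈ Set.uIcc a b := by rw [Set.uIcc_of_le hab]; exact Set.Ioc_subset_Icc_self hr
    rw [hf r hr', hg r hr', intervalIntegral.integral_of_le hr.1.le,
      intervalIntegral.integral_of_le hr.1.le]
    simp
  refine ⟨((l1.add k1).add (l2.add k2)).congr_fun e measurableSet_Ioc, ?_⟩
  have hs : ∫ r in Set.Ioc a b, (B (f' r) (g r) + B (f r) (g' r)) =
      ((∫ r in Set.Ioc a b, B (f' r) (g a)) +
        ∫ r in Set.Ioc a b, B (f' r) (∫ s in Set.Ioc a r, g' s)) +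
      ((∫ r in Set.Ioc a b, B (f a) (g' r)) +
        ∫ r in Set.Ioc a b, B (∫ s in Set.Ioc a r, f' s) (g' r)) := by
    rw [← integral_add l1 k1, ← integral_add l2 k2, ← integral_add]
    · exact (setIntegral_congr_fun measurableSet_Ioc e).symm
    · exact l1.add k1
    · exact l2.add k2
  rw [intervalIntegral.integral_of_le hab, hs]
  have e1 : ∫ r in Set.Ioc a b, B (f' r) (g a) = B (∫ r in Set.Ioc a b, f' r) (g a) :=
    (B.flip (g a)).integral_comp_comm hf'
  have e2 : ∫ r in Set.Ioc a b, B (f a) (g' r) = B (f a) (∫ r in Set.Ioc a b, g' r) :=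
    (B (f a)).integral_comp_comm hg'
  have hb : b ∈ Set.uIcc a b := Set.right_mem_uIcc
  rw [e1, e2, hf b hb, hg b hb, intervalIntegral.integral_of_le hab,
    intervalIntegral.integral_of_le hab]
  simp only [map_add, add_apply]
  rw [← k3]
  abel

omit [CompleteSpace F₁] in
lemma eq_primitive_right {w w' : ℝ → F₁} {a b : ℝ} (hw' : IntervalIntegrable w' volume a b)
    (hw : ∀ r ∈ Set.uIcc a b, w r = w a + ∫ s in a..r, w' s) :
    ∀ r ∈ Set.uIcc b a, w r = w b + ∫ s in b..r, w' s := by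
  intro r hr
  rw [Set.uIcc_comm] at hr
  rw [hw r hr, hw b Set.right_mem_uIcc, add_assoc,
    intervalIntegral.integral_add_adjacent_intervals hw']
  exact (hw'.symm.trans (hw'.mono_set (Set.uIcc_subset_uIcc_left hr)))

/-- Integration by parts for primitives of integrable functions paired by a bilinear map. -/
theorem bilin_primitive (B : F₁ →L[ℝ] F₂ →L[ℝ] F₃) {f f' : ℝ → F₁} {g g' : ℝ → F₂} {a b : ℝ}
    (hf' : IntervalIntegrable f' volume a b) (hg' : IntervalIntegrable g' volume a b)
    (hf : ∀ r ∈ Set.uIcc a b, f r = f a + ∫ s in a..r, f' s)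
    (hg : ∀ r ∈ Set.uIcc a b, g r = g a + ∫ s in a..r, g' s) :
    IntervalIntegrable (fun r => B (f' r) (g r) + B (f r) (g' r)) volume a b ∧
    B (f b) (g b) = B (f a) (g a) + ∫ r in a..b, (B (f' r) (g r) + B (f r) (g' r)) := by
  rcases le_total a b with hab | hab
  · exact bilin_primitive_of_le B hab hf' hg' hf hg
  · obtain ⟨h1, h2⟩ := bilin_primitive_of_le B hab hf'.symm hg'.symm
      (eq_primitive_right hf' hf) (eq_primitive_right hg' hg)
    refine ⟨h1.symm, ?_⟩
    rw [h2, intervalIntegral.integral_symm a b]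
    abel

variable {V : Type*} [NormedAddCommGroup V] [NormedSpace ℝ V] [CompleteSpace V]

/-- Variation of constants for `w' = L w + g`, `w a = w₀`. -/
noncomputable def linearFlow (L : V →L[ℝ] V) (a : ℝ) (w₀ : V) (g : ℝ → V) (t : ℝ) : V :=
  NormedSpace.exp ((t - a) • L) (w₀ + ∫ s in a..t, NormedSpace.exp (-(s - a) • L) (g s))

lemma continuous_exp_smul (L : V →L[ℝ] V) : Continuous fun t : ℝ => NormedSpace.exp (t • L) :=
  continuous_iff_continuousAt.2 fun t => (hasDerivAt_exp_smul_const L t).continuousAt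

lemma exp_smul_eq_primitive (L : V →L[ℝ] V) (a r : ℝ) :
    NormedSpace.exp ((r - a) • L) = NormedSpace.exp ((a - a) • L) +
      ∫ s in a..r, L * NormedSpace.exp ((s - a) • L) := by
  have hd : ∀ s, HasDerivAt (fun s : ℝ => NormedSpace.exp ((s - a) • L))
      (L * NormedSpace.exp ((s - a) • L)) s := fun s => by
    simpa using (hasDerivAt_exp_smul_const' L (s - a)).comp_sub_const s a
  rw [intervalIntegral.integral_eq_sub_of_hasDerivAt (fun s _ => hd s)]
  · abel
  · refine Continuous.intervalIntegrable ?_ _ _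
    exact continuous_const.mul ((continuous_exp_smul L).comp (continuous_id.sub continuous_const))

lemma exp_neg_smul_eq_primitive (L : V →L[ℝ] V) (a r : ℝ) :
    NormedSpace.exp (-(r - a) • L) = NormedSpace.exp (-(a - a) • L) +
      ∫ s in a..r, -(NormedSpace.exp (-(s - a) • L) * L) := by
  have hd : ∀ s, HasDerivAt (fun s : ℝ => NormedSpace.exp (-(s - a) • L))
      (-(NormedSpace.exp (-(s - a) • L) * L)) s := fun s => by
    have h1 : HasDerivAt (fun s : ℝ => -(s - a)) (-1) s := ((hasDerivAt_id' s).sub_const a).fun_neg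
    have := (hasDerivAt_exp_smul_const L (-(s - a))).scomp s h1
    rw [neg_one_smul] at this
    exact this
  rw [intervalIntegral.integral_eq_sub_of_hasDerivAt (fun s _ => hd s)]
  · abel
  · refine Continuous.intervalIntegrable ?_ _ _
    exact (((continuous_exp_smul L).comp (continuous_id.sub continuous_const).neg).mul
      continuous_const).neg

lemma exp_mul_exp_neg (L : V →L[ℝ] V) (t : ℝ) :
    NormedSpace.exp (t • L) * NormedSpace.exp (-t • L) = 1 := by
  let _ : NormedAlgebra ℚ (V →L[ℝ] V) := NormedAlgebra.restrictScalars ℚ ℝ _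
  rw [← NormedSpace.exp_add_of_commute, neg_smul, add_neg_cancel, NormedSpace.exp_zero]
  exact ((Commute.refl L).smul_left t).smul_right (-t)

omit [CompleteSpace V] in
lemma norm_exp_smul_le (L : V →L[ℝ] V) {K r t : ℝ} (hL : ‖L‖ ≤ K) (ht : |t| ≤ r) :
    ‖NormedSpace.exp (t • L)‖ ≤ Real.exp (r * K) := by
  have hr : 0 ≤ r := (abs_nonneg t).trans ht
  have hx : ‖t • L‖ ≤ r * K := by
    rw [norm_smul]
    exact mul_le_mul ht hL (norm_nonneg _) hr
  have hn : ∀ n : ℕ, ‖((n.factorial : ℝ)⁻¹ • (t • L) ^ n : V →L[ℝ] V)‖ ≤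
      (r * K) ^ n / n.factorial := by
    intro n
    rw [norm_smul, norm_inv, Real.norm_natCast, inv_mul_eq_div]
    refine div_le_div_of_nonneg_right ?_ (by positivity)
    -- The zeroth power is separate: the identity operator has norm at most 1, with norm 0 on the
    -- trivial space.
    rcases n with _ | n
    · simpa [ContinuousLinearMap.one_def] using ContinuousLinearMap.norm_id_le (𝕜 := ℝ) (E := V)
    · exact (norm_pow_le' _ n.succ_pos).trans (pow_le_pow_left₀ (norm_nonneg _) hx _)
  rw [NormedSpace.exp_eq_tsum ℝ, Real.exp_eq_exp_ℝ, NormedSpace.exp_eq_tsum_div]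
  exact tsum_of_norm_bounded (NormedSpace.expSeries_div_summable (r * K)).hasSum hn

lemma IntervalIntegrable.exp_apply {g : ℝ → V} {a b : ℝ} (hg : IntervalIntegrable g volume a b)
    (L : V →L[ℝ] V) (c : ℝ) :
    IntervalIntegrable (fun s => NormedSpace.exp (-(s - c) • L) (g s)) volume a b := by
  have hc : Continuous fun s : ℝ => NormedSpace.exp (-(s - c) • L) :=
    (continuous_exp_smul L).comp (continuous_id.sub continuous_const).neg
  refine (hg.norm.const_mul (Real.exp ((|a - c| + |b - c|) * ‖L‖))).mono_fun' ?_ ?_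
  · exact isBoundedBilinearMap_apply.continuous.comp_aestronglyMeasurable
      (hc.aestronglyMeasurable.prodMk (intervalIntegrable_iff.1 hg).aestronglyMeasurable)
  · refine (ae_restrict_iff' measurableSet_uIoc).2 (ae_of_all _ fun s hs => ?_)
    refine (ContinuousLinearMap.le_opNorm _ _).trans ?_
    refine mul_le_mul_of_nonneg_right (norm_exp_smul_le L le_rfl ?_) (norm_nonneg _)
    rcases Set.mem_uIcc.1 (Set.uIoc_subset_uIcc hs) with h | h <;> grind

omit [CompleteSpace V] in
@[simp] lemma linearFlow_self (L : V →L[ℝ] V) (a : ℝ) (w₀ : V) (g : ℝ → V) :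
    linearFlow L a w₀ g a = w₀ := by
  simp [linearFlow, NormedSpace.exp_zero]

lemma linearFlow_continuousOn (L : V →L[ℝ] V) (w₀ : V) {g : ℝ → V} {a b : ℝ}
    (hg : IntervalIntegrable g volume a b) :
    ContinuousOn (linearFlow L a w₀ g) (Set.uIcc a b) := by
  have h1 : ContinuousOn (fun t => ∫ s in a..t, NormedSpace.exp (-(s - a) • L) (g s))
      (Set.uIcc a b) :=
    intervalIntegral.continuousOn_primitive_interval' (hg.exp_apply L a) Set.left_mem_uIcc
  exact ContinuousOn.clm_apply ((continuous_exp_smul L).comp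
    (continuous_id.sub continuous_const)).continuousOn (continuousOn_const.add h1)

/-- Product rule applied to `exp ((t-a)L)` and the bracket of the variation of constants formula,
paired by evaluation. The equation is in integral form because `g` is merely integrable. -/
theorem linearFlow_eq (L : V →L[ℝ] V) (w₀ : V) {g : ℝ → V} {a b : ℝ}
    (hg : IntervalIntegrable g volume a b) :
    IntervalIntegrable (fun s => L (linearFlow L a w₀ g s) + g s) volume a b ∧
    linearFlow L a w₀ g b = w₀ + ∫ s in a..b, (L (linearFlow L a w₀ g s) + g s) := by
  have hI := hg.exp_apply L a
  have hc : Continuous fun s : ℝ => L * NormedSpace.exp ((s - a) • L) :=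
    continuous_const.mul ((continuous_exp_smul L).comp (continuous_id.sub continuous_const))
  obtain ⟨h1, h2⟩ := bilin_primitive (ContinuousLinearMap.id ℝ (V →L[ℝ] V))
    (f := fun s => NormedSpace.exp ((s - a) • L)) (f' := fun s => L * NormedSpace.exp ((s - a) • L))
    (g := fun t => w₀ + ∫ s in a..t, NormedSpace.exp (-(s - a) • L) (g s))
    (g' := fun s => NormedSpace.exp (-(s - a) • L) (g s)) (a := a) (b := b)
    (hc.intervalIntegrable _ _) hI (fun r _ => exp_smul_eq_primitive L a r) (fun r _ => by simp)
  have e : ∀ s, (ContinuousLinearMap.id ℝ (V →L[ℝ] V)) (L * NormedSpace.exp ((s - a) • L))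
      (w₀ + ∫ s in a..s, NormedSpace.exp (-(s - a) • L) (g s)) +
      (ContinuousLinearMap.id ℝ (V →L[ℝ] V)) (NormedSpace.exp ((s - a) • L))
        (NormedSpace.exp (-(s - a) • L) (g s)) = L (linearFlow L a w₀ g s) + g s := by
    intro s
    have := congrArg (fun T : V →L[ℝ] V => T (g s)) (exp_mul_exp_neg L (s - a))
    simp only [mul_apply_eq_comp, one_apply_eq_self] at this
    simp only [ContinuousLinearMap.coe_id', id_eq, mul_apply_eq_comp, this]
    rfl
  simp_rw [e] at h1 h2
  refine ⟨h1, ?_⟩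
  simpa [linearFlow, NormedSpace.exp_zero] using h2

/-- Multiply by the integrating factor: by the product rule `exp (-(s-a)L) (w s)` is a primitive of
`exp (-(s-a)L) (g s)`, which determines `w b`. No Gronwall estimate is needed. -/
theorem linearFlow_unique (L : V →L[ℝ] V) {w g : ℝ → V} {a b : ℝ}
    (hi : IntervalIntegrable (fun s => L (w s) + g s) volume a b)
    (hw : ∀ r ∈ Set.uIcc a b, w r = w a + ∫ s in a..r, (L (w s) + g s)) :
    w b = linearFlow L a (w a) g b := by
  have hc : Continuous fun s : ℝ => -(NormedSpace.exp (-(s - a) • L) * L) :=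
    (((continuous_exp_smul L).comp (continuous_id.sub continuous_const).neg).mul
      continuous_const).neg
  obtain ⟨-, h2⟩ := bilin_primitive (ContinuousLinearMap.id ℝ (V →L[ℝ] V))
    (f := fun s => NormedSpace.exp (-(s - a) • L))
    (f' := fun s => -(NormedSpace.exp (-(s - a) • L) * L))
    (g := w) (g' := fun s => L (w s) + g s) (a := a) (b := b)
    (hc.intervalIntegrable _ _) hi (fun r _ => exp_neg_smul_eq_primitive L a r) hw
  have e : ∀ s, (ContinuousLinearMap.id ℝ (V →L[ℝ] V)) (-(NormedSpace.exp (-(s - a) • L) * L))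
      (w s) + (ContinuousLinearMap.id ℝ (V →L[ℝ] V)) (NormedSpace.exp (-(s - a) • L))
        (L (w s) + g s) = NormedSpace.exp (-(s - a) • L) (g s) := by
    intro s
    simp
  simp_rw [e] at h2
  simp only [ContinuousLinearMap.coe_id', id_eq, sub_self, neg_zero, zero_smul, NormedSpace.exp_zero,
    one_apply_eq_self] at h2
  rw [linearFlow, ← h2]
  have := congrArg (fun T : V →L[ℝ] V => T (w b)) (exp_mul_exp_neg L (b - a))
  simpa using this.symm

omit [CompleteSpace V] in
/-- A bound for the variation of constants formula. -/
lemma norm_linearFlow_le (L : V →L[ℝ] V) {K r : ℝ} (hL : ‖L‖ ≤ K) (w₀ : V) {g : ℝ → V} {a b : ℝ}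
    (hg : IntervalIntegrable g volume a b) (hr : |b - a| ≤ r) :
    ‖linearFlow L a w₀ g b‖ ≤ Real.exp (r * K) * (‖w₀‖ + Real.exp (r * K) * |∫ s in a..b, ‖g s‖|) := by
  refine (ContinuousLinearMap.le_opNorm _ _).trans ?_
  refine mul_le_mul (norm_exp_smul_le L hL hr) ?_ (norm_nonneg _) (Real.exp_pos _).le
  refine (norm_add_le _ _).trans (add_le_add le_rfl ?_)
  have habs : Real.exp (r * K) * |∫ s in a..b, ‖g s‖| =
      |∫ s in a..b, Real.exp (r * K) * ‖g s‖| := by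
    rw [intervalIntegral.integral_const_mul, abs_mul, abs_of_pos (Real.exp_pos (r * K))]
  rw [habs]
  refine intervalIntegral.norm_integral_le_abs_of_norm_le ?_ (hg.norm.const_mul _)
  refine (ae_restrict_iff' measurableSet_uIoc).2 (ae_of_all _ fun s hs => ?_)
  refine (ContinuousLinearMap.le_opNorm _ _).trans ?_
  refine mul_le_mul_of_nonneg_right (norm_exp_smul_le L hL ?_) (norm_nonneg _)
  rw [abs_neg]
  refine le_trans ?_ hr
  have := Set.uIoc_subset_uIcc hs
  exact Set.abs_sub_left_of_mem_uIcc this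

end LinearFlow

/-! ### Histories of jumps and their truncations -/

/-- A sequence of jump times and marks. -/
abbrev History (E : Type*) := ℕ → ℝ≥0∞ × E

namespace History

variable {E : Type*}

/-- Forget everything after the `n`-th jump. -/
def trunc (n : ℕ) (h : History E) : History E := fun k => if k ≤ n then h k else (∞, (h 0).2)

/-- Forget everything after time `t`. -/
noncomputable def upTo (t : ℝ≥0) (h : History E) : History E :=
  fun k => if (h k).1 ≤ t then h k else (∞, (h 0).2)

/-- Forget everything from time `t` on. -/
noncomputable def before (t : ℝ≥0) (h : History E) : History E :=
  fun k => if (h k).1 < t then h k else (∞, (h 0).2)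

/-- The number of jumps in a history. -/
noncomputable def count (M : ℕ) (h : History E) : ℕ :=
  ∑ k ∈ Finset.Icc 1 M, if (h k).1 < ∞ then 1 else 0

/-- The last mark of a history. -/
noncomputable def last (M : ℕ) (h : History E) : E := (h (count M h)).2

/-- The `n`-th jump time as a real number. -/
noncomputable def time (n : ℕ) (h : History E) : ℝ := (h n).1.toReal

/-- The admissible sequences of at most `M` jumps. -/
structure IsPath (M : ℕ) (p : History E) : Prop where
  zero : (p 0).1 = 0
  mono : Monotone fun n => (p n).1
  lt : ∀ n, (p n).1 < ∞ → (p n).1 < (p (n + 1)).1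
  last_eq : (p (M + 1)).1 = ∞

lemma time_nonneg (n : ℕ) (h : History E) : 0 ≤ time n h := ENNReal.toReal_nonneg

/-- This is an exact equality because forgotten entries are filled with the mark of index 0, which
truncation never alters. The same filler avoids choosing a default mode. -/
lemma trunc_trunc {m n : ℕ} (hmn : m ≤ n) (h : History E) : trunc m (trunc n h) = trunc m h := by
  funext k
  simp only [trunc, Nat.zero_le, if_true]
  split_ifs <;> first | rfl | omega

lemma trunc_apply_of_le {k n : ℕ} (hkn : k ≤ n) (h : History E) : trunc n h k = h k := by
  simp [trunc, hkn]

lemma time_trunc {k n : ℕ} (hkn : k ≤ n) (h : History E) : time k (trunc n h) = time k h := by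
  simp [time, trunc, hkn]

namespace IsPath

variable {M : ℕ} {p : History E} (hp : IsPath M p)
include hp

lemma le_of_lt_top {n : ℕ} (h : (p n).1 < ∞) : n ≤ M := by
  by_contra hn
  have := hp.mono (show M + 1 ≤ n by omega)
  simp only [hp.last_eq] at this
  exact absurd h (by simpa using this)

lemma upTo_eq {n : ℕ} {t : ℝ≥0} (h1 : (p n).1 ≤ t) (h2 : t < (p (n + 1)).1) :
    upTo t p = trunc n p := by
  funext k
  simp only [upTo, trunc]
  by_cases hk : k ≤ n
  · rw [if_pos ((hp.mono hk).trans h1), if_pos hk]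
  · rw [if_neg (not_le.2 (h2.trans_le (hp.mono (by omega)))), if_neg hk]

lemma before_eq {n : ℕ} {t : ℝ≥0} (h1 : (p n).1 < t) (h2 : t ≤ (p (n + 1)).1) :
    before t p = trunc n p := by
  funext k
  simp only [before, trunc]
  by_cases hk : k ≤ n
  · rw [if_pos ((hp.mono hk).trans_lt h1), if_pos hk]
  · rw [if_neg (not_lt.2 (h2.trans (hp.mono (by omega)))), if_neg hk]

/-- The jump of index `M + 1` is at `∞`, so the jump times cannot all stay below `t`. -/
lemma exists_mem (t : ℝ≥0) : ∃ n, (p n).1 ≤ t ∧ t < (p (n + 1)).1 := by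
  by_contra! H
  have : ∀ n, (p n).1 ≤ t := by
    intro n
    induction n with
    | zero => simp [hp.zero]
    | succ n ih => exact H n ih
  have := this (M + 1)
  simp [hp.last_eq] at this

lemma sum_jumps {F : Type*} [AddCommMonoid F] (J : ℕ → F) {n : ℕ} {t : ℝ≥0} (h1 : (p n).1 ≤ t)
    (h2 : t < (p (n + 1)).1) :
    (∑ k ∈ Finset.Icc 1 M, if (p k).1 ≤ t then J k else 0) = ∑ k ∈ Finset.Icc 1 n, J k := by
  have hn : n ≤ M := hp.le_of_lt_top (h1.trans_lt coe_lt_top)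
  rw [← Finset.sum_filter]
  refine Finset.sum_congr ?_ fun _ _ => rfl
  ext k
  simp only [Finset.mem_filter, Finset.mem_Icc]
  constructor
  · rintro ⟨⟨hk, -⟩, hkt⟩
    refine ⟨hk, ?_⟩
    by_contra hkn
    exact absurd (h2.trans_le (hp.mono (show n + 1 ≤ k by omega))) (not_lt.2 hkt)
  · rintro ⟨hk, hkn⟩
    exact ⟨⟨hk, hkn.trans hn⟩, (hp.mono hkn).trans h1⟩

lemma count_trunc {n : ℕ} (h : (p n).1 < ∞) : count M (trunc n p) = n := by
  obtain ⟨t, ht⟩ : ∃ t : ℝ≥0, (p n).1 = t := ⟨_, (ENNReal.coe_toNNReal h.ne).symm⟩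
  have h1 : (p n).1 ≤ t := ht.le
  have h2 : t < (p (n + 1)).1 := by rw [← ht]; exact hp.lt n h
  have := hp.sum_jumps (fun _ => 1) h1 h2
  simp only [Finset.sum_const, Nat.card_Icc, smul_eq_mul, mul_one, Nat.add_sub_cancel] at this
  rw [← hp.upTo_eq h1 h2, count]
  refine Eq.trans ?_ this
  refine Finset.sum_congr rfl fun k _ => ?_
  by_cases hk : (p k).1 ≤ t
  · simp [upTo, hk, hk.trans_lt coe_lt_top]
  · simp [upTo, hk]

lemma last_trunc {n : ℕ} (h : (p n).1 < ∞) : last M (trunc n p) = (p n).2 := by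
  rw [last, hp.count_trunc h, trunc_apply_of_le le_rfl]

lemma lt_top_trunc {n : ℕ} (h : (p n).1 < ∞) : (trunc n p M).1 < ∞ ↔ n = M := by
  have hn := hp.le_of_lt_top h
  constructor
  · intro H
    by_contra hne
    have : ¬ M ≤ n := by omega
    simp [trunc, this] at H
  · rintro rfl
    rwa [trunc_apply_of_le le_rfl]

lemma count_upTo {n : ℕ} {t : ℝ≥0} (h1 : (p n).1 ≤ t) (h2 : t < (p (n + 1)).1) :
    count M (upTo t p) = n := by
  rw [hp.upTo_eq h1 h2, hp.count_trunc (h1.trans_lt coe_lt_top)]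

lemma time_zero : time 0 p = 0 := by simp [time, hp.zero]

lemma mem_of_mem_Ico {n : ℕ} {s : ℝ} {b : ℝ} (hn : (p n).1 < ∞) (hb : ENNReal.ofReal b ≤ (p (n + 1)).1)
    (hs : s ∈ Set.Ico (time n p) b) : (p n).1 ≤ s.toNNReal ∧ s.toNNReal < (p (n + 1)).1 := by
  have h0 : 0 ≤ time n p := time_nonneg n p
  refine ⟨?_, lt_of_lt_of_le ?_ hb⟩
  · rw [← ENNReal.ofReal_toReal hn.ne]
    exact ENNReal.ofReal_le_ofReal hs.1
  · exact (ENNReal.ofReal_lt_ofReal_iff (lt_of_le_of_lt (h0.trans hs.1) hs.2)).2 hs.2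

end IsPath

end History

/-! ### Linear systems with impulses: uniqueness and existence -/

lemma leftLim_eq_of_eqOn {V : Type*} [NormedAddCommGroup V] {W : ℝ≥0 → V} {F : ℝ → V} {a : ℝ}
    {b : ℝ≥0} (ha : 0 ≤ a) (hab : a < b) (hF : ContinuousOn F (Set.Icc a b))
    (hW : ∀ t : ℝ≥0, a ≤ t → t < b → W t = F t) : Function.leftLim W b = F b := by
  have hb : (0 : ℝ≥0) < b := by exact_mod_cast ha.trans_lt hab
  -- Since `b > 0`, the left neighbourhoods of `b` in `ℝ≥0` are nontrivial and the left limit is a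
  -- genuine limit.
  have : (nhdsWithin b (Set.Iio b)).NeBot := nhdsLT_neBot_of_exists_lt ⟨0, hb⟩
  refine leftLim_eq_of_tendsto ?_
  have h1 : Filter.Tendsto F (nhdsWithin (b : ℝ) (Set.Icc a b)) (nhds (F b)) :=
    hF b (Set.right_mem_Icc.2 hab.le)
  have h2 : Filter.Tendsto (fun t : ℝ≥0 => (t : ℝ)) (nhdsWithin b (Set.Iio b))
      (nhdsWithin (b : ℝ) (Set.Icc a b)) := by
    refine tendsto_nhdsWithin_iff.2 ⟨(NNReal.continuous_coe.tendsto b).mono_left nhdsWithin_le_nhds, ?_⟩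
    have : Set.Ioo a.toNNReal b ∈ nhdsWithin b (Set.Iio b) :=
      Ioo_mem_nhdsLT (by rwa [Real.toNNReal_lt_iff_lt_coe ha])
    filter_upwards [this] with t ht
    exact ⟨(Real.toNNReal_lt_iff_lt_coe ha).1 ht.1 |>.le, by exact_mod_cast ht.2.le⟩
  refine (h1.comp h2).congr' ?_
  have : Set.Ioo a.toNNReal b ∈ nhdsWithin b (Set.Iio b) :=
      Ioo_mem_nhdsLT (by rwa [Real.toNNReal_lt_iff_lt_coe ha])
  filter_upwards [this] with t ht
  exact (hW t ((Real.toNNReal_lt_iff_lt_coe ha).1 ht.1).le ht.2).symm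

open History

/-- A linear system with impulses at the jumps of a history. -/
structure ImpulsiveSystem (E V : Type*) [NormedAddCommGroup V] [NormedSpace ℝ V] where
  /-- the linear drift -/
  L : History E → V →L[ℝ] V
  /-- the inhomogeneous drift -/
  g : History E → ℝ → V
  /-- the linear part of the impulses -/
  D : History E → E → V →L[ℝ] V
  /-- the inhomogeneous part of the impulses -/
  j : History E → ℝ → E → V
  /-- the initial value -/
  w₀ : V

namespace ImpulsiveSystem

variable {E V : Type*} [NormedAddCommGroup V] [NormedSpace ℝ V]
  (Z : ImpulsiveSystem E V)

/-- The solution after `n` jumps. -/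
noncomputable def sol : ℕ → History E → ℝ → V
  | 0, h => linearFlow (Z.L (trunc 0 h)) (time 0 h) Z.w₀ (Z.g (trunc 0 h))
  | n + 1, h => linearFlow (Z.L (trunc (n + 1) h)) (time (n + 1) h)
      (sol n h (time (n + 1) h) + Z.D (trunc n h) (h (n + 1)).2 (sol n h (time (n + 1) h)) +
        Z.j (trunc n h) (time (n + 1) h) (h (n + 1)).2)
      (Z.g (trunc (n + 1) h))

lemma sol_zero_time (h : History E) : Z.sol 0 h (time 0 h) = Z.w₀ := by
  simp [sol]

lemma sol_succ_time (n : ℕ) (h : History E) : Z.sol (n + 1) h (time (n + 1) h) =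
    Z.sol n h (time (n + 1) h) + Z.D (trunc n h) (h (n + 1)).2 (Z.sol n h (time (n + 1) h)) +
        Z.j (trunc n h) (time (n + 1) h) (h (n + 1)).2 := by
  simp [sol]

lemma sol_eq_linearFlow (n : ℕ) (h : History E) : Z.sol n h =
    linearFlow (Z.L (trunc n h)) (time n h) (Z.sol n h (time n h)) (Z.g (trunc n h)) := by
  cases n with
  | zero => rw [sol_zero_time]; rfl
  | succ n => rw [sol_succ_time]; rfl

/-- Nonanticipation: after `n` jumps the solution reads only the entries of index at most `n`. This
makes it a function of the stopped history. -/
lemma sol_trunc (n m : ℕ) (hnm : n ≤ m) (h : History E) : Z.sol n (trunc m h) = Z.sol n h := by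
  induction n with
  | zero => simp [sol, trunc_trunc hnm, time_trunc hnm]
  | succ n ih =>
    simp [sol, trunc_trunc hnm, time_trunc hnm, ih (by omega), trunc_trunc (show n ≤ m by omega),
      trunc_apply_of_le hnm]

/-- The drift along a path. -/
noncomputable def drift (p : History E) (W : ℝ≥0 → V) (s : ℝ) : V :=
  Z.L (upTo s.toNNReal p) (W s.toNNReal) + Z.g (upTo s.toNNReal p) s

/-- The impulse at the `k`-th jump. -/
noncomputable def impulse (p : History E) (W : ℝ≥0 → V) (k : ℕ) : V :=
  Z.D (trunc (k - 1) p) (p k).2 (Function.leftLim W (p k).1.toNNReal) +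
    Z.j (trunc (k - 1) p) (time k p) (p k).2

/-- `W` solves the impulsive system along the path `p`. -/
def Solves (M : ℕ) (p : History E) (W : ℝ≥0 → V) : Prop :=
  ∀ t : ℝ≥0, IntervalIntegrable (Z.drift p W) volume 0 t ∧
    W t = Z.w₀ + (∫ s in (0 : ℝ)..t, Z.drift p W s) +
      ∑ k ∈ Finset.Icc 1 M, if (p k).1 ≤ t then Z.impulse p W k else 0

variable [CompleteSpace V] {Z} {M : ℕ} {p : History E} (hp : IsPath M p) {W : ℝ≥0 → V}

include hp

lemma Solves.intervalIntegrable (hW : Z.Solves M p W) {a b : ℝ} (ha : 0 ≤ a) (hb : 0 ≤ b) :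
    IntervalIntegrable (Z.drift p W) volume a b := by
  have h1 := (hW ⟨a, ha⟩).1
  have h2 := (hW ⟨b, hb⟩).1
  exact h1.symm.trans h2

lemma Solves.eq_add (hW : Z.Solves M p W) {n : ℕ} (hn : (p n).1 < ∞) {b : ℝ≥0} (hnb : (p n).1 ≤ b)
    (hb : b < (p (n + 1)).1) :
    W b = W (p n).1.toNNReal + ∫ s in time n p..b, Z.drift p W s := by
  have hcoe : ((p n).1.toNNReal : ℝ≥0∞) = (p n).1 := ENNReal.coe_toNNReal hn.ne
  rw [(hW b).2, (hW (p n).1.toNNReal).2, hp.sum_jumps _ hnb hb,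
    hp.sum_jumps _ hcoe.ge (by rw [hcoe]; exact hp.lt n hn),
    show ((p n).1.toNNReal : ℝ) = time n p from rfl,
    ← intervalIntegral.integral_add_adjacent_intervals (b := time n p)
      (hW.intervalIntegrable hp le_rfl (time_nonneg n p))
      (hW.intervalIntegrable hp (time_nonneg n p) (NNReal.coe_nonneg b))]
  abel

lemma Solves.eq_add_jump (hW : Z.Solves M p W) {n : ℕ} (hn : (p (n + 1)).1 < ∞) :
    W (p (n + 1)).1.toNNReal = W (p n).1.toNNReal +
      (∫ s in time n p..time (n + 1) p, Z.drift p W s) + Z.impulse p W (n + 1) := by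
  have hn' : (p n).1 < ∞ := (hp.mono n.le_succ).trans_lt hn
  have hcoe : ((p n).1.toNNReal : ℝ≥0∞) = (p n).1 := ENNReal.coe_toNNReal hn'.ne
  have hcoe' : ((p (n + 1)).1.toNNReal : ℝ≥0∞) = (p (n + 1)).1 := ENNReal.coe_toNNReal hn.ne
  rw [(hW (p (n + 1)).1.toNNReal).2, (hW (p n).1.toNNReal).2,
    hp.sum_jumps _ hcoe.ge (by rw [hcoe]; exact hp.lt n hn'),
    hp.sum_jumps _ hcoe'.ge (by rw [hcoe']; exact hp.lt _ hn),
    show ((p n).1.toNNReal : ℝ) = time n p from rfl,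
    show ((p (n + 1)).1.toNNReal : ℝ) = time (n + 1) p from rfl,
    ← intervalIntegral.integral_add_adjacent_intervals (a := 0) (b := time n p)
      (hW.intervalIntegrable hp le_rfl (time_nonneg n p))
      (hW.intervalIntegrable hp (time_nonneg n p) (time_nonneg (n + 1) p)),
    Finset.sum_Icc_succ_top (by omega)]
  abel

lemma time_le_of_lt_top {n : ℕ} (hn : (p (n + 1)).1 < ∞) : time n p < time (n + 1) p := by
  have hn' : (p n).1 < ∞ := (hp.mono n.le_succ).trans_lt hn
  exact (ENNReal.toReal_lt_toReal hn'.ne hn.ne).2 (hp.lt n hn')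

/-- Here `b` may be the next jump time, where `W` itself has already jumped. The left-hand side is
the continuous continuation of `W` to `b`; its drift agrees with the linear drift except at `b`, so
uniqueness for the linear flow applies up to and including `b`. -/
lemma Solves.primitive_eq_sol (hW : Z.Solves M p W) {n : ℕ} (hn : (p n).1 < ∞)
    (hstart : W (p n).1.toNNReal = Z.sol n p (time n p)) {b : ℝ} (hnb : time n p ≤ b)
    (hb : ENNReal.ofReal b ≤ (p (n + 1)).1) :
    W (p n).1.toNNReal + ∫ s in time n p..b, Z.drift p W s = Z.sol n p b := by
  have h0 : 0 ≤ time n p := time_nonneg n p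
  set w : ℝ → V := fun r => W (p n).1.toNNReal + ∫ s in time n p..r, Z.drift p W s with hw
  have hint : ∀ r ∈ Set.uIcc (time n p) b, IntervalIntegrable (Z.drift p W) volume (time n p) r := by
    intro r hr
    rw [Set.uIcc_of_le hnb] at hr
    exact hW.intervalIntegrable hp h0 (h0.trans hr.1)
  have hcongr : ∀ s ∈ Set.Ico (time n p) b,
      Z.drift p W s = Z.L (trunc n p) (w s) + Z.g (trunc n p) s := by
    intro s hs
    obtain ⟨h1, h2⟩ := hp.mem_of_mem_Ico hn hb hs
    rw [drift, hp.upTo_eq h1 h2, hW.eq_add hp hn h1 h2, Real.coe_toNNReal s (h0.trans hs.1)]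
  have hae : ∀ r ∈ Set.uIcc (time n p) b, ∀ᵐ s, s ∈ Set.uIoc (time n p) r →
      Z.drift p W s = Z.L (trunc n p) (w s) + Z.g (trunc n p) s := by
    intro r hr
    rw [Set.uIcc_of_le hnb] at hr
    have : ∀ᵐ s : ℝ, s ≠ b := by simp [ae_iff]
    filter_upwards [this] with s hs hs'
    rw [Set.uIoc_of_le hr.1] at hs'
    exact hcongr s ⟨hs'.1.le, lt_of_le_of_ne (hs'.2.trans hr.2) hs⟩
  have hwa : w (time n p) = W (p n).1.toNNReal := by simp [hw]
  have := linearFlow_unique (Z.L (trunc n p)) (w := w) (g := Z.g (trunc n p)) (a := time n p) (b := b)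
    ((hint b Set.right_mem_uIcc).congr_ae
      ((ae_restrict_iff' measurableSet_uIoc).2 (hae b Set.right_mem_uIcc))) (fun r hr => by
        rw [hwa]
        simp only [hw]
        rw [intervalIntegral.integral_congr_ae (hae r hr)])
  rw [hwa, hstart, ← sol_eq_linearFlow] at this
  exact this

/-- Induction over the jumps. The left limit in the impulse at the next jump is the end value of the
continuous continuation, hence the value of `sol n` there; the recursion defining `sol (n + 1)` then
matches the impulse. -/
lemma Solves.sol_start (hW : Z.Solves M p W) : ∀ {n : ℕ}, (p n).1 < ∞ →
    W (p n).1.toNNReal = Z.sol n p (time n p) := by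
  intro n
  induction n with
  | zero =>
    intro _
    rw [sol_zero_time]
    have h := (hW 0).2
    rw [hp.sum_jumps (n := 0) _ (by simp [hp.zero])
      (by simpa [hp.zero] using hp.lt 0 (by simp [hp.zero]))] at h
    simpa [hp.zero] using h
  | succ n ih =>
    intro hn
    have hn' : (p n).1 < ∞ := (hp.mono n.le_succ).trans_lt hn
    have hlt := time_le_of_lt_top hp hn
    have h0 : 0 ≤ time n p := time_nonneg n p
    have hofReal : ENNReal.ofReal (time (n + 1) p) = (p (n + 1)).1 := ENNReal.ofReal_toReal hn.ne
    have hprim := hW.primitive_eq_sol hp hn' (ih hn') hlt.le hofReal.le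
    rw [hW.eq_add_jump hp hn, hprim, sol_succ_time, add_assoc]
    congr 1
    have hleft : Function.leftLim W (p (n + 1)).1.toNNReal = Z.sol n p (time (n + 1) p) := by
      rw [← hprim]
      refine leftLim_eq_of_eqOn (b := (p (n + 1)).1.toNNReal)
        (F := fun r => W (p n).1.toNNReal + ∫ s in time n p..r, Z.drift p W s)
        h0 hlt ?_ ?_
      · refine continuousOn_const.add ?_
        have := intervalIntegral.continuousOn_primitive_interval'
          (hW.intervalIntegrable hp h0 (b := time (n + 1) p) ENNReal.toReal_nonneg) Set.left_mem_uIcc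
        rwa [Set.uIcc_of_le hlt.le] at this
      · intro t h1 h2
        refine hW.eq_add hp hn' ?_ ?_
        · rw [← ENNReal.ofReal_toReal hn'.ne]
          exact (ENNReal.ofReal_le_ofReal h1).trans (by simp)
        · rw [← ENNReal.coe_toNNReal hn.ne]; exact_mod_cast h2
    rw [impulse, hleft]
    rfl

/-- Uniqueness for impulsive systems. -/
theorem Solves.eq_sol (hW : Z.Solves M p W) {n : ℕ} {t : ℝ≥0} (h1 : (p n).1 ≤ t)
    (h2 : t < (p (n + 1)).1) : W t = Z.sol n p t := by
  have hn : (p n).1 < ∞ := h1.trans_lt coe_lt_top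
  rw [hW.eq_add hp hn h1 h2]
  refine hW.primitive_eq_sol hp hn (hW.sol_start hp hn) ?_ (by simpa using h2.le)
  exact (ENNReal.toReal_mono coe_ne_top h1)

omit hp in
/-- The solution along a path, as a function of the stopped path. -/
noncomputable def value (Z : ImpulsiveSystem E V) (M : ℕ) (h : History E) (t : ℝ) : V :=
  Z.sol (count M h) h t

lemma value_upTo {n : ℕ} {t : ℝ≥0} (h1 : (p n).1 ≤ t) (h2 : t < (p (n + 1)).1) (s : ℝ) :
    Z.value M (upTo t p) s = Z.sol n p s := by
  rw [value, hp.count_upTo h1 h2, hp.upTo_eq h1 h2, sol_trunc _ _ _ le_rfl]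

theorem Solves.eq_value (hW : Z.Solves M p W) (t : ℝ≥0) : W t = Z.value M (upTo t p) t := by
  obtain ⟨n, h1, h2⟩ := hp.exists_mem t
  rw [hW.eq_sol hp h1 h2, value_upTo hp h1 h2]

/-- Between two jumps the stopped history is constantly `trunc n p`, so the source along the path is
a single function there, up to the end point `b`. -/
lemma intervalIntegrable_g (hg : ∀ t : ℝ≥0, IntervalIntegrable
    (fun s : ℝ => Z.g (upTo s.toNNReal p) s) volume 0 t) {n : ℕ} (hn : (p n).1 < ∞) {b : ℝ}
    (hnb : time n p ≤ b) (hb : ENNReal.ofReal b ≤ (p (n + 1)).1) :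
    IntervalIntegrable (Z.g (trunc n p)) volume (time n p) b := by
  have h0 : 0 ≤ time n p := time_nonneg n p
  have h1 : IntervalIntegrable (fun s : ℝ => Z.g (upTo s.toNNReal p) s) volume (time n p) b :=
    (hg ⟨_, h0⟩).symm.trans (hg ⟨b, h0.trans hnb⟩)
  refine h1.congr_ae ((ae_restrict_iff' measurableSet_uIoc).2 ?_)
  have : ∀ᵐ s : ℝ, s ≠ b := by simp [ae_iff]
  filter_upwards [this] with s hs hs'
  rw [Set.uIoc_of_le hnb] at hs'
  obtain ⟨h1, h2⟩ := hp.mem_of_mem_Ico hn hb ⟨hs'.1.le, lt_of_le_of_ne hs'.2 hs⟩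
  rw [hp.upTo_eq h1 h2]

lemma sol_primitive (hg : ∀ t : ℝ≥0, IntervalIntegrable
    (fun s : ℝ => Z.g (upTo s.toNNReal p) s) volume 0 t) {n : ℕ} (hn : (p n).1 < ∞) {b : ℝ}
    (hnb : time n p ≤ b) (hb : ENNReal.ofReal b ≤ (p (n + 1)).1) :
    IntervalIntegrable (fun s => Z.L (trunc n p) (Z.sol n p s) + Z.g (trunc n p) s) volume
        (time n p) b ∧
      Z.sol n p b = Z.sol n p (time n p) +
        ∫ s in time n p..b, (Z.L (trunc n p) (Z.sol n p s) + Z.g (trunc n p) s) := by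
  have := linearFlow_eq (Z.L (trunc n p)) (Z.sol n p (time n p))
    (intervalIntegrable_g hp hg hn hnb hb)
  rwa [← sol_eq_linearFlow] at this

lemma sol_continuousOn (hg : ∀ t : ℝ≥0, IntervalIntegrable
    (fun s : ℝ => Z.g (upTo s.toNNReal p) s) volume 0 t) {n : ℕ} (hn : (p n).1 < ∞) {b : ℝ}
    (hnb : time n p ≤ b) (hb : ENNReal.ofReal b ≤ (p (n + 1)).1) :
    ContinuousOn (Z.sol n p) (Set.Icc (time n p) b) := by
  have := linearFlow_continuousOn (Z.L (trunc n p)) (Z.sol n p (time n p))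
    (intervalIntegrable_g hp hg hn hnb hb)
  rwa [← sol_eq_linearFlow, Set.uIcc_of_le hnb] at this

end ImpulsiveSystem

/-- Assemble a piecewise description of a path with jumps into a global one. -/
theorem History.IsPath.eq_integral_add_sum {E V : Type*} [NormedAddCommGroup V] [NormedSpace ℝ V]
    {M : ℕ} {p : History E} (hp : IsPath M p) {f : ℝ → V} {J : ℕ → V} {Y : ℕ → ℝ → V}
    (hf : ∀ n b, (p n).1 < ∞ → time n p ≤ b → ENNReal.ofReal b ≤ (p (n + 1)).1 →
      IntervalIntegrable f volume (time n p) b ∧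
        Y n b = Y n (time n p) + ∫ s in time n p..b, f s)
    (hJ : ∀ n, (p (n + 1)).1 < ∞ → Y (n + 1) (time (n + 1) p) = Y n (time (n + 1) p) + J (n + 1))
    {n : ℕ} {b : ℝ} (hn : (p n).1 < ∞) (hnb : time n p ≤ b) (hb : ENNReal.ofReal b ≤ (p (n + 1)).1) :
    IntervalIntegrable f volume 0 b ∧
      Y n b = Y 0 0 + (∫ s in (0 : ℝ)..b, f s) + ∑ k ∈ Finset.Icc 1 n, J k := by
  have key : ∀ n, (p n).1 < ∞ → IntervalIntegrable f volume 0 (time n p) ∧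
      Y n (time n p) = Y 0 0 + (∫ s in (0 : ℝ)..time n p, f s) + ∑ k ∈ Finset.Icc 1 n, J k := by
    intro n
    induction n with
    | zero => intro _; simp [hp.time_zero]
    | succ n ih =>
      intro hn
      have hn' : (p n).1 < ∞ := (hp.mono n.le_succ).trans_lt hn
      obtain ⟨i1, i2⟩ := ih hn'
      obtain ⟨j1, j2⟩ := hf n (time (n + 1) p) hn'
        (ENNReal.toReal_mono hn.ne (hp.mono n.le_succ)) (ENNReal.ofReal_toReal hn.ne).le
      refine ⟨i1.trans j1, ?_⟩
      rw [hJ n hn, j2, i2, Finset.sum_Icc_succ_top (by omega),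
        ← intervalIntegral.integral_add_adjacent_intervals i1 j1]
      abel
  obtain ⟨i1, i2⟩ := key n hn
  obtain ⟨j1, j2⟩ := hf n b hn hnb hb
  refine ⟨i1.trans j1, ?_⟩
  rw [j2, i2, ← intervalIntegral.integral_add_adjacent_intervals i1 j1]
  abel

namespace ImpulsiveSystem

variable {E V : Type*} [NormedAddCommGroup V] [NormedSpace ℝ V] [CompleteSpace V]
  {Z : ImpulsiveSystem E V} {M : ℕ} {p : History E}

/-- Existence for impulsive systems. -/
theorem solves_value (hp : IsPath M p) (hg : ∀ t : ℝ≥0, IntervalIntegrable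
    (fun s : ℝ => Z.g (upTo s.toNNReal p) s) volume 0 t) :
    Z.Solves M p fun t => Z.value M (upTo t p) t := by
  set W : ℝ≥0 → V := fun t => Z.value M (upTo t p) t with hW
  have hWsol : ∀ {n : ℕ} {t : ℝ≥0}, (p n).1 ≤ t → t < (p (n + 1)).1 → W t = Z.sol n p t :=
    fun h1 h2 => value_upTo hp h1 h2 _
  have hae : ∀ n b, (p n).1 < ∞ → time n p ≤ b → ENNReal.ofReal b ≤ (p (n + 1)).1 →
      ∀ᵐ s, s ∈ Set.uIoc (time n p) b →
        Z.L (trunc n p) (Z.sol n p s) + Z.g (trunc n p) s = Z.drift p W s := by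
    intro n b hn hnb hb
    have : ∀ᵐ s : ℝ, s ≠ b := by simp [ae_iff]
    filter_upwards [this] with s hs hs'
    rw [Set.uIoc_of_le hnb] at hs'
    obtain ⟨h1, h2⟩ := hp.mem_of_mem_Ico hn hb ⟨hs'.1.le, lt_of_le_of_ne hs'.2 hs⟩
    have h0 : 0 ≤ time n p := time_nonneg n p
    rw [drift, hp.upTo_eq h1 h2, hWsol h1 h2, Real.coe_toNNReal s (h0.trans hs'.1.le)]
  intro t
  obtain ⟨n, h1, h2⟩ := hp.exists_mem t
  have hmain := hp.eq_integral_add_sum (f := Z.drift p W) (J := Z.impulse p W)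
    (Y := fun n => Z.sol n p) ?_ ?_ (h1.trans_lt coe_lt_top) (b := t)
      (ENNReal.toReal_mono coe_ne_top h1) (by simpa using h2.le)
  · refine ⟨hmain.1, ?_⟩
    rw [hp.sum_jumps _ h1 h2, hWsol h1 h2, hmain.2, ← sol_zero_time Z p, hp.time_zero]
  · intro n b hn hnb hb
    obtain ⟨k1, k2⟩ := sol_primitive hp hg hn hnb hb
    refine ⟨k1.congr_ae ((ae_restrict_iff' measurableSet_uIoc).2 (hae n b hn hnb hb)), ?_⟩
    rw [← intervalIntegral.integral_congr_ae (hae n b hn hnb hb)]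
    exact k2
  · intro n hn
    have hn' : (p n).1 < ∞ := (hp.mono n.le_succ).trans_lt hn
    have hlt := time_le_of_lt_top hp hn
    have hofReal : ENNReal.ofReal (time (n + 1) p) = (p (n + 1)).1 := ENNReal.ofReal_toReal hn.ne
    have hleft : Function.leftLim W (p (n + 1)).1.toNNReal = Z.sol n p (time (n + 1) p) := by
      refine leftLim_eq_of_eqOn (b := (p (n + 1)).1.toNNReal) ENNReal.toReal_nonneg hlt
        (sol_continuousOn hp hg hn' hlt.le hofReal.le) fun t k1 k2 => hWsol ?_ ?_
      · rw [← ENNReal.ofReal_toReal hn'.ne]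
        exact (ENNReal.ofReal_le_ofReal k1).trans (by simp)
      · rw [← ENNReal.coe_toNNReal hn.ne]; exact_mod_cast k2
    simp only [impulse, hleft, sol_succ_time, Nat.add_sub_cancel, add_assoc]

end ImpulsiveSystem

/-! ### Measurability and growth of solutions in the history -/

lemma stronglyMeasurable_linearFlow {α V : Type*} [MeasurableSpace α] [NormedAddCommGroup V]
    [NormedSpace ℝ V] [CompleteSpace V] {L : α → V →L[ℝ] V} {a t : α → ℝ} {w : α → V}
    {g : α → ℝ → V} (hL : StronglyMeasurable L) (ha : Measurable a) (ht : Measurable t)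
    (hw : StronglyMeasurable w) (hg : StronglyMeasurable (Function.uncurry g)) :
    StronglyMeasurable fun x => linearFlow (L x) (a x) (w x) (g x) (t x) := by
  have hexp : Continuous fun q : ℝ × (V →L[ℝ] V) => NormedSpace.exp (q.1 • q.2) := by
    let _ : NormedAlgebra ℚ (V →L[ℝ] V) := NormedAlgebra.restrictScalars ℚ ℝ _
    exact NormedSpace.exp_continuous.comp (continuous_fst.smul continuous_snd)
  have happ : Continuous fun q : (V →L[ℝ] V) × V => q.1 q.2 := isBoundedBilinearMap_apply.continuous
  have hk : StronglyMeasurable fun q : α × ℝ =>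
      NormedSpace.exp (-(q.2 - a q.1) • L q.1) (g q.1 q.2) := by
    refine happ.comp_stronglyMeasurable (StronglyMeasurable.prodMk ?_ hg)
    refine hexp.comp_stronglyMeasurable (StronglyMeasurable.prodMk ?_ (hL.comp_measurable measurable_fst))
    exact (measurable_snd.sub (ha.comp measurable_fst)).neg.stronglyMeasurable
  have hS : ∀ {b c : α → ℝ}, Measurable b → Measurable c →
      StronglyMeasurable fun x => ∫ s in Set.Ioc (b x) (c x),
        NormedSpace.exp (-(s - a x) • L x) (g x s) := by
    intro b c hb hc
    -- The end points depend on the parameter; they are moved into an indicator so that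
    -- measurability of a parametric integral over all of `ℝ` applies.
    have hm : MeasurableSet {q : α × ℝ | q.2 ∈ Set.Ioc (b q.1) (c q.1)} :=
      (measurableSet_lt (hb.comp measurable_fst) measurable_snd).inter
        (measurableSet_le measurable_snd (hc.comp measurable_fst))
    have := (hk.indicator hm).integral_prod_right' (ν := volume)
    convert this using 1
    funext x
    rw [← integral_indicator measurableSet_Ioc]
    rfl
  refine happ.comp_stronglyMeasurable (StronglyMeasurable.prodMk ?_ (hw.add ((hS ha ht).sub (hS ht ha))))
  exact hexp.comp_stronglyMeasurable ((ht.sub ha).stronglyMeasurable.prodMk hL)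

namespace History

variable {E : Type*} [MeasurableSpace E]

@[fun_prop]
lemma measurable_trunc (n : ℕ) : Measurable (trunc n : History E → History E) := by
  refine measurable_pi_iff.2 fun k => ?_
  unfold trunc
  split_ifs <;> fun_prop

lemma measurable_upTo : Measurable fun q : ℝ≥0 × History E => upTo q.1 q.2 := by
  refine measurable_pi_iff.2 fun k => ?_
  unfold upTo
  refine Measurable.ite (measurableSet_le (by fun_prop) (by fun_prop)) (by fun_prop) (by fun_prop)

@[fun_prop]
lemma measurable_time (n : ℕ) : Measurable (time n : History E → ℝ) := by
  unfold time; fun_prop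

@[fun_prop]
lemma measurable_count (M : ℕ) : Measurable (count M : History E → ℕ) := by
  unfold count
  refine Finset.measurable_sum _ fun k _ => ?_
  exact Measurable.ite (measurableSet_lt (by fun_prop) measurable_const)
    measurable_const measurable_const

@[fun_prop]
lemma measurable_last (M : ℕ) : Measurable (last M : History E → E) := by
  have h2 : Measurable (fun p : ℕ × History E => (p.2 p.1).2) :=
    measurable_from_prod_countable_right fun n => by fun_prop
  exact h2.comp ((measurable_count M).prodMk measurable_id)

end History

namespace ImpulsiveSystem

variable {E V : Type*} [MeasurableSpace E] [NormedAddCommGroup V] [NormedSpace ℝ V]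

/-- The coefficients of the system are measurable. -/
structure IsMeasurable (Z : ImpulsiveSystem E V) : Prop where
  L : StronglyMeasurable Z.L
  g : StronglyMeasurable fun q : History E × ℝ => Z.g q.1 q.2
  D : StronglyMeasurable fun q : History E × E => Z.D q.1 q.2
  j : StronglyMeasurable fun q : History E × ℝ × E => Z.j q.1 q.2.1 q.2.2

variable [CompleteSpace V] {Z : ImpulsiveSystem E V}

lemma IsMeasurable.sol (hZ : Z.IsMeasurable) (n : ℕ) :
    StronglyMeasurable fun q : History E × ℝ => Z.sol n q.1 q.2 := by
  have happ : Continuous fun q : (V →L[ℝ] V) × V => q.1 q.2 := isBoundedBilinearMap_apply.continuous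
  have hg : ∀ n, StronglyMeasurable (Function.uncurry fun q : History E × ℝ => Z.g (trunc n q.1)) := by
    intro n
    exact hZ.g.comp_measurable (g := fun q : (History E × ℝ) × ℝ => (trunc n q.1.1, q.2)) (by fun_prop)
  have hL : ∀ n, StronglyMeasurable fun q : History E × ℝ => Z.L (trunc n q.1) := fun n =>
    hZ.L.comp_measurable (by fun_prop)
  induction n with
  | zero =>
    simp only [ImpulsiveSystem.sol]
    exact stronglyMeasurable_linearFlow (hL 0) (by fun_prop) measurable_snd
      stronglyMeasurable_const (hg 0)
  | succ n ih =>
    simp only [ImpulsiveSystem.sol]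
    have h1 : StronglyMeasurable fun q : History E × ℝ => Z.sol n q.1 (time (n + 1) q.1) :=
      ih.comp_measurable (g := fun q : History E × ℝ => (q.1, time (n + 1) q.1)) (by fun_prop)
    refine stronglyMeasurable_linearFlow (hL _) (by fun_prop) measurable_snd
      ((h1.add (happ.comp_stronglyMeasurable (StronglyMeasurable.prodMk ?_ h1))).add ?_) (hg _)
    · exact hZ.D.comp_measurable
        (g := fun q : History E × ℝ => (trunc n q.1, (q.1 (n + 1)).2)) (by fun_prop)
    · exact hZ.j.comp_measurable
        (g := fun q : History E × ℝ => (trunc n q.1, time (n + 1) q.1, (q.1 (n + 1)).2)) (by fun_prop)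

/-- The number of jumps takes finitely many values, and on each level set `value` is one of the
functions `sol n`. -/
lemma IsMeasurable.value (hZ : Z.IsMeasurable) (M : ℕ) :
    StronglyMeasurable fun q : History E × ℝ => Z.value M q.1 q.2 := by
  have h : ∀ q : History E × ℝ, Z.value M q.1 q.2 =
      ∑ n ∈ Finset.range (M + 1), {q : History E × ℝ | count M q.1 = n}.indicator
        (fun q => Z.sol n q.1 q.2) q := by
    intro q
    have hc : count M q.1 ≤ M := by
      unfold count
      refine (Finset.sum_le_sum (g := fun _ => 1) fun k _ => ?_).trans (by simp)
      split_ifs <;> simp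
    rw [Finset.sum_eq_single_of_mem (count M q.1) (Finset.mem_range.2 (by omega))]
    · simp [ImpulsiveSystem.value]
    · intro n _ hn
      simp [Ne.symm hn]
  rw [funext h]
  refine Finset.stronglyMeasurable_fun_sum _ fun n _ => (hZ.sol n).indicator ?_
  exact ((measurable_count M).comp measurable_fst) (measurableSet_singleton n)

/-- A pathwise bound for the solution. -/
theorem norm_sol_le {M : ℕ} {p : History E} (hp : IsPath M p)
    (hg : ∀ t : ℝ≥0, IntervalIntegrable (fun s : ℝ => Z.g (upTo s.toNNReal p) s) volume 0 t)
    {K T : ℝ} (hK : 0 ≤ K) (hL : ∀ h, ‖Z.L h‖ ≤ K) (hD : ∀ h θ, ‖Z.D h θ‖ ≤ K) :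
    ∀ n b, (p n).1 < ∞ → time n p ≤ b → ENNReal.ofReal b ≤ (p (n + 1)).1 → b ≤ T →
      ‖Z.sol n p b‖ ≤ (Real.exp (T * K) * Real.exp (T * K) * (2 + K)) ^ (n + 1) *
        (‖Z.w₀‖ + (∫ s in (0 : ℝ)..b, ‖Z.g (upTo s.toNNReal p) s‖) +
          ∑ k ∈ Finset.Icc 1 n, ‖Z.j (trunc (k - 1) p) (time k p) (p k).2‖) := by
  set γ : ℝ → ℝ := fun s => ‖Z.g (upTo s.toNNReal p) s‖ with hγ
  have hγi : ∀ {a b : ℝ}, 0 ≤ a → 0 ≤ b → IntervalIntegrable γ volume a b := fun {a b} ha hb =>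
    ((hg ⟨a, ha⟩).symm.trans (hg ⟨b, hb⟩)).norm
  set e := Real.exp (T * K) with he
  -- Growth factor of one sojourn. It dominates `e * (1 + K)` (flow followed by an impulse) and `e *
  -- e` (flow acting on the integrated source), and is at least 1, so terms that enter late can be
  -- multiplied by the full power.
  set C := e * e * (2 + K) with hC
  have step : ∀ n b, (p n).1 < ∞ → time n p ≤ b → ENNReal.ofReal b ≤ (p (n + 1)).1 → b ≤ T →
      ‖Z.sol n p b‖ ≤ e * (‖Z.sol n p (time n p)‖ + e * ∫ s in time n p..b, γ s) := by
    intro n b hn hnb hb hbT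
    have h0 := time_nonneg n p
    have h1 := norm_linearFlow_le (Z.L (trunc n p)) (hL _) (Z.sol n p (time n p))
      (intervalIntegrable_g hp hg hn hnb hb) (r := T) (by rw [abs_of_nonneg] <;> linarith)
    rw [← sol_eq_linearFlow] at h1
    have h2 : ∫ s in time n p..b, ‖Z.g (trunc n p) s‖ = ∫ s in time n p..b, γ s := by
      refine intervalIntegral.integral_congr_ae ?_
      have : ∀ᵐ s : ℝ, s ≠ b := by simp [ae_iff]
      filter_upwards [this] with s hs hs'
      rw [Set.uIoc_of_le hnb] at hs'
      obtain ⟨h1, h2⟩ := hp.mem_of_mem_Ico hn hb ⟨hs'.1.le, lt_of_le_of_ne hs'.2 hs⟩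
      simp only [hγ, hp.upTo_eq h1 h2]
    rwa [h2, abs_of_nonneg (intervalIntegral.integral_nonneg hnb fun s _ => norm_nonneg _)] at h1
  intro n
  induction n with
  | zero =>
    intro b hn hnb hb hbT
    have hT : 0 ≤ T := (time_nonneg 0 p).trans (hnb.trans hbT)
    have he1 : 1 ≤ e := Real.one_le_exp (by positivity)
    refine (step 0 b hn hnb hb hbT).trans ?_
    rw [sol_zero_time, hp.time_zero]
    have hI : 0 ≤ ∫ s in (0 : ℝ)..b, γ s :=
      intervalIntegral.integral_nonneg (hp.time_zero ▸ hnb) fun s _ => norm_nonneg _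
    have h2 : e ≤ C := by rw [hC]; nlinarith [mul_nonneg (by positivity : 0 ≤ e * e) hK]
    have h3 : e * e ≤ C := by rw [hC]; nlinarith [mul_nonneg (by positivity : 0 ≤ e * e) hK]
    simp only [zero_add, pow_one, Finset.Icc_eq_empty_of_lt one_pos, Finset.sum_empty, add_zero]
    rw [mul_add, mul_add, ← mul_assoc]
    exact add_le_add (mul_le_mul_of_nonneg_right h2 (norm_nonneg _))
      (mul_le_mul_of_nonneg_right h3 hI)
  | succ n ih =>
    intro b hn hnb hb hbT
    have hT : 0 ≤ T := (time_nonneg _ p).trans (hnb.trans hbT)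
    have he1 : 1 ≤ e := Real.one_le_exp (by positivity)
    have hn' : (p n).1 < ∞ := (hp.mono n.le_succ).trans_lt hn
    have hlt := time_le_of_lt_top hp hn
    have hofReal : ENNReal.ofReal (time (n + 1) p) = (p (n + 1)).1 := ENNReal.ofReal_toReal hn.ne
    have hprev := ih (time (n + 1) p) hn' hlt.le hofReal.le (hnb.trans hbT)
    refine (step _ b hn hnb hb hbT).trans ?_
    rw [sol_succ_time, Finset.sum_Icc_succ_top (by omega),
      ← intervalIntegral.integral_add_adjacent_intervals (b := time (n + 1) p)
        (hγi le_rfl (time_nonneg _ _)) (hγi (time_nonneg _ _) ((time_nonneg _ _).trans hnb)),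
      Nat.add_sub_cancel]
    set I₁ := ∫ s in (0 : ℝ)..time (n + 1) p, γ s
    set I₂ := ∫ s in time (n + 1) p..b, γ s
    set x := Z.sol n p (time (n + 1) p)
    set y := Z.j (trunc n p) (time (n + 1) p) (p (n + 1)).2
    set S := ∑ k ∈ Finset.Icc 1 n, ‖Z.j (trunc (k - 1) p) (time k p) (p k).2‖
    have hI₁ : 0 ≤ I₁ := intervalIntegral.integral_nonneg (time_nonneg _ _) fun s _ => norm_nonneg _
    have hI₂ : 0 ≤ I₂ := intervalIntegral.integral_nonneg hnb fun s _ => norm_nonneg _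
    have hS : 0 ≤ S := Finset.sum_nonneg fun _ _ => norm_nonneg _
    have hC1 : 1 ≤ C := by rw [hC]; nlinarith [mul_nonneg (by positivity : 0 ≤ e * e) hK]
    have h3 : e * e ≤ C := by rw [hC]; nlinarith [mul_nonneg (by positivity : 0 ≤ e * e) hK]
    have h2 : e ≤ C := le_trans (by nlinarith) h3
    have h4 : e * (1 + K) ≤ C := by
      rw [hC, mul_assoc]
      refine mul_le_mul_of_nonneg_left ?_ (by positivity)
      nlinarith
    have hP : 1 ≤ C ^ (n + 1) := one_le_pow₀ hC1
    have hx : ‖x + Z.D (trunc n p) (p (n + 1)).2 x + y‖ ≤ (1 + K) * ‖x‖ + ‖y‖ := by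
      refine (norm_add_le _ _).trans (add_le_add ?_ le_rfl)
      refine (norm_add_le _ _).trans ?_
      rw [add_mul, one_mul]
      exact add_le_add le_rfl (ContinuousLinearMap.le_of_opNorm_le _ (hD _ _) _)
    have hyn := norm_nonneg y
    calc e * (‖x + Z.D (trunc n p) (p (n + 1)).2 x + y‖ + e * I₂)
        ≤ e * (((1 + K) * ‖x‖ + ‖y‖) + e * I₂) := by gcongr
      _ = (e * (1 + K)) * ‖x‖ + e * ‖y‖ + (e * e) * I₂ := by ring
      _ ≤ C * (C ^ (n + 1) * (‖Z.w₀‖ + I₁ + S)) + C * ‖y‖ + C * I₂ := by gcongr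
      _ ≤ C * (C ^ (n + 1) * (‖Z.w₀‖ + I₁ + S)) + C * (C ^ (n + 1) * ‖y‖) +
          C * (C ^ (n + 1) * I₂) := by
          gcongr
          · exact le_mul_of_one_le_left hyn hP
          · exact le_mul_of_one_le_left hI₂ hP
      _ = C ^ (n + 1 + 1) * (‖Z.w₀‖ + (I₁ + I₂) + (S + ‖y‖)) := by ring

end ImpulsiveSystem

/-! ### Intensities as functions of the history, and the law of the next jump -/

namespace JumpCharacteristics

variable {E : Type*} [Fintype E]

/-- The intensity of a jump to `θ` given the history of at most `M` jumps. -/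
noncomputable def lam (c : JumpCharacteristics E) (M : ℕ) (h : History E) (θ : E) : ℝ≥0 :=
  if (h M).1 < ∞ then 0 else c.rate (last M h) * c.Q (last M h) θ

lemma lam_trunc (c : JumpCharacteristics E) {M n : ℕ} {p : History E} (hp : IsPath M p)
    (hn : (p n).1 < ∞) (θ : E) :
    c.lam M (trunc n p) θ = if n = M then 0 else c.rate (p n).2 * c.Q (p n).2 θ := by
  rw [lam, hp.last_trunc hn]
  simp only [hp.lt_top_trunc hn]

lemma measurable_lam [MeasurableSpace E] [MeasurableSingletonClass E]
    (c : JumpCharacteristics E) (M : ℕ) (θ : E) : Measurable fun h => c.lam M h θ := by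
  unfold lam
  refine Measurable.ite (measurableSet_lt (by fun_prop) measurable_const) measurable_const ?_
  have : Measurable fun e => c.rate e * c.Q e θ := measurable_of_finite _
  exact this.comp (measurable_last M)

lemma lam_le (c : JumpCharacteristics E) (M : ℕ) (h : History E) (θ : E) :
    c.lam M h θ ≤ c.rate (last M h) * c.Q (last M h) θ := by
  unfold lam
  split_ifs
  · exact zero_le
  · exact le_rfl

/-- A bound for the intensities. -/
noncomputable def maxRate (c : JumpCharacteristics E) : ℝ≥0 := ∑ γ, ∑ θ, c.rate γ * c.Q γ θ

lemma lam_le_maxRate (c : JumpCharacteristics E) {M : ℕ} (h : History E) (θ : E) :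
    c.lam M h θ ≤ c.maxRate := by
  refine (c.lam_le M h θ).trans ?_
  refine (Finset.single_le_sum (f := fun θ => c.rate (last M h) * c.Q (last M h) θ)
    (fun _ _ => zero_le) (Finset.mem_univ θ)).trans ?_
  exact Finset.single_le_sum (f := fun γ => ∑ θ, c.rate γ * c.Q γ θ)
    (fun _ _ => zero_le) (Finset.mem_univ (last M h))

end JumpCharacteristics

namespace SwitchProcess

variable {E : Type*} [Fintype E] [MeasurableSpace E]
  {c : JumpCharacteristics E} {γ₀ : E} {M : ℕ}
  {Ω : Type*} [MeasurableSpace Ω] {μ : Measure Ω} (G : SwitchProcess c γ₀ M μ)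

/-- The full history of the switch process. -/
def path (ω : Ω) : History E := fun k => (G.time k ω, G.mark k ω)

lemma isPath (ω : Ω) : IsPath M (G.path ω) where
  zero := G.time_zero ω
  mono := G.time_mono ω
  lt n := G.time_lt n ω
  last_eq := G.time_last ω

@[fun_prop]
lemma measurable_path : Measurable G.path :=
  measurable_pi_iff.2 fun k => (G.measurable_time k).prodMk (G.measurable_mark k)

lemma mode_eq (t : ℝ≥0) (ω : Ω) : G.mode t ω = last M (upTo t (G.path ω)) := by
  obtain ⟨n, h1, h2⟩ := (G.isPath ω).exists_mem t
  have hj : G.jumpCount t ω = n := by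
    have := (G.isPath ω).sum_jumps (fun _ => 1) h1 h2
    simp only [Finset.sum_const, Nat.card_Icc, smul_eq_mul, mul_one, Nat.add_sub_cancel] at this
    exact this
  rw [mode, hj, (G.isPath ω).upTo_eq h1 h2, (G.isPath ω).last_trunc (h1.trans_lt coe_lt_top)]
  rfl

lemma intensity_eq (t : ℝ≥0) (ω : Ω) (θ : E) :
    G.intensity t ω θ = c.lam M (upTo t (G.path ω)) θ := by
  rw [intensity, JumpCharacteristics.lam, ← mode_eq]
  refine if_congr ?_ rfl rfl
  by_cases h : G.time M ω ≤ t
  · simp [upTo, path, h, h.trans_lt coe_lt_top]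
  · simp [upTo, path, h]

/-- Extend a finite history by jumps that never happen. -/
def extendHistory (n : ℕ) (f : Fin (n + 1) → ℝ≥0∞ × E) : History E :=
  fun k => if h : k < n + 1 then f ⟨k, h⟩ else (∞, (f 0).2)

lemma measurable_extendHistory (n : ℕ) : Measurable (extendHistory n (E := E)) := by
  refine measurable_pi_iff.2 fun k => ?_
  unfold extendHistory
  split_ifs <;> fun_prop

lemma extendHistory_path (n : ℕ) (ω : Ω) :
    extendHistory n (fun k : Fin (n + 1) => (G.time k ω, G.mark k ω)) = trunc n (G.path ω) := by
  funext k
  simp only [extendHistory, trunc, path, Order.lt_add_one_iff]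
  split_ifs <;> rfl

lemma measurableSet_time_lt_top (n : ℕ) : MeasurableSet {ω | G.time n ω < ∞} :=
  measurableSet_lt (G.measurable_time n) measurable_const

variable [MeasurableSingletonClass E]

lemma measurable_rate_exp (n : ℕ) (t : ℝ) : Measurable fun ω =>
    ENNReal.ofReal (Real.exp (-((c.rate (G.mark n ω) : ℝ) * t))) := by
  have : Measurable fun e => ENNReal.ofReal (Real.exp (-((c.rate e : ℝ) * t))) := measurable_of_finite _
  exact this.comp (G.measurable_mark n)

/-- The law of the waiting time is prescribed on events of the past. It states that two image
measures on histories coincide, so it extends to nonnegative functions of the past. -/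
lemma lintegral_survival {n : ℕ} (hn : n < M) (t : ℝ≥0) {φ : History E → ℝ≥0∞} (hφ : Measurable φ) :
    ∫⁻ ω in {ω | G.time n ω < ∞ ∧ G.time n ω + t ≤ G.time (n + 1) ω}, φ (trunc n (G.path ω)) ∂μ =
      ∫⁻ ω in {ω | G.time n ω < ∞}, ENNReal.ofReal (Real.exp (-((c.rate (G.mark n ω) : ℝ) * t))) *
        φ (trunc n (G.path ω)) ∂μ := by
  have hm : Measurable fun ω => trunc n (G.path ω) := by fun_prop
  have hS : MeasurableSet {ω | G.time n ω < ∞ ∧ G.time n ω + t ≤ G.time (n + 1) ω} :=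
    (G.measurableSet_time_lt_top n).inter
      (measurableSet_le ((G.measurable_time n).add_const _) (G.measurable_time _))
  have key : (μ.restrict {ω | G.time n ω < ∞ ∧ G.time n ω + t ≤ G.time (n + 1) ω}).map
        (fun ω => trunc n (G.path ω)) =
      ((μ.restrict {ω | G.time n ω < ∞}).withDensity fun ω =>
        ENNReal.ofReal (Real.exp (-((c.rate (G.mark n ω) : ℝ) * t)))).map
        (fun ω => trunc n (G.path ω)) := by
    ext D hD
    rw [Measure.map_apply hm hD, Measure.map_apply hm hD, Measure.restrict_apply (hm hD),
      withDensity_apply _ (hm hD), Measure.restrict_restrict (hm hD)]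
    have := G.law_time n hn t (extendHistory n ⁻¹' D) (measurable_extendHistory n hD)
    simp only [Set.mem_preimage, extendHistory_path] at this
    exact this
  rw [← lintegral_map hφ hm, key, lintegral_map hφ hm,
    lintegral_withDensity_eq_lintegral_mul _ (G.measurable_rate_exp n t)
      (g := fun ω => φ (trunc n (G.path ω))) (hφ.comp hm)]
  rfl

/-- Same passage from events to functions, where the past now includes the time of the jump whose
mark is drawn. -/
lemma lintegral_mark {n : ℕ} (hn : n < M) (θ : E) {φ : History E × ℝ≥0∞ → ℝ≥0∞} (hφ : Measurable φ) :
    ∫⁻ ω in {ω | G.time (n + 1) ω < ∞ ∧ G.mark (n + 1) ω = θ},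
        φ (trunc n (G.path ω), G.time (n + 1) ω) ∂μ =
      ∫⁻ ω in {ω | G.time (n + 1) ω < ∞}, (c.Q (G.mark n ω) θ : ℝ≥0∞) *
        φ (trunc n (G.path ω), G.time (n + 1) ω) ∂μ := by
  have hm : Measurable fun ω => (trunc n (G.path ω), G.time (n + 1) ω) := by
    have := G.measurable_time (n + 1)
    fun_prop
  have hQ : Measurable fun ω => (c.Q (G.mark n ω) θ : ℝ≥0∞) :=
    (measurable_of_finite fun e => (c.Q e θ : ℝ≥0∞)).comp (G.measurable_mark n)
  have key : (μ.restrict {ω | G.time (n + 1) ω < ∞ ∧ G.mark (n + 1) ω = θ}).map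
        (fun ω => (trunc n (G.path ω), G.time (n + 1) ω)) =
      ((μ.restrict {ω | G.time (n + 1) ω < ∞}).withDensity fun ω =>
        (c.Q (G.mark n ω) θ : ℝ≥0∞)).map (fun ω => (trunc n (G.path ω), G.time (n + 1) ω)) := by
    ext D hD
    rw [Measure.map_apply hm hD, Measure.map_apply hm hD, Measure.restrict_apply (hm hD),
      withDensity_apply _ (hm hD), Measure.restrict_restrict (hm hD)]
    have := G.law_mark n hn θ ((fun q => (extendHistory n q.1, q.2)) ⁻¹' D)
      (((measurable_extendHistory n).comp measurable_fst).prodMk measurable_snd hD)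
    simp only [Set.mem_preimage, extendHistory_path] at this
    exact this
  rw [← lintegral_map hφ hm, key, lintegral_map hφ hm,
    lintegral_withDensity_eq_lintegral_mul _ hQ
      (g := fun ω => φ (trunc n (G.path ω), G.time (n + 1) ω)) (hφ.comp hm)]
  rfl

lemma lintegral_exp_density (r : ℝ≥0) (t : ℝ≥0) :
    ∫⁻ w in Set.Ico (0 : ℝ) t, (r : ℝ≥0∞) * ENNReal.ofReal (Real.exp (-((r : ℝ) * w))) =
      1 - ENNReal.ofReal (Real.exp (-((r : ℝ) * t))) := by
  have hd : ∀ w ∈ Set.uIcc (0 : ℝ) t, HasDerivAt (fun w => -Real.exp (-((r : ℝ) * w)))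
      (r * Real.exp (-((r : ℝ) * w))) w := by
    intro w _
    have h1 : HasDerivAt (fun w => -((r : ℝ) * w)) (-((r : ℝ) * 1)) w :=
      ((hasDerivAt_id' w).const_mul (r : ℝ)).fun_neg
    have := h1.exp.fun_neg
    rwa [show -(Real.exp (-((r : ℝ) * w)) * -((r : ℝ) * 1)) = r * Real.exp (-((r : ℝ) * w)) by ring]
      at this
  have hc : Continuous fun w : ℝ => (r : ℝ) * Real.exp (-((r : ℝ) * w)) := by fun_prop
  have hI := intervalIntegral.integral_eq_sub_of_hasDerivAt hd (hc.intervalIntegrable _ _)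
  rw [intervalIntegral.integral_of_le (NNReal.coe_nonneg t)] at hI
  have hint : IntegrableOn (fun w : ℝ => (r : ℝ) * Real.exp (-((r : ℝ) * w))) (Set.Ioc 0 (t : ℝ)) :=
    (intervalIntegrable_iff_integrableOn_Ioc_of_le (NNReal.coe_nonneg t)).1 (hc.intervalIntegrable _ _)
  have := ofReal_integral_eq_lintegral_ofReal hint (ae_of_all _ fun w => by positivity)
  rw [hI] at this
  simp only [mul_zero, neg_zero, Real.exp_zero, sub_neg_eq_add] at this
  rw [setLIntegral_congr Ico_ae_eq_Ioc]
  calc _ = ∫⁻ w in Set.Ioc (0 : ℝ) t, ENNReal.ofReal ((r : ℝ) * Real.exp (-((r : ℝ) * w))) := by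
        refine lintegral_congr fun w => ?_
        rw [ENNReal.ofReal_mul (NNReal.coe_nonneg r), ENNReal.ofReal_coe_nnreal]
    _ = _ := by
        rw [← this, neg_add_eq_sub, ENNReal.ofReal_sub _ (Real.exp_pos _).le, ENNReal.ofReal_one]

variable [IsProbabilityMeasure μ]

/-- Only survival probabilities are prescribed. By Tonelli and the survival law, the right-hand side
is the integral over `w` of rate times `exp (-rate * w)`, that is `1 - exp (-rate * t)`; the
left-hand side is the complement of survival up to `t`. The form with an indicator, rather than an
exponential density, is the one that leads to the compensator. -/
lemma measure_wait_lt {n : ℕ} (hn : n < M) (t : ℝ≥0) {D : Set (History E)} (hD : MeasurableSet D) :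
    μ {ω | trunc n (G.path ω) ∈ D ∧ G.time n ω < ∞ ∧ G.time (n + 1) ω < G.time n ω + t} =
      ∫⁻ ω in {ω | trunc n (G.path ω) ∈ D ∧ G.time n ω < ∞}, (∫⁻ w in Set.Ico (0 : ℝ) t,
        {w : ℝ | G.time n ω + ENNReal.ofReal w ≤ G.time (n + 1) ω}.indicator
          (fun _ => (c.rate (G.mark n ω) : ℝ≥0∞)) w) ∂μ := by
  have hm : Measurable fun ω => trunc n (G.path ω) := by fun_prop
  have hrate : Measurable fun ω => (c.rate (G.mark n ω) : ℝ≥0∞) :=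
    (measurable_of_finite fun e => (c.rate e : ℝ≥0∞)).comp (G.measurable_mark n)
  have hT := G.measurableSet_time_lt_top n
  have hDT : MeasurableSet {ω | trunc n (G.path ω) ∈ D ∧ G.time n ω < ∞} := (hm hD).inter hT
  have hjoint : Measurable fun q : Ω × ℝ =>
      {w : ℝ | G.time n q.1 + ENNReal.ofReal w ≤ G.time (n + 1) q.1}.indicator
          (fun _ => (c.rate (G.mark n q.1) : ℝ≥0∞)) q.2 := by
    refine Measurable.ite (p := fun q : Ω × ℝ =>
      G.time n q.1 + ENNReal.ofReal q.2 ≤ G.time (n + 1) q.1) ?_ (hrate.comp measurable_fst)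
      measurable_const
    exact measurableSet_le (((G.measurable_time n).comp measurable_fst).add
      (ENNReal.measurable_ofReal.comp measurable_snd)) ((G.measurable_time _).comp measurable_fst)
  rw [lintegral_lintegral_swap hjoint.aemeasurable]
  have h1 : ∀ w ∈ Set.Ico (0 : ℝ) t,
      ∫⁻ ω in {ω | trunc n (G.path ω) ∈ D ∧ G.time n ω < ∞},
        {w : ℝ | G.time n ω + ENNReal.ofReal w ≤ G.time (n + 1) ω}.indicator
          (fun _ => (c.rate (G.mark n ω) : ℝ≥0∞)) w ∂μ =
      ∫⁻ ω in {ω | trunc n (G.path ω) ∈ D ∧ G.time n ω < ∞},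
        (c.rate (G.mark n ω) : ℝ≥0∞) *
          ENNReal.ofReal (Real.exp (-((c.rate (G.mark n ω) : ℝ) * w))) ∂μ := by
    intro w hw
    set φ : History E → ℝ≥0∞ := D.indicator fun h => (c.rate (h n).2 : ℝ≥0∞) with hφ
    have hφm : Measurable φ := by
      refine Measurable.indicator ?_ hD
      exact (measurable_of_finite fun e => (c.rate e : ℝ≥0∞)).comp (by fun_prop)
    have := G.lintegral_survival hn w.toNNReal hφm
    have hφe : ∀ ω, φ (trunc n (G.path ω)) = {ω | trunc n (G.path ω) ∈ D}.indicator
        (fun ω => (c.rate (G.mark n ω) : ℝ≥0∞)) ω := by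
      intro ω
      simp only [hφ, Set.indicator, trunc_apply_of_le le_rfl, Set.mem_ofPred_eq]
      rfl
    have hS : MeasurableSet {ω | G.time n ω < ∞ ∧ G.time n ω + (w.toNNReal : ℝ≥0∞) ≤ G.time (n + 1) ω} :=
      hT.inter (measurableSet_le ((G.measurable_time n).add_const _) (G.measurable_time _))
    simp only [hφe] at this
    rw [← lintegral_indicator hS, ← lintegral_indicator hT] at this
    rw [← lintegral_indicator hDT, ← lintegral_indicator hDT]
    refine Eq.trans (lintegral_congr fun ω => ?_) (this.trans (lintegral_congr fun ω => ?_))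
    · by_cases a : trunc n (G.path ω) ∈ D <;> by_cases b : G.time n ω < ∞ <;>
        by_cases c : G.time n ω + (w.toNNReal : ℝ≥0∞) ≤ G.time (n + 1) ω <;>
        simp [Set.indicator_apply, ENNReal.ofReal, a, b, c]
    · by_cases a : trunc n (G.path ω) ∈ D <;> by_cases b : G.time n ω < ∞ <;>
        simp [a, b, Real.coe_toNNReal w hw.1, mul_comm]
  rw [setLIntegral_congr_fun measurableSet_Ico h1]
  have hjoint2 : Measurable fun q : ℝ × Ω => (c.rate (G.mark n q.2) : ℝ≥0∞) *
          ENNReal.ofReal (Real.exp (-((c.rate (G.mark n q.2) : ℝ) * q.1))) := by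
    have h2 : Measurable fun ω => (c.rate (G.mark n ω) : ℝ) :=
      (measurable_of_finite fun e => (c.rate e : ℝ)).comp (G.measurable_mark n)
    have h3 : Measurable fun q : ℝ × Ω => (c.rate (G.mark n q.2) : ℝ) := h2.comp measurable_snd
    have h4 : Measurable fun q : ℝ × Ω => (c.rate (G.mark n q.2) : ℝ≥0∞) := hrate.comp measurable_snd
    fun_prop
  rw [lintegral_lintegral_swap hjoint2.aemeasurable]
  simp_rw [lintegral_exp_density]
  have h5 : Measurable fun ω => ENNReal.ofReal (Real.exp (-((c.rate (G.mark n ω) : ℝ) * t))) :=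
    G.measurable_rate_exp n t
  have hle : ∀ ω, ENNReal.ofReal (Real.exp (-((c.rate (G.mark n ω) : ℝ) * t))) ≤ 1 := by
    intro ω
    rw [ENNReal.ofReal_le_one, Real.exp_le_one_iff, neg_nonpos]
    positivity
  rw [lintegral_sub h5 _ (ae_of_all _ hle), lintegral_one, Measure.restrict_apply_univ]
  · have hlaw := G.lintegral_survival hn t (φ := D.indicator 1) (measurable_one.indicator hD)
    have hS : MeasurableSet {ω | G.time n ω < ∞ ∧ G.time n ω + (t : ℝ≥0∞) ≤ G.time (n + 1) ω} :=
      hT.inter (measurableSet_le ((G.measurable_time n).add_const _) (G.measurable_time _))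
    have e1 : ∫⁻ ω in {ω | trunc n (G.path ω) ∈ D ∧ G.time n ω < ∞},
        ENNReal.ofReal (Real.exp (-((c.rate (G.mark n ω) : ℝ) * t))) ∂μ =
        μ {ω | trunc n (G.path ω) ∈ D ∧ G.time n ω < ∞ ∧ G.time n ω + (t : ℝ≥0∞) ≤ G.time (n + 1) ω} := by
      have e0 : μ {ω | trunc n (G.path ω) ∈ D ∧ G.time n ω < ∞ ∧
          G.time n ω + (t : ℝ≥0∞) ≤ G.time (n + 1) ω} = ∫⁻ ω, ((fun ω => trunc n (G.path ω)) ⁻¹' D ∩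
            {ω | G.time n ω < ∞ ∧ G.time n ω + (t : ℝ≥0∞) ≤ G.time (n + 1) ω}).indicator 1 ω ∂μ :=
        (lintegral_indicator_one ((hm hD).inter hS)).symm
      rw [e0, ← lintegral_indicator hDT]
      rw [← lintegral_indicator hS, ← lintegral_indicator hT] at hlaw
      refine Eq.trans (lintegral_congr fun ω => ?_) (hlaw.symm.trans (lintegral_congr fun ω => ?_))
      · by_cases a : trunc n (G.path ω) ∈ D <;> by_cases b : G.time n ω < ∞ <;>
          simp [a, b]
      · by_cases a : trunc n (G.path ω) ∈ D <;> by_cases b : G.time n ω < ∞ <;>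
          by_cases c : G.time n ω + (t : ℝ≥0∞) ≤ G.time (n + 1) ω <;>
          simp [a, b, c]
    rw [e1, ← measure_sdiff]
    · congr 1
      ext ω
      by_cases a : trunc n (G.path ω) ∈ D <;> by_cases b : G.time n ω < ∞ <;> simp [a, b]
    · exact fun ω h => ⟨h.1, h.2.1⟩
    · exact ((hm hD).inter hS).nullMeasurableSet
    · exact measure_ne_top _ _
  · refine ((lintegral_mono hle).trans_lt ?_).ne
    rw [lintegral_one]
    exact measure_lt_top _ _

end SwitchProcess

/-! ### From waiting times to the compensator formula -/

/-- Two measures on `α × ℝ` agree as soon as they agree on the sets `D × (-∞, t)`. -/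
lemma Measure.ext_prod_Iio {α : Type*} [MeasurableSpace α] {ν₁ ν₂ : Measure (α × ℝ)}
    [IsFiniteMeasure ν₁]
    (h : ∀ D : Set α, MeasurableSet D → ∀ t : ℝ, ν₁ (D ×ˢ Set.Iio t) = ν₂ (D ×ˢ Set.Iio t)) :
    ν₁ = ν₂ := by
  refine Measure.ext_prod fun {D B} hD hB => ?_
  have hDm : MeasurableSet (D ×ˢ (Set.univ : Set ℝ)) := hD.prod MeasurableSet.univ
  have hval : ∀ (ν : Measure (α × ℝ)) (B : Set ℝ), MeasurableSet B →
      ((ν.restrict (D ×ˢ Set.univ)).map Prod.snd) B = ν (D ×ˢ B) := by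
    intro ν B hB
    rw [Measure.map_apply measurable_snd hB, Measure.restrict_apply (measurable_snd hB)]
    congr 1
    ext ⟨x, y⟩
    simp [and_comm]
  have : (ν₁.restrict (D ×ˢ Set.univ)).map Prod.snd = (ν₂.restrict (D ×ˢ Set.univ)).map Prod.snd := by
    refine Measure.ext_of_generateFrom_of_iUnion (Set.range Set.Iio) (fun n : ℕ => Set.Iio (n : ℝ))
      ?_ isPiSystem_Iio ?_ ?_ ?_ ?_
    · rw [← borel_eq_generateFrom_Iio ℝ]
      exact BorelSpace.measurable_eq
    · exact Set.iUnion_eq_univ_iff.2 fun x => exists_nat_gt x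
    · exact fun n => ⟨_, rfl⟩
    · exact fun n => measure_ne_top _ _
    · rintro _ ⟨t, rfl⟩
      rw [hval _ _ measurableSet_Iio, hval _ _ measurableSet_Iio, h D hD]
  rw [← hval _ _ hB, this, hval _ _ hB]

namespace History

variable {E : Type*}

/-- The set of times between the `n`-th and the following jump. -/
def sojourn (n : ℕ) (p : History E) : Set ℝ :=
  {s : ℝ | (p n).1 < ∞ ∧ time n p ≤ s ∧ ENNReal.ofReal s < (p (n + 1)).1}

lemma measurableSet_sojourn [MeasurableSpace E] (n : ℕ) :
    MeasurableSet {q : History E × ℝ | q.2 ∈ sojourn n q.1} := by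
  have h1 : MeasurableSet {q : History E × ℝ | (q.1 n).1 < ∞} :=
    measurableSet_lt (by fun_prop) measurable_const
  have h2 : MeasurableSet {q : History E × ℝ | time n q.1 ≤ q.2} :=
    measurableSet_le (by fun_prop) (by fun_prop)
  have h3 : MeasurableSet {q : History E × ℝ | ENNReal.ofReal q.2 < (q.1 (n + 1)).1} :=
    measurableSet_lt (by fun_prop) (by fun_prop)
  exact h1.inter (h2.inter h3)

end History

lemma Finset.sum_Icc_one_eq_sum_range {F : Type*} [AddCommMonoid F] (f : ℕ → F) (M : ℕ) :
    ∑ k ∈ Finset.Icc 1 M, f k = ∑ n ∈ Finset.range M, f (n + 1) := by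
  induction M with
  | zero => simp
  | succ M ih => rw [Finset.sum_Icc_succ_top (by omega), ih, Finset.sum_range_succ]

namespace SwitchProcess

variable {E : Type*} [Fintype E] [MeasurableSpace E]
  {c : JumpCharacteristics E} {γ₀ : E} {M : ℕ}
  {Ω : Type*} [MeasurableSpace Ω] {μ : Measure Ω} (G : SwitchProcess c γ₀ M μ)
  [MeasurableSingletonClass E] [IsProbabilityMeasure μ]

lemma time_succ_lt_top {n : ℕ} {ω : Ω} (h : G.time (n + 1) ω < ∞) : G.time n ω < ∞ :=
  (G.time_mono ω n.le_succ).trans_lt h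

lemma measurable_rate_mark (n : ℕ) : Measurable fun ω => (c.rate (G.mark n ω) : ℝ≥0∞) :=
  (measurable_of_finite fun e => (c.rate e : ℝ≥0∞)).comp (G.measurable_mark n)

/-- The density of the waiting time on the event that the jump has not happened yet. -/
noncomputable def waitDensity (n : ℕ) (q : Ω × ℝ) : ℝ≥0∞ :=
  {q : Ω × ℝ | G.time n q.1 + ENNReal.ofReal q.2 ≤ G.time (n + 1) q.1}.indicator
    (fun q => (c.rate (G.mark n q.1) : ℝ≥0∞)) q

lemma waitDensity_of_le {n : ℕ} {ω : Ω} {w : ℝ}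
    (h : G.time n ω + ENNReal.ofReal w ≤ G.time (n + 1) ω) :
    G.waitDensity n (ω, w) = c.rate (G.mark n ω) := by
  simp [waitDensity, h]

lemma waitDensity_of_not_le {n : ℕ} {ω : Ω} {w : ℝ}
    (h : ¬ G.time n ω + ENNReal.ofReal w ≤ G.time (n + 1) ω) : G.waitDensity n (ω, w) = 0 := by
  simpa [waitDensity] using fun h' => absurd h' h

lemma measurable_waitDensity (n : ℕ) : Measurable (G.waitDensity n) := by
  refine Measurable.indicator ((G.measurable_rate_mark n).comp measurable_fst) ?_
  exact measurableSet_le (((G.measurable_time n).comp measurable_fst).add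
    (ENNReal.measurable_ofReal.comp measurable_snd)) ((G.measurable_time _).comp measurable_fst)

lemma time_sub_lt_iff {n : ℕ} {ω : Ω} (h : G.time (n + 1) ω < ∞) {t : ℝ} (ht : 0 ≤ t) :
    History.time (n + 1) (G.path ω) - History.time n (G.path ω) < t ↔
      G.time (n + 1) ω < G.time n ω + ENNReal.ofReal t := by
  have h' := G.time_succ_lt_top h
  change (G.time (n + 1) ω).toReal - (G.time n ω).toReal < t ↔ _
  rw [← ENNReal.toReal_lt_toReal h.ne (by finiteness), ENNReal.toReal_add h'.ne (by finiteness),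
    ENNReal.toReal_ofReal ht, sub_lt_iff_lt_add']

/-- Extends `measure_wait_lt` from half-lines to the joint law of past and waiting time. For
negative `t` both sides vanish, since waiting times are positive. -/
lemma map_wait_eq {n : ℕ} (hn : n < M) :
    (μ.restrict {ω | G.time (n + 1) ω < ∞}).map (fun ω => (trunc n (G.path ω),
        History.time (n + 1) (G.path ω) - History.time n (G.path ω))) =
      (((μ.restrict {ω | G.time n ω < ∞}).prod (volume.restrict (Set.Ici (0 : ℝ)))).withDensity
        (G.waitDensity n)).map (fun q => (trunc n (G.path q.1), q.2)) := by
  have hm : Measurable fun ω => trunc n (G.path ω) := by fun_prop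
  have hm1 : Measurable fun ω => (trunc n (G.path ω),
        History.time (n + 1) (G.path ω) - History.time n (G.path ω)) := by fun_prop
  have hm2 : Measurable fun q : Ω × ℝ => (trunc n (G.path q.1), q.2) := by fun_prop
  have hT := G.measurableSet_time_lt_top n
  refine Measure.ext_prod_Iio fun D hD t => ?_
  have hDt : MeasurableSet (D ×ˢ Set.Iio t) := hD.prod measurableSet_Iio
  have hDT : MeasurableSet {ω | trunc n (G.path ω) ∈ D ∧ G.time n ω < ∞} := (hm hD).inter hT
  rw [Measure.map_apply hm1 hDt, Measure.map_apply hm2 hDt, Measure.restrict_apply (hm1 hDt),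
    withDensity_apply _ (hm2 hDt)]
  have hpre : (fun q : Ω × ℝ => (trunc n (G.path q.1), q.2)) ⁻¹' (D ×ˢ Set.Iio t) =
      ((fun ω => trunc n (G.path ω)) ⁻¹' D) ×ˢ Set.Iio t := rfl
  rw [hpre, ← Measure.prod_restrict, Measure.restrict_restrict (hm hD),
    Measure.restrict_restrict measurableSet_Iio,
    lintegral_prod _ (G.measurable_waitDensity n).aemeasurable]
  have hI : Set.Iio t ∩ Set.Ici 0 = Set.Ico 0 t := by
    ext; simp [and_comm]
  rw [hI]
  rcases le_or_gt 0 t with ht | ht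
  · have := G.measure_wait_lt hn t.toNNReal hD
    rw [Real.coe_toNNReal t ht] at this
    refine Eq.trans ?_ this
    congr 1
    ext ω
    simp only [Set.mem_inter_iff, Set.mem_preimage, Set.mem_prod, Set.mem_Iio, Set.mem_ofPred_eq]
    constructor
    · rintro ⟨⟨h1, h2⟩, h3⟩
      exact ⟨h1, G.time_succ_lt_top h3, (G.time_sub_lt_iff h3 ht).1 h2⟩
    · rintro ⟨h1, h2, h3⟩
      have h4 : G.time (n + 1) ω < ∞ := h3.trans (by finiteness)
      exact ⟨⟨h1, (G.time_sub_lt_iff h4 ht).2 h3⟩, h4⟩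
  · have e : (fun ω => (trunc n (G.path ω), History.time (n + 1) (G.path ω) -
        History.time n (G.path ω))) ⁻¹' (D ×ˢ Set.Iio t) ∩ {ω | G.time (n + 1) ω < ∞} = ∅ := by
      ext ω
      simp only [Set.mem_inter_iff, Set.mem_preimage, Set.mem_prod, Set.mem_Iio, Set.mem_ofPred_eq,
        Set.mem_empty_iff_false, iff_false, not_and, and_imp]
      intro _ h2 h3
      have := ImpulsiveSystem.time_le_of_lt_top (G.isPath ω) h3
      linarith
    rw [e, measure_empty, Set.Ico_eq_empty (by linarith)]
    simp

/-- Integrate against the joint law of past and waiting time, then translate by the time of the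
`n`-th jump to pass from elapsed time to absolute time. -/
lemma lintegral_jump_time {n : ℕ} (hn : n < M) {φ : History E × ℝ → ℝ≥0∞} (hφ : Measurable φ) :
    ∫⁻ ω in {ω | G.time (n + 1) ω < ∞}, φ (trunc n (G.path ω), History.time (n + 1) (G.path ω)) ∂μ =
      ∫⁻ ω, (∫⁻ s, (sojourn n (G.path ω)).indicator
        (fun s => (c.rate (G.mark n ω) : ℝ≥0∞) * φ (trunc n (G.path ω), s)) s) ∂μ := by
  have hm1 : Measurable fun ω => (trunc n (G.path ω),
        History.time (n + 1) (G.path ω) - History.time n (G.path ω)) := by fun_prop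
  have hm2 : Measurable fun q : Ω × ℝ => (trunc n (G.path q.1), q.2) := by fun_prop
  set φ' : History E × ℝ → ℝ≥0∞ := fun q => φ (q.1, q.2 + History.time n q.1) with hφ'
  have hφ'm : Measurable φ' := hφ.comp (by fun_prop)
  have h1 : ∀ ω, φ (trunc n (G.path ω), History.time (n + 1) (G.path ω)) =
      φ' (trunc n (G.path ω), History.time (n + 1) (G.path ω) - History.time n (G.path ω)) := by
    intro ω
    simp [hφ', time_trunc le_rfl]
  simp_rw [h1]
  rw [← lintegral_map hφ'm hm1, G.map_wait_eq hn, lintegral_map hφ'm hm2,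
    lintegral_withDensity_eq_lintegral_mul _ (G.measurable_waitDensity n)
      (g := fun q => φ' (trunc n (G.path q.1), q.2)) (hφ'm.comp hm2),
    lintegral_prod _ ((G.measurable_waitDensity n).mul
      (g := fun q : Ω × ℝ => φ' (trunc n (G.path q.1), q.2)) (hφ'm.comp hm2)).aemeasurable,
    ← lintegral_indicator (G.measurableSet_time_lt_top n)]
  refine lintegral_congr fun ω => ?_
  by_cases hω : G.time n ω < ∞
  · rw [Set.indicator_of_mem (show ω ∈ {ω | G.time n ω < ∞} from hω),
      ← lintegral_indicator measurableSet_Ici,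
      ← lintegral_sub_right_eq_self _ (History.time n (G.path ω))]
    -- The waiting density still counts the instant of the next jump while the sojourn excludes it;
    -- this single time is null.
    have hae : ∀ᵐ s : ℝ, s ≠ (G.time (n + 1) ω).toReal := by simp [ae_iff]
    refine lintegral_congr_ae ?_
    filter_upwards [hae] with s hs
    have h0 := time_nonneg n (G.path ω)
    have hiff : (0 ≤ s - History.time n (G.path ω) ∧
        G.time n ω + ENNReal.ofReal (s - History.time n (G.path ω)) ≤ G.time (n + 1) ω) ↔
        s ∈ sojourn n (G.path ω) := by
      simp only [sojourn, Set.mem_ofPred_eq, sub_nonneg]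
      have hp : ((G.path ω) n).1 = G.time n ω := rfl
      have hp' : ((G.path ω) (n + 1)).1 = G.time (n + 1) ω := rfl
      rw [hp, hp', and_iff_right hω]
      refine and_congr_right fun hs0 => ?_
      have : G.time n ω + ENNReal.ofReal (s - History.time n (G.path ω)) = ENNReal.ofReal s := by
        rw [← ENNReal.ofReal_toReal hω.ne, ← ENNReal.ofReal_add ENNReal.toReal_nonneg
          (sub_nonneg.2 hs0)]
        congr 1
        change History.time n (G.path ω) + _ = _
        ring
      rw [this]
      refine ⟨fun h => lt_of_le_of_ne h fun h' => hs ?_, le_of_lt⟩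
      rw [← h', ENNReal.toReal_ofReal (h0.trans hs0)]
    have harg : φ' (trunc n (G.path ω), s - History.time n (G.path ω)) = φ (trunc n (G.path ω), s) := by
      simp [hφ', time_trunc le_rfl]
    by_cases hS : s ∈ sojourn n (G.path ω)
    · obtain ⟨k1, k2⟩ := hiff.2 hS
      rw [Set.indicator_of_mem hS, Set.indicator_of_mem (show _ ∈ Set.Ici _ from k1)]
      simp only [Pi.mul_apply, harg]
      rw [G.waitDensity_of_le k2]
    · rw [Set.indicator_of_notMem hS]
      by_cases k1 : 0 ≤ s - History.time n (G.path ω)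
      · rw [Set.indicator_of_mem (show _ ∈ Set.Ici _ from k1)]
        have k2 := fun h => hS (hiff.1 ⟨k1, h⟩)
        simp only [Pi.mul_apply]
        rw [G.waitDensity_of_not_le k2, zero_mul]
      · rw [Set.indicator_of_notMem (show _ ∉ Set.Ici _ from k1)]
  · rw [Set.indicator_of_notMem (show ω ∉ {ω | G.time n ω < ∞} from hω)]
    have : sojourn n (G.path ω) = ∅ := by
      ext s
      simp only [sojourn, Set.mem_ofPred_eq, Set.mem_empty_iff_false, iff_false, not_and]
      exact fun h => absurd h hω
    simp [this]

/-- Split according to the new mark `θ`, draw it by `lintegral_mark`, and absorb the weight `Q` into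
the integrand of `lintegral_jump_time`. -/
lemma lintegral_jump {n : ℕ} (hn : n < M) {φ : History E × ℝ × E → ℝ≥0∞} (hφ : Measurable φ) :
    ∫⁻ ω in {ω | G.time (n + 1) ω < ∞},
        φ (trunc n (G.path ω), History.time (n + 1) (G.path ω), G.mark (n + 1) ω) ∂μ =
      ∫⁻ ω, (∫⁻ s, (sojourn n (G.path ω)).indicator
        (fun s => ∑ θ, ((c.rate (G.mark n ω) * c.Q (G.mark n ω) θ : ℝ≥0) : ℝ≥0∞) *
          φ (trunc n (G.path ω), s, θ)) s) ∂μ := by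
  have hT := G.measurableSet_time_lt_top (n + 1)
  have hmk : ∀ θ, MeasurableSet {ω | G.time (n + 1) ω < ∞ ∧ G.mark (n + 1) ω = θ} := fun θ =>
    hT.inter (G.measurable_mark (n + 1) (measurableSet_singleton θ))
  have hφθ : ∀ θ, Measurable fun q : History E × ℝ => φ (q.1, q.2, θ) := fun θ =>
    hφ.comp (by fun_prop)
  have h1 : ∫⁻ ω in {ω | G.time (n + 1) ω < ∞},
        φ (trunc n (G.path ω), History.time (n + 1) (G.path ω), G.mark (n + 1) ω) ∂μ =
      ∑ θ, ∫⁻ ω in {ω | G.time (n + 1) ω < ∞ ∧ G.mark (n + 1) ω = θ},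
        φ (trunc n (G.path ω), (G.time (n + 1) ω).toReal, θ) ∂μ := by
    rw [← lintegral_indicator hT, Finset.sum_congr rfl fun θ _ => (lintegral_indicator (hmk θ) _).symm,
      ← lintegral_finsetSum]
    · refine lintegral_congr fun ω => ?_
      by_cases hω : G.time (n + 1) ω < ∞
      · rw [Finset.sum_eq_single (G.mark (n + 1) ω)]
        · simp [hω]; rfl
        · intro θ _ hθ
          simp [hθ.symm]
        · simp
      · simp [hω]
    · intro θ _
      refine Measurable.indicator ?_ (hmk θ)
      have := G.measurable_time (n + 1)
      exact (hφθ θ).comp (f := fun ω => (trunc n (G.path ω), (G.time (n + 1) ω).toReal)) (by fun_prop)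
  have h2 : ∀ θ, ∫⁻ ω in {ω | G.time (n + 1) ω < ∞ ∧ G.mark (n + 1) ω = θ},
        φ (trunc n (G.path ω), (G.time (n + 1) ω).toReal, θ) ∂μ =
      ∫⁻ ω, (∫⁻ s, (sojourn n (G.path ω)).indicator
        (fun s => ((c.rate (G.mark n ω) * c.Q (G.mark n ω) θ : ℝ≥0) : ℝ≥0∞) *
          φ (trunc n (G.path ω), s, θ)) s) ∂μ := by
    intro θ
    rw [G.lintegral_mark hn θ (φ := fun q => φ (q.1, q.2.toReal, θ)) (hφ.comp (by fun_prop))]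
    have := G.lintegral_jump_time hn (φ := fun q => (c.Q (q.1 n).2 θ : ℝ≥0∞) * φ (q.1, q.2, θ))
      (((measurable_of_finite fun e => (c.Q e θ : ℝ≥0∞)).comp (by fun_prop)).mul (hφθ θ))
    simp only [trunc_apply_of_le (le_refl n)] at this
    refine Eq.trans this (lintegral_congr fun ω => lintegral_congr fun s => ?_)
    refine congrArg (fun f => Set.indicator _ f s) (funext fun s => ?_)
    rw [ENNReal.coe_mul, mul_assoc]
    rfl
  rw [h1, Finset.sum_congr rfl fun θ _ => h2 θ]
  have hjm : ∀ θ, Measurable fun q : Ω × ℝ => (sojourn n (G.path q.1)).indicator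
        (fun s => ((c.rate (G.mark n q.1) * c.Q (G.mark n q.1) θ : ℝ≥0) : ℝ≥0∞) *
          φ (trunc n (G.path q.1), s, θ)) q.2 := by
    intro θ
    have hc : Measurable fun q : Ω × ℝ =>
        ((c.rate (G.mark n q.1) * c.Q (G.mark n q.1) θ : ℝ≥0) : ℝ≥0∞) :=
      (measurable_of_finite fun e => ((c.rate e * c.Q e θ : ℝ≥0) : ℝ≥0∞)).comp
        ((G.measurable_mark n).comp measurable_fst)
    have hs : MeasurableSet {q : Ω × ℝ | q.2 ∈ sojourn n (G.path q.1)} :=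
      (measurableSet_sojourn (E := E) n).preimage
        (f := fun q : Ω × ℝ => (G.path q.1, q.2)) (by fun_prop)
    exact (hc.mul ((hφθ θ).comp (g := fun q => φ (q.1, q.2, θ))
      (f := fun q : Ω × ℝ => (trunc n (G.path q.1), q.2)) (by fun_prop))).indicator hs
  rw [← lintegral_finsetSum]
  · refine lintegral_congr fun ω => ?_
    refine (lintegral_finsetSum _ fun θ _ => (hjm θ).comp measurable_prodMk_left).symm.trans ?_
    refine lintegral_congr fun s => ?_
    by_cases hs : s ∈ sojourn n (G.path ω) <;> simp [hs]
  · exact fun θ _ => (hjm θ).lintegral_prod_right'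

/-- A time `s ≥ 0` lies in exactly one sojourn. If it is the one after the `M`-th jump, the
intensity vanishes on the left, and on the right this sojourn is outside the range of summation. -/
lemma sum_sojourn (p : History E) (hp : IsPath M p) {s : ℝ} (hs : 0 ≤ s)
    (F : History E → E → ℝ≥0∞) :
    ∑ θ, (c.lam M (upTo s.toNNReal p) θ : ℝ≥0∞) * F (upTo s.toNNReal p) θ =
      ∑ n ∈ Finset.range M, (sojourn n p).indicator
        (fun _ => ∑ θ, ((c.rate (p n).2 * c.Q (p n).2 θ : ℝ≥0) : ℝ≥0∞) * F (trunc n p) θ) s := by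
  obtain ⟨m, h1, h2⟩ := hp.exists_mem s.toNNReal
  have hm : (p m).1 < ∞ := h1.trans_lt coe_lt_top
  have hmem : s ∈ sojourn m p := by
    refine ⟨hm, ?_, h2⟩
    have := ENNReal.toReal_mono coe_ne_top h1
    simpa [History.time, hs] using this
  have hne : ∀ n, n ≠ m → s ∉ sojourn n p := by
    rintro n hnm ⟨k1, k2, k3⟩
    rcases lt_or_gt_of_ne hnm with h | h
    · have : (p (n + 1)).1 ≤ (p m).1 := hp.mono (show n + 1 ≤ m by omega)
      exact absurd (k3.trans_le (this.trans h1)) (by simp [ENNReal.ofReal])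
    · have h3 : (p (m + 1)).1 ≤ (p n).1 := hp.mono (show m + 1 ≤ n by omega)
      have h4 : (p n).1 ≤ ENNReal.ofReal s := by
        rw [← ENNReal.ofReal_toReal k1.ne]; exact ENNReal.ofReal_le_ofReal k2
      exact absurd (h2.trans_le (h3.trans h4)) (by simp [ENNReal.ofReal])
  rw [hp.upTo_eq h1 h2]
  have hmM := hp.le_of_lt_top hm
  rcases hmM.lt_or_eq with h | h
  · rw [Finset.sum_eq_single_of_mem m (Finset.mem_range.2 h), Set.indicator_of_mem hmem]
    · simp only [c.lam_trunc hp hm, if_neg h.ne]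
    · intro n _ hn
      rw [Set.indicator_of_notMem (hne n hn)]
  · rw [Finset.sum_eq_zero fun n hn => Set.indicator_of_notMem (hne n ?_) _]
    · simp only [c.lam_trunc hp hm, if_pos h]
      simp
    · have := Finset.mem_range.1 hn
      omega

/-- The compensator formula for nonnegative predictable integrands. -/
theorem lintegral_compensator {F : History E × ℝ × E → ℝ≥0∞} (hF : Measurable F) :
    ∫⁻ ω, (∑ k ∈ Finset.Icc 1 M, if G.time k ω < ∞ then
        F (trunc (k - 1) (G.path ω), History.time k (G.path ω), G.mark k ω) else 0) ∂μ =
      ∫⁻ ω, (∫⁻ s in Set.Ici (0 : ℝ), ∑ θ, (c.lam M (upTo s.toNNReal (G.path ω)) θ : ℝ≥0∞) *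
        F (upTo s.toNNReal (G.path ω), s, θ)) ∂μ := by
  have hl : ∀ n, ∫⁻ ω, {ω | G.time (n + 1) ω < ∞}.indicator (fun ω =>
      F (trunc n (G.path ω), History.time (n + 1) (G.path ω), G.mark (n + 1) ω)) ω ∂μ =
      ∫⁻ ω in {ω | G.time (n + 1) ω < ∞},
        F (trunc n (G.path ω), History.time (n + 1) (G.path ω), G.mark (n + 1) ω) ∂μ :=
    fun n => lintegral_indicator (G.measurableSet_time_lt_top (n + 1)) _
  have e1 : ∀ ω, (∑ k ∈ Finset.Icc 1 M, if G.time k ω < ∞ then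
        F (trunc (k - 1) (G.path ω), History.time k (G.path ω), G.mark k ω) else 0) =
      ∑ n ∈ Finset.range M, {ω | G.time (n + 1) ω < ∞}.indicator (fun ω =>
        F (trunc n (G.path ω), History.time (n + 1) (G.path ω), G.mark (n + 1) ω)) ω := by
    intro ω
    rw [Finset.sum_Icc_one_eq_sum_range]
    refine Finset.sum_congr rfl fun n _ => ?_
    by_cases h : G.time (n + 1) ω < ∞ <;> simp [h]
  simp_rw [e1]
  rw [lintegral_finsetSum]
  swap
  · intro n _
    refine Measurable.indicator ?_ (G.measurableSet_time_lt_top (n + 1))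
    have := G.measurable_mark (n + 1)
    exact hF.comp (by fun_prop)
  rw [Finset.sum_congr rfl fun n hn => (hl n).trans (G.lintegral_jump (Finset.mem_range.1 hn) hF)]
  have hjm : ∀ n, Measurable fun q : Ω × ℝ => (sojourn n (G.path q.1)).indicator
        (fun s => ∑ θ, ((c.rate (G.mark n q.1) * c.Q (G.mark n q.1) θ : ℝ≥0) : ℝ≥0∞) *
          F (trunc n (G.path q.1), s, θ)) q.2 := by
    intro n
    refine Measurable.indicator (f := fun q : Ω × ℝ =>
      ∑ θ, ((c.rate (G.mark n q.1) * c.Q (G.mark n q.1) θ : ℝ≥0) : ℝ≥0∞) *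
          F (trunc n (G.path q.1), q.2, θ)) ?_ ((measurableSet_sojourn (E := E) n).preimage
        (f := fun q : Ω × ℝ => (G.path q.1, q.2)) (by fun_prop))
    refine Finset.measurable_sum _ fun θ _ => ?_
    refine ((measurable_of_finite fun e => ((c.rate e * c.Q e θ : ℝ≥0) : ℝ≥0∞)).comp
        ((G.measurable_mark n).comp measurable_fst)).mul ?_
    exact hF.comp (g := F) (f := fun q : Ω × ℝ => (trunc n (G.path q.1), q.2, θ)) (by fun_prop)
  rw [← lintegral_finsetSum _ fun n _ => (hjm n).lintegral_prod_right']
  refine lintegral_congr fun ω => ?_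
  refine (lintegral_finsetSum _ fun n _ => (hjm n).comp measurable_prodMk_left).symm.trans ?_
  rw [← lintegral_indicator measurableSet_Ici]
  refine lintegral_congr fun s => ?_
  by_cases hs : s ∈ Set.Ici (0 : ℝ)
  · rw [Set.indicator_of_mem hs, sum_sojourn (G.path ω) (G.isPath ω) hs fun h θ => F (h, s, θ)]
    rfl
  · rw [Set.indicator_of_notMem hs]
    refine Finset.sum_eq_zero fun n _ => ?_
    have : s ∉ sojourn n (G.path ω) := fun h => hs ((time_nonneg n _).trans h.2.1)
    simp [this]

end SwitchProcess

/-! ### The natural filtration in terms of histories -/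

namespace History

variable {E : Type*}

lemma upTo_upTo {r t : ℝ≥0} (hrt : r ≤ t) (h : History E) : upTo r (upTo t h) = upTo r h := by
  have h0 : (upTo t h 0).2 = (h 0).2 := by
    unfold upTo; split_ifs <;> rfl
  funext k
  have hrt' : (r : ℝ≥0∞) ≤ t := by exact_mod_cast hrt
  by_cases hk : (h k).1 ≤ t
  · simp only [upTo, hk, if_true] at h0 ⊢
    rw [h0]
  · have hk' : ¬ (h k).1 ≤ r := fun h' => hk (h'.trans hrt')
    simp only [upTo, hk, hk', if_false] at h0 ⊢
    simp [h0]

lemma upTo_before {r t : ℝ≥0} (hrt : r < t) (h : History E) :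
    upTo r (before t h) = upTo r h := by
  have h0 : (before t h 0).2 = (h 0).2 := by
    unfold before; split_ifs <;> rfl
  funext k
  have hrt' : (r : ℝ≥0∞) < t := by exact_mod_cast hrt
  by_cases hk : (h k).1 < t
  · simp only [upTo, before, hk, if_true] at h0 ⊢
    rw [h0]
  · have hk' : ¬ (h k).1 ≤ r := fun h' => hk (h'.trans_lt hrt')
    simp only [upTo, before, hk, hk', if_false] at h0 ⊢
    simp [h0]

end History

namespace SwitchProcess

variable {E : Type*} [Fintype E] [MeasurableSpace E]
  {c : JumpCharacteristics E} {γ₀ : E} {M : ℕ}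
  {Ω : Type*} [MeasurableSpace Ω] {μ : Measure Ω} (G : SwitchProcess c γ₀ M μ)

lemma exists_dense_between {a b : ℝ≥0∞} (h : a < b) :
    ∃ n, a < (TopologicalSpace.denseSeq ℝ≥0 n : ℝ≥0∞) ∧ (TopologicalSpace.denseSeq ℝ≥0 n : ℝ≥0∞) < b := by
  obtain ⟨x, hx1, hx2⟩ := ENNReal.lt_iff_exists_nnreal_btwn.1 h
  obtain ⟨y, hy1, hy2⟩ := ENNReal.lt_iff_exists_nnreal_btwn.1 hx2
  have hxy : x < y := by exact_mod_cast hy1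
  obtain ⟨n, hn⟩ := (TopologicalSpace.denseRange_denseSeq ℝ≥0).exists_mem_open isOpen_Ioo
    (Set.nonempty_Ioo.2 hxy)
  exact ⟨n, hx1.trans (by exact_mod_cast hn.1), lt_trans (by exact_mod_cast hn.2) hy2⟩

lemma mode_of_mem {n : ℕ} {t : ℝ≥0} {ω : Ω} (h1 : G.time n ω ≤ t) (h2 : t < G.time (n + 1) ω) :
    G.mode t ω = G.mark n ω := by
  rw [mode_eq, (G.isPath ω).upTo_eq h1 h2, (G.isPath ω).last_trunc (h1.trans_lt coe_lt_top)]
  rfl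

variable [MeasurableSingletonClass E]

lemma measurable_mode_filtration {r t : ℝ≥0} (hrt : r ≤ t) : Measurable[G.filtration t] (G.mode r) := by
  rw [measurable_iff_comap_le]
  exact le_iSup₂_of_le r hrt le_rfl

/-- Sample times: a countable dense set of times, and `t` itself. -/
noncomputable def sampleTime (t : ℝ≥0) : Option ℕ → ℝ≥0
  | none => t
  | some n => min t (TopologicalSpace.denseSeq ℝ≥0 n)

lemma sampleTime_le (t : ℝ≥0) (i : Option ℕ) : sampleTime t i ≤ t := by
  cases i <;> simp [sampleTime]

lemma exists_sampleTime {t : ℝ≥0} {a b : ℝ≥0∞} (hab : a < b) (ha : a ≤ t) :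
    ∃ i, a ≤ sampleTime t i ∧ sampleTime t i < b := by
  by_cases hb : (t : ℝ≥0∞) < b
  · exact ⟨none, ha, hb⟩
  · obtain ⟨n, h1, h2⟩ := exists_dense_between hab
    refine ⟨some n, ?_, ?_⟩
    · simp only [sampleTime, ENNReal.coe_min]
      exact le_min ha h1.le
    · simp only [sampleTime, ENNReal.coe_min]
      exact min_lt_of_right_lt h2

/-- The jump times are stopping times. -/
lemma measurableSet_time_le (k : ℕ) (t : ℝ≥0) : MeasurableSet[G.filtration t] {ω | G.time k ω ≤ t} := by
  induction k generalizing t with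
  | zero => simp [G.time_zero]
  | succ k ih =>
    have hk : ∀ {r}, r ≤ t → MeasurableSet[G.filtration t] {ω | G.time k ω ≤ r} := fun {r} hr =>
      G.filtration.mono hr _ (ih r)
    -- The next jump has occurred by `t` exactly when two sample times after the `k`-th jump show
    -- different modes; this uses that a jump really changes the mode. The time `t` must itself be a
    -- sample, to detect a jump occurring exactly at `t`.
    have e : {ω | G.time (k + 1) ω ≤ t} = ⋃ i, ⋃ j, ({ω | G.time k ω ≤ sampleTime t i} ∩
        {ω | G.time k ω ≤ sampleTime t j}) ∩
          {ω | G.mode (sampleTime t i) ω = G.mode (sampleTime t j) ω}ᶜ := by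
      ext ω
      simp only [Set.mem_ofPred_eq, Set.mem_iUnion, Set.mem_inter_iff, Set.mem_compl_iff]
      constructor
      · intro h
        have hk1 : G.time k ω < G.time (k + 1) ω :=
          G.time_lt k ω ((G.time_mono ω k.le_succ).trans_lt (h.trans_lt coe_lt_top))
        have hk2 : G.time (k + 1) ω < G.time (k + 2) ω :=
          G.time_lt (k + 1) ω (h.trans_lt coe_lt_top)
        obtain ⟨i, hi1, hi2⟩ := exists_sampleTime hk1 (hk1.le.trans h)
        obtain ⟨j, hj1, hj2⟩ := exists_sampleTime hk2 h
        refine ⟨i, j, ⟨hi1, hk1.le.trans hj1⟩, ?_⟩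
        rw [G.mode_of_mem hi1 hi2, G.mode_of_mem hj1 hj2]
        exact (G.mark_ne k ω (h.trans_lt coe_lt_top)).symm
      · rintro ⟨i, j, ⟨hi, hj⟩, hne⟩
        by_contra hlt
        rw [not_le] at hlt
        have hc : ∀ i, (sampleTime t i : ℝ≥0∞) < G.time (k + 1) ω := fun i =>
          lt_of_le_of_lt (by exact_mod_cast sampleTime_le t i) hlt
        exact hne (by rw [G.mode_of_mem hi (hc i), G.mode_of_mem hj (hc j)])
    rw [e]
    refine MeasurableSet.iUnion fun i => MeasurableSet.iUnion fun j => ?_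
    refine ((hk (sampleTime_le t i)).inter (hk (sampleTime_le t j))).inter (MeasurableSet.compl ?_)
    exact measurableSet_eq_fun (G.measurable_mode_filtration (sampleTime_le t i))
      (G.measurable_mode_filtration (sampleTime_le t j))

/-- The mark is read off as the mode at a sample time between the `k`-th jump and the following one.
-/
lemma measurableSet_time_le_mark (k : ℕ) (t : ℝ≥0) (θ : E) :
    MeasurableSet[G.filtration t] {ω | G.time k ω ≤ t ∧ G.mark k ω = θ} := by
  have e : {ω | G.time k ω ≤ t ∧ G.mark k ω = θ} = ⋃ i, ({ω | G.time k ω ≤ sampleTime t i} ∩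
      {ω | G.time (k + 1) ω ≤ sampleTime t i}ᶜ) ∩ G.mode (sampleTime t i) ⁻¹' {θ} := by
    ext ω
    simp only [Set.mem_ofPred_eq, Set.mem_iUnion, Set.mem_inter_iff, Set.mem_compl_iff, not_le,
      Set.mem_preimage, Set.mem_singleton_iff]
    constructor
    · rintro ⟨h, rfl⟩
      obtain ⟨i, hi1, hi2⟩ := exists_sampleTime (G.time_lt k ω (h.trans_lt coe_lt_top)) h
      exact ⟨i, ⟨hi1, hi2⟩, G.mode_of_mem hi1 hi2⟩
    · rintro ⟨i, ⟨hi1, hi2⟩, hi3⟩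
      refine ⟨hi1.trans (by exact_mod_cast sampleTime_le t i), ?_⟩
      rw [← hi3, G.mode_of_mem hi1 hi2]
  rw [e]
  refine MeasurableSet.iUnion fun i => ?_
  have hF := G.filtration.mono (sampleTime_le t i)
  refine ((hF _ (G.measurableSet_time_le k _)).inter
    (hF _ (G.measurableSet_time_le (k + 1) _)).compl).inter ?_
  exact G.measurable_mode_filtration (sampleTime_le t i) (measurableSet_singleton θ)

lemma measurable_upTo_path (t : ℝ≥0) : Measurable[G.filtration t] fun ω => upTo t (G.path ω) := by
  refine @measurable_pi_iff Ω ℕ (fun _ => ℝ≥0∞ × E) (G.filtration t) _ _ |>.2 fun k => ?_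
  refine Measurable.prodMk (f := fun ω => (upTo t (G.path ω) k).1)
    (g := fun ω => (upTo t (G.path ω) k).2) ?_ ?_
  · refine @measurable_of_Iic ℝ≥0∞ Ω _ _ _ (G.filtration t) _ _ _ _ fun a => ?_
    by_cases ha : a = ∞
    · subst ha
      simp
    · have e : (fun ω => (upTo t (G.path ω) k).1) ⁻¹' Set.Iic a =
          {ω | G.time k ω ≤ ((min a.toNNReal t : ℝ≥0) : ℝ≥0∞)} := by
        ext ω
        simp only [Set.mem_preimage, Set.mem_Iic, Set.mem_ofPred_eq, ENNReal.coe_min,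
          ENNReal.coe_toNNReal ha, le_min_iff, upTo]
        change (if G.time k ω ≤ t then (G.path ω) k else (∞, ((G.path ω) 0).2)).1 ≤ a ↔ _
        by_cases h : G.time k ω ≤ t
        · simp only [h, if_true, and_true]; rfl
        · simp [h, ha]
      rw [e]
      exact G.filtration.mono (min_le_right _ _) _ (G.measurableSet_time_le k _)
  · refine @measurable_to_countable' E Ω _ _ (G.filtration t) _ fun θ => ?_
    have e : (fun ω => (upTo t (G.path ω) k).2) ⁻¹' {θ} =
        {ω | G.time k ω ≤ t ∧ G.mark k ω = θ} ∪ ({ω | G.time k ω ≤ t}ᶜ ∩ {_ω | γ₀ = θ}) := by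
      ext ω
      simp only [Set.mem_preimage, Set.mem_singleton_iff, Set.mem_union, Set.mem_inter_iff,
        Set.mem_compl_iff, Set.mem_ofPred_eq, upTo]
      change (if G.time k ω ≤ t then (G.path ω) k else (∞, ((G.path ω) 0).2)).2 = θ ↔ _
      by_cases h : G.time k ω ≤ t
      · simp only [h, if_true, true_and, not_true, false_and, or_false]; rfl
      · simp only [h, if_false, false_and, not_false_iff, true_and, false_or]
        rw [show ((G.path ω) 0).2 = γ₀ from G.mark_zero ω]
    rw [e]
    exact (G.measurableSet_time_le_mark k t θ).union
      ((G.measurableSet_time_le k t).compl.inter (MeasurableSet.const _))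

/-- The natural filtration is generated by the stopped histories. -/
lemma filtration_eq_comap (t : ℝ≥0) :
    G.filtration t = MeasurableSpace.comap (fun ω => upTo t (G.path ω)) inferInstance := by
  refine le_antisymm (iSup₂_le fun r hr => ?_) (G.measurable_upTo_path t).comap_le
  have e : G.mode r = (fun h => last M (upTo r h)) ∘ fun ω => upTo t (G.path ω) := by
    funext ω
    simp only [Function.comp_apply, upTo_upTo hr, mode_eq]
  rw [e, ← MeasurableSpace.comap_comp]
  refine MeasurableSpace.comap_mono (Measurable.comap_le ?_)
  exact (measurable_last M).comp (measurable_upTo.comp measurable_prodMk_left)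

variable {U : Type*} [TopologicalSpace U]

/-- On `[0, i]` the history up to `t` is a measurable function of `t` and of the history up to `i`,
and the latter is measurable at time `i`. -/
lemma isStronglyProgressive_of_upTo {w : History E × ℝ≥0 → U} (hw : StronglyMeasurable w) :
    IsStronglyProgressive G.filtration fun t ω => w (upTo t (G.path ω), t) := by
  intro i
  have e : (fun q : Set.Iic i × Ω => w (upTo q.1 (G.path q.2), q.1)) =
      (fun q : Set.Iic i × History E => w (upTo q.1 q.2, q.1)) ∘
        fun q => (q.1, upTo i (G.path q.2)) := by
    funext q
    simp only [Function.comp_apply, upTo_upTo q.1.2]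
  rw [e]
  have h1 : StronglyMeasurable fun q : Set.Iic i × History E => w (upTo q.1 q.2, q.1) := by
    refine hw.comp_measurable (Measurable.prodMk ?_ (measurable_subtype_coe.comp measurable_fst))
    exact measurable_upTo.comp (measurable_subtype_coe.prodMap measurable_id)
  refine h1.comp_measurable ?_
  exact @Measurable.prodMk _ (Subtype.instMeasurableSpace.prod (G.filtration i)) _ _ _ _ _ _
    (@measurable_fst _ _ _ (G.filtration i))
    ((G.measurable_upTo_path i).comp (@measurable_snd _ _ _ (G.filtration i)))

/-- A jump strictly before `t` has happened by some time `r < t` of a countable dense set. The event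
is therefore a countable union of predictable rectangles `(r, ∞) × A` with `A` observable at time
`r`. -/
lemma measurable_before_path : Measurable[G.filtration.predictable]
    fun q : ℝ≥0 × Ω => (before q.1 (G.path q.2), q.1) := by
  have hfst : Measurable[G.filtration.predictable] (Prod.fst : ℝ≥0 × Ω → ℝ≥0) := by
    refine @measurable_of_Ioi ℝ≥0 _ _ _ _ G.filtration.predictable _ _ _ _ fun a => ?_
    have : (Prod.fst ⁻¹' Set.Ioi a : Set (ℝ≥0 × Ω)) = Set.Ioi a ×ˢ Set.univ := by
      ext; simp
    rw [this]
    exact measurableSet_predictable_Ioi_prod MeasurableSet.univ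
  refine Measurable.prodMk (m := G.filtration.predictable)
    (f := fun q : ℝ≥0 × Ω => before q.1 (G.path q.2)) ?_ hfst
  refine @measurable_pi_iff _ ℕ (fun _ => ℝ≥0∞ × E) G.filtration.predictable _ _ |>.2 fun k => ?_
  have hset : ∀ B : Set (ℝ≥0∞ × E), MeasurableSet B →
      MeasurableSet[G.filtration.predictable] {q : ℝ≥0 × Ω | G.time k q.2 < q.1 ∧ (G.path q.2) k ∈ B} := by
    intro B hB
    have e : {q : ℝ≥0 × Ω | G.time k q.2 < q.1 ∧ (G.path q.2) k ∈ B} =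
        ⋃ n, Set.Ioi (TopologicalSpace.denseSeq ℝ≥0 n) ×ˢ
          {ω | upTo (TopologicalSpace.denseSeq ℝ≥0 n) (G.path ω) k ∈ B ∩ {x | x.1 < ∞}} := by
      ext ⟨t, ω⟩
      simp only [Set.mem_ofPred_eq, Set.mem_iUnion, Set.mem_prod, Set.mem_Ioi, Set.mem_inter_iff]
      constructor
      · rintro ⟨h1, h2⟩
        obtain ⟨n, hn1, hn2⟩ := exists_dense_between h1
        refine ⟨n, by exact_mod_cast hn2, ?_⟩
        have : ((G.path ω) k).1 ≤ TopologicalSpace.denseSeq ℝ≥0 n := hn1.le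
        simp only [upTo, this, if_true]
        exact ⟨h2, this.trans_lt coe_lt_top⟩
      · rintro ⟨n, hn, h2, h3⟩
        by_cases h : ((G.path ω) k).1 ≤ TopologicalSpace.denseSeq ℝ≥0 n
        · simp only [upTo, h, if_true] at h2
          exact ⟨h.trans_lt (by exact_mod_cast hn), h2⟩
        · simp [upTo, h] at h3
    rw [e]
    refine MeasurableSet.iUnion fun n => measurableSet_predictable_Ioi_prod ?_
    exact ((measurable_pi_apply k).comp (G.measurable_upTo_path _))
      (hB.inter (measurableSet_lt measurable_fst measurable_const))
  intro B hB
  have e : (fun q : ℝ≥0 × Ω => before q.1 (G.path q.2) k) ⁻¹' B =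
      {q : ℝ≥0 × Ω | G.time k q.2 < q.1 ∧ (G.path q.2) k ∈ B} ∪
        ({q : ℝ≥0 × Ω | G.time k q.2 < q.1 ∧ (G.path q.2) k ∈ Set.univ}ᶜ ∩
          {_q | ((∞, γ₀) : ℝ≥0∞ × E) ∈ B}) := by
    ext ⟨t, ω⟩
    simp only [Set.mem_preimage, Set.mem_union, Set.mem_inter_iff,
        Set.mem_compl_iff, Set.mem_ofPred_eq, Set.mem_univ, and_true, before]
    change (if G.time k ω < t then (G.path ω) k else (∞, ((G.path ω) 0).2)) ∈ B ↔ _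
    by_cases h : G.time k ω < t
    · simp [h]
    · simp only [h, if_false, false_and, not_false_iff, true_and, false_or]
      rw [show ((G.path ω) 0).2 = γ₀ from G.mark_zero ω]
  rw [e]
  exact (hset B hB).union ((hset _ MeasurableSet.univ).compl.inter (MeasurableSet.const _))

lemma isStronglyPredictable_of_before {w : History E × ℝ≥0 → U} (hw : StronglyMeasurable w) :
    IsStronglyPredictable G.filtration fun t ω => w (before t (G.path ω), t) :=
  hw.comp_measurable G.measurable_before_path

lemma upTo_zero_path (ω : Ω) : upTo 0 (G.path ω) = fun k => if k = 0 then (0, γ₀) else (∞, γ₀) := by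
  have h1 : ((G.path ω) 0).1 = 0 := G.time_zero ω
  have h2 : ((G.path ω) 0).2 = γ₀ := G.mark_zero ω
  have hlt : (0 : ℝ≥0∞) < ((G.path ω) 1).1 := by
    have := (G.isPath ω).lt 0 (by simp [h1])
    rwa [h1] at this
  rw [(G.isPath ω).upTo_eq (n := 0) (by simp [h1]) (by simpa using hlt)]
  funext k
  by_cases hk : k = 0
  · subst hk
    simp [trunc, Prod.ext_iff, h1, h2]
  · simp [trunc, hk, h2]

/-- Check the generators. For `(t, ∞) × A`, the event `A` is read from the history up to `t`, which
the history strictly before any later time determines. For `{0} × A`, the event `A` is trivial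
because the history at time 0 is deterministic. -/
lemma predictable_le_comap : G.filtration.predictable ≤
    MeasurableSpace.comap (fun q : ℝ≥0 × Ω => (before q.1 (G.path q.2), q.1)) inferInstance := by
  have hm : Measurable[MeasurableSpace.comap (fun q : ℝ≥0 × Ω => (before q.1 (G.path q.2), q.1))
      inferInstance] (fun q : ℝ≥0 × Ω => (before q.1 (G.path q.2), q.1)) := comap_measurable _
  refine MeasurableSpace.generateFrom_le ?_
  rintro s (⟨A, hA, rfl⟩ | ⟨t, A, hA, rfl⟩)
  · have hA' : A = ∅ ∨ A = Set.univ := by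
      rw [show (⊥ : ℝ≥0) = 0 from rfl, filtration_eq_comap] at hA
      obtain ⟨D, -, rfl⟩ := hA
      by_cases hD : (fun k => if k = 0 then (0, γ₀) else (∞, γ₀) : History E) ∈ D
      · right; ext ω; simp [upTo_zero_path, hD]
      · left; ext ω; simp [upTo_zero_path, hD]
    rcases hA' with rfl | rfl
    · simp
    · have : (({⊥} : Set ℝ≥0) ×ˢ (Set.univ : Set Ω)) =
          (fun q : ℝ≥0 × Ω => (before q.1 (G.path q.2), q.1)) ⁻¹' (Set.univ ×ˢ {⊥}) := by
        ext; simp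
      rw [this]
      exact hm (MeasurableSet.univ.prod (measurableSet_singleton _))
  · rw [filtration_eq_comap] at hA
    obtain ⟨D, hD, rfl⟩ := hA
    have : (Set.Ioi t ×ˢ ((fun ω => upTo t (G.path ω)) ⁻¹' D)) =
        (fun q : ℝ≥0 × Ω => (before q.1 (G.path q.2), q.1)) ⁻¹'
          {q | t < q.2 ∧ upTo t q.1 ∈ D} := by
      ext ⟨s, ω⟩
      simp only [Set.mem_prod, Set.mem_Ioi, Set.mem_preimage, Set.mem_ofPred_eq]
      refine and_congr_right fun hs => ?_
      rw [upTo_before hs]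
    rw [this]
    refine hm ((measurableSet_lt measurable_const measurable_snd).inter ?_)
    exact (measurable_upTo.comp measurable_prodMk_left |>.comp measurable_fst) hD

/-- A predictable process is a function of time and of the history strictly before it. -/
lemma exists_eq_before [Nonempty U] [TopologicalSpace.IsCompletelyMetrizableSpace U]
    {v : ℝ≥0 → Ω → U} (hv : IsStronglyPredictable G.filtration v) :
    ∃ w : History E × ℝ≥0 → U, StronglyMeasurable w ∧
      ∀ t ω, v t ω = w (before t (G.path ω), t) := by
  obtain ⟨w, hw, he⟩ := (StronglyMeasurable.mono hv G.predictable_le_comap).exists_eq_measurable_comp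
  exact ⟨w, hw, fun t ω => congrFun he (t, ω)⟩

/-- For a fixed horizon `i` this is factorization through the generating map. The function obtained
still looks ahead, to the history up to `i` instead of `t`; `exists_eq_upTo` removes this. -/
lemma exists_eq_upTo_of_le [Nonempty U] [TopologicalSpace.IsCompletelyMetrizableSpace U]
    {u : ℝ≥0 → Ω → U} (hu : IsStronglyProgressive G.filtration u) (i : ℝ≥0) :
    ∃ w : ℝ≥0 × History E → U, StronglyMeasurable w ∧
      ∀ t ω, t ≤ i → u t ω = w (t, upTo i (G.path ω)) := by
  have hle : (Subtype.instMeasurableSpace.prod (G.filtration i) : MeasurableSpace (Set.Iic i × Ω)) ≤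
      MeasurableSpace.comap (fun q : Set.Iic i × Ω => (q.1, upTo i (G.path q.2))) inferInstance := by
    rw [filtration_eq_comap]
    refine sup_le ?_ ?_
    · rw [← measurable_iff_comap_le]
      exact measurable_fst.comp (f := fun q : Set.Iic i × Ω => (q.1, upTo i (G.path q.2)))
        (comap_measurable _)
    · rw [MeasurableSpace.comap_comp, ← measurable_iff_comap_le]
      exact measurable_snd.comp (f := fun q : Set.Iic i × Ω => (q.1, upTo i (G.path q.2)))
        (comap_measurable _)
  obtain ⟨w, hw, he⟩ := ((hu i).mono hle).exists_eq_measurable_comp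
  refine ⟨fun q => w (⟨min q.1 i, Set.mem_Iic.2 (min_le_right _ _)⟩, q.2), hw.comp_measurable ?_, fun t ω ht => ?_⟩
  · exact ((measurable_fst.min measurable_const).subtype_mk).prodMk measurable_snd
  · have := congrFun he (⟨t, ht⟩, ω)
    simpa [min_eq_left ht] using this

/-- A progressive process is a function of time and of the history up to it. -/
lemma exists_eq_upTo {U : Type*} [NormedAddCommGroup U] [CompleteSpace U] [MeasurableSpace U]
    [BorelSpace U] [SecondCountableTopology U]
    {u : ℝ≥0 → Ω → U} (hu : IsStronglyProgressive G.filtration u) :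
    ∃ w : History E × ℝ≥0 → U, StronglyMeasurable w ∧
      ∀ t ω, u t ω = w (upTo t (G.path ω), t) := by
  choose w hw hwe using G.exists_eq_upTo_of_le hu
  -- With `m` the integer part of `t * (k + 1)`, `a k m` is a grid point strictly above `t` and
  -- within `1 / (k + 1)` of it. There are countably many grid points, so joint measurability
  -- survives the dependence of the horizon on `t`.
  set a : ℕ → ℕ → ℝ≥0 := fun k m => ((m : ℝ≥0) + 1) / ((k : ℝ≥0) + 1) with ha
  set f : ℕ → History E × ℝ≥0 → U := fun k q =>
    w (a k ⌊q.2 * ((k : ℝ≥0) + 1)⌋₊) (q.2, q.1) with hf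
  have hfm : ∀ k, StronglyMeasurable (f k) := by
    intro k
    have h1 : Measurable fun q : ℕ × (ℝ≥0 × History E) => w (a k q.1) q.2 :=
      measurable_from_prod_countable_right fun m => (hw (a k m)).measurable
    refine Measurable.stronglyMeasurable (h1.comp (g := fun q : ℕ × (ℝ≥0 × History E) => w (a k q.1) q.2)
      (f := fun q : History E × ℝ≥0 => (⌊q.2 * ((k : ℝ≥0) + 1)⌋₊, (q.2, q.1))) ?_)
    exact (Nat.measurable_floor.comp (by fun_prop)).prodMk (by fun_prop)
  refine ⟨fun q => Filter.limUnder Filter.atTop fun k => f k q, StronglyMeasurable.limUnder hfm,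
    fun t ω => ?_⟩
  obtain ⟨n, h1, h2⟩ := (G.isPath ω).exists_mem t
  have hgt : ∀ k, t < a k ⌊t * ((k : ℝ≥0) + 1)⌋₊ := by
    intro k
    rw [ha, lt_div_iff₀ (by positivity)]
    exact Nat.lt_floor_add_one _
  have hlim : Filter.Tendsto (fun k : ℕ => t + 1 / ((k : ℝ≥0) + 1)) Filter.atTop (nhds (t + 0)) :=
    tendsto_const_nhds.add tendsto_one_div_add_atTop_nhds_zero_nat
  have hle : ∀ k : ℕ, a k ⌊t * ((k : ℝ≥0) + 1)⌋₊ ≤ t + 1 / ((k : ℝ≥0) + 1) := by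
    intro k
    have hk : (0 : ℝ≥0) < (k : ℝ≥0) + 1 := by positivity
    rw [ha, div_le_iff₀ hk, add_mul, div_mul_cancel₀ _ hk.ne']
    exact add_le_add (Nat.floor_le (by positivity)) le_rfl
  -- No jump occurs just after `t`, so for large `k` the history up to the grid point equals the
  -- history up to `t`, and the look-ahead disappears: the approximations are eventually equal to `u
  -- t ω`.
  have hev : ∀ᶠ k : ℕ in Filter.atTop, f k (upTo t (G.path ω), t) = u t ω := by
    obtain ⟨b, hb1, hb2⟩ := ENNReal.lt_iff_exists_nnreal_btwn.1 h2
    have hb : t < b := by exact_mod_cast hb1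
    rw [add_zero] at hlim
    filter_upwards [hlim.eventually_lt_const hb] with k hk
    have hk2 : ((a k ⌊t * ((k : ℝ≥0) + 1)⌋₊ : ℝ≥0) : ℝ≥0∞) < ((G.path ω) (n + 1)).1 :=
      lt_of_le_of_lt (by exact_mod_cast (hle k).trans hk.le) hb2
    have hk1 : ((G.path ω) n).1 ≤ (a k ⌊t * ((k : ℝ≥0) + 1)⌋₊ : ℝ≥0) :=
      h1.trans (by exact_mod_cast (hgt k).le)
    rw [hwe _ t ω (hgt k).le, (G.isPath ω).upTo_eq hk1 hk2, (G.isPath ω).upTo_eq h1 h2]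
  exact ((tendsto_const_nhds.congr' (hev.mono fun _ h => h.symm)).limUnder_eq).symm

end SwitchProcess

/-! ### Pathwise integration by parts and duality -/

namespace ImpulsiveSystem

variable {E V : Type*} [NormedAddCommGroup V] [InnerProductSpace ℝ V] [CompleteSpace V]
  {Z₁ Z₂ : ImpulsiveSystem E V} {M : ℕ} {p : History E}

lemma inner_sol_primitive (hp : IsPath M p)
    (hg₁ : ∀ t : ℝ≥0, IntervalIntegrable (fun s : ℝ => Z₁.g (upTo s.toNNReal p) s) volume 0 t)
    (hg₂ : ∀ t : ℝ≥0, IntervalIntegrable (fun s : ℝ => Z₂.g (upTo s.toNNReal p) s) volume 0 t)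
    {n : ℕ} (hn : (p n).1 < ∞) {b : ℝ} (hnb : time n p ≤ b) (hb : ENNReal.ofReal b ≤ (p (n + 1)).1) :
    IntervalIntegrable (fun s =>
        inner ℝ (Z₁.L (trunc n p) (Z₁.sol n p s) + Z₁.g (trunc n p) s) (Z₂.sol n p s) +
        inner ℝ (Z₁.sol n p s) (Z₂.L (trunc n p) (Z₂.sol n p s) + Z₂.g (trunc n p) s)) volume
        (time n p) b ∧
      inner ℝ (Z₁.sol n p b) (Z₂.sol n p b) =
        inner ℝ (Z₁.sol n p (time n p)) (Z₂.sol n p (time n p)) + ∫ s in time n p..b,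
          (inner ℝ (Z₁.L (trunc n p) (Z₁.sol n p s) + Z₁.g (trunc n p) s) (Z₂.sol n p s) +
        inner ℝ (Z₁.sol n p s) (Z₂.L (trunc n p) (Z₂.sol n p s) + Z₂.g (trunc n p) s)) := by
  have h : ∀ r ∈ Set.uIcc (time n p) b, time n p ≤ r ∧ ENNReal.ofReal r ≤ (p (n + 1)).1 := by
    intro r hr
    rw [Set.uIcc_of_le hnb] at hr
    exact ⟨hr.1, (ENNReal.ofReal_le_ofReal hr.2).trans hb⟩
  exact bilin_primitive (innerSL ℝ) (sol_primitive hp hg₁ hn hnb hb).1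
    (sol_primitive hp hg₂ hn hnb hb).1
    (fun r hr => (sol_primitive hp hg₁ hn (h r hr).1 (h r hr).2).2)
    (fun r hr => (sol_primitive hp hg₂ hn (h r hr).1 (h r hr).2).2)

/-- Integration by parts for two impulsive systems along the same path. -/
theorem inner_value (hp : IsPath M p)
    (hg₁ : ∀ t : ℝ≥0, IntervalIntegrable (fun s : ℝ => Z₁.g (upTo s.toNNReal p) s) volume 0 t)
    (hg₂ : ∀ t : ℝ≥0, IntervalIntegrable (fun s : ℝ => Z₂.g (upTo s.toNNReal p) s) volume 0 t)
    {φ : History E → ℝ → ℝ} {J : History E → ℝ → E → ℝ}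
    (hφ : ∀ h s, φ h s = inner ℝ (Z₁.L h (Z₁.value M h s) + Z₁.g h s) (Z₂.value M h s) +
        inner ℝ (Z₁.value M h s) (Z₂.L h (Z₂.value M h s) + Z₂.g h s))
    (hJ : ∀ h s θ, J h s θ = inner ℝ (Z₁.value M h s + Z₁.D h θ (Z₁.value M h s) + Z₁.j h s θ)
        (Z₂.value M h s + Z₂.D h θ (Z₂.value M h s) + Z₂.j h s θ) -
        inner ℝ (Z₁.value M h s) (Z₂.value M h s)) (t : ℝ≥0) :
    IntervalIntegrable (fun s : ℝ => φ (upTo s.toNNReal p) s) volume 0 t ∧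
    inner ℝ (Z₁.value M (upTo t p) t) (Z₂.value M (upTo t p) t) =
      inner ℝ Z₁.w₀ Z₂.w₀ + (∫ s in (0 : ℝ)..t, φ (upTo s.toNNReal p) s) +
        ∑ k ∈ Finset.Icc 1 M, if (p k).1 ≤ t then
          J (trunc (k - 1) p) (time k p) (p k).2 else 0 := by
  have hvt : ∀ (Z : ImpulsiveSystem E V) {n : ℕ} (s : ℝ), (p n).1 < ∞ →
      Z.value M (trunc n p) s = Z.sol n p s := by
    intro Z n s hn
    rw [value, hp.count_trunc hn, sol_trunc _ _ _ le_rfl]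
  obtain ⟨n, h1, h2⟩ := hp.exists_mem t
  have hmain := hp.eq_integral_add_sum (f := fun s : ℝ => φ (upTo s.toNNReal p) s)
    (J := fun k => J (trunc (k - 1) p) (time k p) (p k).2)
    (Y := fun n s => inner ℝ (Z₁.sol n p s) (Z₂.sol n p s)) ?_ ?_ (h1.trans_lt coe_lt_top) (b := t)
      (ENNReal.toReal_mono coe_ne_top h1) (by simpa using h2.le)
  · refine ⟨hmain.1, ?_⟩
    rw [hp.sum_jumps _ h1 h2, value_upTo hp h1 h2, value_upTo hp h1 h2, hmain.2,
      ← sol_zero_time Z₁ p, ← sol_zero_time Z₂ p, hp.time_zero]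
  · intro n b hn hnb hb
    have hae : ∀ᵐ s, s ∈ Set.uIoc (time n p) b →
        inner ℝ (Z₁.L (trunc n p) (Z₁.sol n p s) + Z₁.g (trunc n p) s) (Z₂.sol n p s) +
        inner ℝ (Z₁.sol n p s) (Z₂.L (trunc n p) (Z₂.sol n p s) + Z₂.g (trunc n p) s) =
        φ (upTo s.toNNReal p) s := by
      have : ∀ᵐ s : ℝ, s ≠ b := by simp [ae_iff]
      filter_upwards [this] with s hs hs'
      rw [Set.uIoc_of_le hnb] at hs'
      obtain ⟨h1, h2⟩ := hp.mem_of_mem_Ico hn hb ⟨hs'.1.le, lt_of_le_of_ne hs'.2 hs⟩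
      rw [hp.upTo_eq h1 h2, hφ, hvt _ _ hn, hvt _ _ hn]
    obtain ⟨k1, k2⟩ := inner_sol_primitive hp hg₁ hg₂ hn hnb hb
    refine ⟨k1.congr_ae ((ae_restrict_iff' measurableSet_uIoc).2 hae), ?_⟩
    rw [← intervalIntegral.integral_congr_ae hae]
    exact k2
  · intro n hn
    have hn' : (p n).1 < ∞ := (hp.mono n.le_succ).trans_lt hn
    simp only [sol_succ_time, Nat.add_sub_cancel, hJ, hvt _ _ hn']
    ring

end ImpulsiveSystem

namespace SwitchCoefficients

variable {E : Type*} [Fintype E] {N d : ℕ} (S : SwitchCoefficients E N d)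
  (c : JumpCharacteristics E) (M : ℕ)

/-- The state equation as an impulsive system. -/
noncomputable def stateSystem (u : History E × ℝ≥0 → EuclideanSpace ℝ (Fin d))
    (x : EuclideanSpace ℝ (Fin N)) : ImpulsiveSystem E (EuclideanSpace ℝ (Fin N)) where
  L h := S.A (last M h) - ∑ θ, (c.lam M h θ : ℝ) • S.C (last M h) θ
  g h s := S.B (last M h) (u (h, s.toNNReal))
  D h θ := S.C (last M h) θ
  j _ _ _ := 0
  w₀ := x

/-- The dual equation as an impulsive system. -/
noncomputable def dualSystem (v : E → History E × ℝ≥0 → EuclideanSpace ℝ (Fin N))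
    (y : EuclideanSpace ℝ (Fin N)) : ImpulsiveSystem E (EuclideanSpace ℝ (Fin N)) where
  L h := -(S.A (last M h)).adjoint
  g h s := - ∑ θ, (c.lam M h θ : ℝ) • (v θ (h, s.toNNReal) +
    (S.C (last M h) θ).adjoint (v θ (h, s.toNNReal)))
  D _ _ := 0
  j h s θ := v θ (h, s.toNNReal)
  w₀ := y

/-- The jump of `⟪X, Y⟫`. -/
noncomputable def pairingJump (u : History E × ℝ≥0 → EuclideanSpace ℝ (Fin d))
    (v : E → History E × ℝ≥0 → EuclideanSpace ℝ (Fin N)) (x y : EuclideanSpace ℝ (Fin N))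
    (h : History E) (s : ℝ) (θ : E) : ℝ :=
  inner ℝ (S.C (last M h) θ ((S.stateSystem c M u x).value M h s))
      ((S.dualSystem c M v y).value M h s) +
    inner ℝ ((S.stateSystem c M u x).value M h s +
      S.C (last M h) θ ((S.stateSystem c M u x).value M h s)) (v θ (h, s.toNNReal))

variable {S c M} {u : History E × ℝ≥0 → EuclideanSpace ℝ (Fin d)}
  {v : E → History E × ℝ≥0 → EuclideanSpace ℝ (Fin N)} {x y : EuclideanSpace ℝ (Fin N)}
  {p : History E}

/-- The pathwise duality between the state and the dual equation. -/
theorem inner_state_dual (hp : IsPath M p)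
    (hg₁ : ∀ t : ℝ≥0, IntervalIntegrable
      (fun s : ℝ => (S.stateSystem c M u x).g (upTo s.toNNReal p) s) volume 0 t)
    (hg₂ : ∀ t : ℝ≥0, IntervalIntegrable
      (fun s : ℝ => (S.dualSystem c M v y).g (upTo s.toNNReal p) s) volume 0 t) (t : ℝ≥0) :
    inner ℝ ((S.stateSystem c M u x).value M (upTo t p) t)
        ((S.dualSystem c M v y).value M (upTo t p) t) =
      inner ℝ x y + (∫ s in (0 : ℝ)..t,
        (inner ℝ (S.B (last M (upTo s.toNNReal p)) (u (upTo s.toNNReal p, s.toNNReal)))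
          ((S.dualSystem c M v y).value M (upTo s.toNNReal p) s) -
        ∑ θ, (c.lam M (upTo s.toNNReal p) θ : ℝ) *
          S.pairingJump c M u v x y (upTo s.toNNReal p) s θ)) +
        ∑ k ∈ Finset.Icc 1 M, if (p k).1 ≤ t then
          S.pairingJump c M u v x y (trunc (k - 1) p) (time k p) (p k).2 else 0 := by
  refine (ImpulsiveSystem.inner_value hp hg₁ hg₂
    (φ := fun h s => inner ℝ (S.B (last M h) (u (h, s.toNNReal)))
        ((S.dualSystem c M v y).value M h s) - ∑ θ, (c.lam M h θ : ℝ) *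
          S.pairingJump c M u v x y h s θ) (J := S.pairingJump c M u v x y) ?_ ?_ t).2
  -- The `A` terms cancel by adjointness. The compensators left in the two drifts add up to minus
  -- the sum over `θ` of intensity times the jump of `⟪X, Y⟫`; only the control term survives
  -- besides.
  · intro h s
    set X := (S.stateSystem c M u x).value M h s with hX
    set Y := (S.dualSystem c M v y).value M h s with hY
    simp only [pairingJump, ← hX, ← hY]
    clear_value X Y
    simp only [stateSystem, dualSystem, sub_apply, neg_apply, inner_add_left, inner_add_right,
      inner_sub_left, inner_neg_right, inner_sum, sum_inner, sum_apply, smul_apply,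
      inner_smul_left, inner_smul_right, ContinuousLinearMap.adjoint_inner_right, mul_add,
      Finset.sum_add_distrib, conj_trivial]
    ring
  · intro h s θ
    set X := (S.stateSystem c M u x).value M h s with hX
    set Y := (S.dualSystem c M v y).value M h s with hY
    simp only [pairingJump, ← hX, ← hY]
    simp only [stateSystem, dualSystem, zero_apply, add_zero, inner_add_left, inner_add_right]
    ring

end SwitchCoefficients

/-! ### Uniform bounds and measurability of both systems -/

namespace SwitchCoefficients

variable {E : Type*} [Fintype E] {N d : ℕ} (S : SwitchCoefficients E N d)
  (c : JumpCharacteristics E)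

/-- A bound for all coefficients of the state and the dual system. -/
noncomputable def bound : ℝ :=
  ∑ γ, (‖S.A γ‖ + ‖S.B γ‖ + ∑ θ, ((c.rate γ * c.Q γ θ : ℝ≥0) + 1 : ℝ) * ‖S.C γ θ‖)

lemma bound_nonneg : 0 ≤ S.bound c := by
  unfold bound; positivity

lemma bound_term_le (γ : E) :
    ‖S.A γ‖ + ‖S.B γ‖ + ∑ θ, ((c.rate γ * c.Q γ θ : ℝ≥0) + 1 : ℝ) * ‖S.C γ θ‖ ≤ S.bound c :=
  Finset.single_le_sum (f := fun γ => ‖S.A γ‖ + ‖S.B γ‖ +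
    ∑ θ, ((c.rate γ * c.Q γ θ : ℝ≥0) + 1 : ℝ) * ‖S.C γ θ‖) (fun _ _ => by positivity)
    (Finset.mem_univ γ)

lemma norm_A_le (γ : E) : ‖S.A γ‖ ≤ S.bound c := by
  refine le_trans ?_ (S.bound_term_le c γ)
  rw [add_assoc]
  exact le_add_of_nonneg_right (by positivity)

lemma norm_B_le (γ : E) : ‖S.B γ‖ ≤ S.bound c := by
  refine le_trans ?_ (S.bound_term_le c γ)
  rw [add_comm ‖S.A γ‖, add_assoc]
  exact le_add_of_nonneg_right (by positivity)

/-- The summand 1 in the weights of `bound` serves here: one constant must control `C` itself, in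
the impulses, as well as intensity times `C`, in the drift. -/
lemma norm_C_le (γ θ : E) : ‖S.C γ θ‖ ≤ S.bound c := by
  refine le_trans ?_ (S.bound_term_le c γ)
  have h := Finset.single_le_sum (f := fun θ => ((c.rate γ * c.Q γ θ : ℝ≥0) + 1 : ℝ) * ‖S.C γ θ‖)
    (fun _ _ => by positivity) (Finset.mem_univ θ)
  have h1 : ‖S.C γ θ‖ ≤ ((c.rate γ * c.Q γ θ : ℝ≥0) + 1 : ℝ) * ‖S.C γ θ‖ :=
    le_mul_of_one_le_left (norm_nonneg _) (le_add_of_nonneg_left (NNReal.coe_nonneg _))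
  have h2 : 0 ≤ ‖S.A γ‖ + ‖S.B γ‖ := by positivity
  exact h1.trans (h.trans (le_add_of_nonneg_left h2))

variable (M : ℕ)

lemma norm_stateSystem_L_le (u : History E × ℝ≥0 → EuclideanSpace ℝ (Fin d))
    (x : EuclideanSpace ℝ (Fin N)) (h : History E) :
    ‖(S.stateSystem c M u x).L h‖ ≤ S.bound c := by
  refine le_trans ?_ (S.bound_term_le c (last M h))
  refine (norm_sub_le _ _).trans (add_le_add (le_add_of_nonneg_right (norm_nonneg _)) ?_)
  refine (norm_sum_le _ _).trans (Finset.sum_le_sum fun θ _ => ?_)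
  rw [norm_smul, Real.norm_of_nonneg (NNReal.coe_nonneg _)]
  refine mul_le_mul_of_nonneg_right ?_ (norm_nonneg _)
  have := c.lam_le M h θ
  have : (c.lam M h θ : ℝ) ≤ (c.rate (last M h) * c.Q (last M h) θ : ℝ≥0) := by exact_mod_cast this
  linarith

lemma norm_stateSystem_D_le (u : History E × ℝ≥0 → EuclideanSpace ℝ (Fin d))
    (x : EuclideanSpace ℝ (Fin N)) (h : History E) (θ : E) :
    ‖(S.stateSystem c M u x).D h θ‖ ≤ S.bound c := S.norm_C_le c _ _

lemma norm_dualSystem_L_le (v : E → History E × ℝ≥0 → EuclideanSpace ℝ (Fin N))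
    (y : EuclideanSpace ℝ (Fin N)) (h : History E) :
    ‖(S.dualSystem c M v y).L h‖ ≤ S.bound c := by
  change ‖-(S.A (last M h)).adjoint‖ ≤ _
  rw [norm_neg, LinearIsometryEquiv.norm_map]
  exact S.norm_A_le c _

lemma norm_dualSystem_D_le (v : E → History E × ℝ≥0 → EuclideanSpace ℝ (Fin N))
    (y : EuclideanSpace ℝ (Fin N)) (h : History E) (θ : E) :
    ‖(S.dualSystem c M v y).D h θ‖ ≤ S.bound c := by
  change ‖(0 : EuclideanSpace ℝ (Fin N) →L[ℝ] EuclideanSpace ℝ (Fin N))‖ ≤ _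
  rw [norm_zero]
  exact S.bound_nonneg c

section Measurability

variable [MeasurableSpace E] [MeasurableSingletonClass E]

lemma stronglyMeasurable_last {α : Type*} [TopologicalSpace α] (f : E → α) :
    StronglyMeasurable fun h : History E => f (last M h) :=
  (StronglyMeasurable.of_discrete (f := f)).comp_measurable (measurable_last M)

lemma stronglyMeasurable_lam (θ : E) : StronglyMeasurable fun h : History E => (c.lam M h θ : ℝ) :=
  (measurable_coe_nnreal_real.comp (c.measurable_lam M θ)).stronglyMeasurable

lemma stronglyMeasurable_clm_apply {α V W : Type*} [MeasurableSpace α] [NormedAddCommGroup V]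
    [NormedSpace ℝ V] [NormedAddCommGroup W] [NormedSpace ℝ W] {L : α → V →L[ℝ] W} {w : α → V}
    (hL : StronglyMeasurable L) (hw : StronglyMeasurable w) :
    StronglyMeasurable fun a => L a (w a) :=
  (isBoundedBilinearMap_apply (𝕜 := ℝ) (E := V) (F := W)).continuous.comp_stronglyMeasurable
    (hL.prodMk hw)

lemma isMeasurable_stateSystem {u : History E × ℝ≥0 → EuclideanSpace ℝ (Fin d)}
    (hu : StronglyMeasurable u) (x : EuclideanSpace ℝ (Fin N)) :
    (S.stateSystem c M u x).IsMeasurable where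
  L := by
    refine (stronglyMeasurable_last M S.A).sub (Finset.stronglyMeasurable_fun_sum _ fun θ _ => ?_)
    exact (stronglyMeasurable_lam c M θ).smul (stronglyMeasurable_last M fun γ => S.C γ θ)
  g := stronglyMeasurable_clm_apply ((stronglyMeasurable_last M S.B).comp_measurable measurable_fst)
    (hu.comp_measurable (measurable_fst.prodMk (measurable_real_toNNReal.comp measurable_snd)))
  D := (StronglyMeasurable.of_discrete (f := fun q : E × E => S.C q.1 q.2)).comp_measurable
    (((measurable_last M).comp measurable_fst).prodMk measurable_snd)
  j := stronglyMeasurable_const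

lemma isMeasurable_dualSystem {v : E → History E × ℝ≥0 → EuclideanSpace ℝ (Fin N)}
    (hv : ∀ θ, StronglyMeasurable (v θ)) (y : EuclideanSpace ℝ (Fin N)) :
    (S.dualSystem c M v y).IsMeasurable where
  L := stronglyMeasurable_last M fun γ => -(S.A γ).adjoint
  g := by
    have hm : Measurable fun q : History E × ℝ => (q.1, q.2.toNNReal) :=
      measurable_fst.prodMk (measurable_real_toNNReal.comp measurable_snd)
    refine StronglyMeasurable.fun_neg (Finset.stronglyMeasurable_fun_sum _ fun θ _ => ?_)
    refine ((stronglyMeasurable_lam c M θ).comp_measurable measurable_fst).smul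
      (((hv θ).comp_measurable hm).add ?_)
    exact stronglyMeasurable_clm_apply
      ((stronglyMeasurable_last M fun γ => (S.C γ θ).adjoint).comp_measurable measurable_fst)
      ((hv θ).comp_measurable hm)
  D := stronglyMeasurable_const
  j := by
    have : Measurable fun q : E × (History E × ℝ≥0) => v q.1 q.2 :=
      measurable_from_prod_countable_right fun θ => (hv θ).measurable
    exact (this.comp (f := fun q : History E × ℝ × E => (q.2.2, (q.1, q.2.1.toNNReal)))
      (by fun_prop)).stronglyMeasurable

end Measurability

end SwitchCoefficients

/-! ### The equations of the statement as impulsive systems along paths -/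

namespace SwitchProcess

variable {E : Type*} [Fintype E] [MeasurableSpace E]
  {c : JumpCharacteristics E} {γ₀ : E} {M : ℕ}
  {Ω : Type*} [MeasurableSpace Ω] {μ : Measure Ω} (G : SwitchProcess c γ₀ M μ)
  {N d : ℕ} (S : SwitchCoefficients E N d)

lemma isStateSolution_iff {u : ℝ≥0 → Ω → EuclideanSpace ℝ (Fin d)}
    {w : History E × ℝ≥0 → EuclideanSpace ℝ (Fin d)}
    (huw : ∀ t ω, u t ω = w (upTo t (G.path ω), t)) (x : EuclideanSpace ℝ (Fin N))
    (X : ℝ≥0 → Ω → EuclideanSpace ℝ (Fin N)) :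
    G.IsStateSolution S x u X ↔
      ∀ᵐ ω ∂μ, (S.stateSystem c M w x).Solves M (G.path ω) fun t => X t ω := by
  refine Filter.eventually_congr (ae_of_all _ fun ω => forall_congr' fun t => ?_)
  have hdrift : (fun s : ℝ => G.stateDrift S u X s.toNNReal ω) =
      (S.stateSystem c M w x).drift (G.path ω) fun t => X t ω := by
    funext s
    simp only [stateDrift, ImpulsiveSystem.drift, SwitchCoefficients.stateSystem, mode_eq,
      intensity_eq, huw, sub_apply, sum_apply, smul_apply]
    abel
  have hj : ∀ k ∈ Finset.Icc 1 M, (if G.time k ω ≤ t then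
        S.C (G.mark (k - 1) ω) (G.mark k ω)
          (Function.leftLim (fun r : ℝ≥0 => X r ω) (G.time k ω).toNNReal) else 0) =
      if ((G.path ω) k).1 ≤ t then
        (S.stateSystem c M w x).impulse (G.path ω) (fun t => X t ω) k else 0 := by
    intro k _
    refine ite_congr rfl (fun hk => ?_) fun _ => rfl
    have hlt : ((G.path ω) (k - 1)).1 < ∞ :=
      ((G.isPath ω).mono (Nat.sub_le k 1)).trans_lt (hk.trans_lt coe_lt_top)
    simp only [ImpulsiveSystem.impulse, SwitchCoefficients.stateSystem, (G.isPath ω).last_trunc hlt,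
      add_zero]
    rfl
  rw [Finset.sum_congr rfl hj, ← hdrift]
  rfl

/-- The two histories differ only at the countably many jump times, which are Lebesgue null. In the
drift a predictable control may thus be read from either one. -/
lemma ae_before_eq_upTo (ω : Ω) :
    ∀ᵐ s : ℝ, 0 ≤ s → before s.toNNReal (G.path ω) = upTo s.toNNReal (G.path ω) := by
  have : ∀ᵐ s : ℝ, ∀ k, s ≠ (G.time k ω).toReal := by
    rw [ae_all_iff]; intro k; simp [ae_iff]
  filter_upwards [this] with s hs h0
  funext k
  have hne : ((G.path ω) k).1 ≠ (s.toNNReal : ℝ≥0∞) := by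
    intro h
    apply hs k
    rw [show G.time k ω = _ from h]
    simp [h0]
  simp only [upTo, before]
  refine if_congr ⟨le_of_lt, fun h => lt_of_le_of_ne h hne⟩ rfl rfl

lemma before_jump {ω : Ω} {k : ℕ} (hk : 1 ≤ k) (h : G.time k ω < ∞) :
    before (G.time k ω).toNNReal (G.path ω) = trunc (k - 1) (G.path ω) := by
  obtain ⟨n, rfl⟩ : ∃ n, k = n + 1 := ⟨k - 1, by omega⟩
  have hlt : ((G.path ω) n).1 < ∞ := ((G.isPath ω).mono n.le_succ).trans_lt h
  have hcoe : ((G.time (n + 1) ω).toNNReal : ℝ≥0∞) = G.time (n + 1) ω := ENNReal.coe_toNNReal h.ne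
  refine (G.isPath ω).before_eq ?_ ?_ <;> rw [hcoe]
  · exact (G.isPath ω).lt n hlt
  · exact le_rfl

/-- The control is a function of the history strictly before `t`. In the drift this may be replaced
by the history up to `t` for almost every time; at the `k`-th jump it is exactly the history of the
first `k - 1` jumps, as the impulse of `dualSystem` requires. -/
lemma isDualSolution_iff {v : ℝ≥0 → Ω → E → EuclideanSpace ℝ (Fin N)}
    {w : E → History E × ℝ≥0 → EuclideanSpace ℝ (Fin N)}
    (hvw : ∀ θ t ω, v t ω θ = w θ (before t (G.path ω), t)) (y : EuclideanSpace ℝ (Fin N))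
    (Y : ℝ≥0 → Ω → EuclideanSpace ℝ (Fin N)) :
    G.IsDualSolution S y v Y ↔
      ∀ᵐ ω ∂μ, (S.dualSystem c M w y).Solves M (G.path ω) fun t => Y t ω := by
  refine Filter.eventually_congr (ae_of_all _ fun ω => forall_congr' fun t => ?_)
  have hdrift : ∀ᵐ s : ℝ, s ∈ Set.uIoc 0 (t : ℝ) → G.dualDrift S v Y s.toNNReal ω =
      (S.dualSystem c M w y).drift (G.path ω) (fun t => Y t ω) s := by
    filter_upwards [G.ae_before_eq_upTo ω] with s hs hs'
    rw [Set.uIoc_of_le (NNReal.coe_nonneg t)] at hs'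
    simp only [dualDrift, ImpulsiveSystem.drift, SwitchCoefficients.dualSystem, mode_eq,
      intensity_eq, hvw, hs hs'.1.le, neg_apply, smul_add, Finset.sum_add_distrib]
    abel
  have hj : ∀ k ∈ Finset.Icc 1 M, (if G.time k ω ≤ t then
        v (G.time k ω).toNNReal ω (G.mark k ω) else 0) =
      if ((G.path ω) k).1 ≤ t then
        (S.dualSystem c M w y).impulse (G.path ω) (fun t => Y t ω) k else 0 := by
    intro k hk
    refine ite_congr rfl (fun hkt => ?_) fun _ => rfl
    rw [hvw, G.before_jump (Finset.mem_Icc.1 hk).1 (hkt.trans_lt coe_lt_top)]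
    simp only [ImpulsiveSystem.impulse, SwitchCoefficients.dualSystem, zero_apply, zero_add]
    rw [show History.time k (G.path ω) = ((G.time k ω).toNNReal : ℝ) from rfl, Real.toNNReal_coe]
    rfl
  rw [Finset.sum_congr rfl hj, intervalIntegral.integral_congr_ae hdrift]
  refine and_congr_left fun _ => ?_
  exact intervalIntegrable_congr_ae ((ae_restrict_iff' measurableSet_uIoc).2 hdrift)

end SwitchProcess

/-! ### Square integrable estimates along the switch process -/

lemma ENNReal.sq_sum_le {ι : Type*} (s : Finset ι) (f : ι → ℝ≥0∞) :
    (∑ i ∈ s, f i) ^ 2 ≤ s.card * ∑ i ∈ s, f i ^ 2 := by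
  have h := ENNReal.inner_le_Lp_mul_Lq s f (fun _ => 1) Real.HolderConjugate.two_two
  simp only [mul_one, ENNReal.one_rpow, Finset.sum_const, nsmul_eq_mul] at h
  have h2 := pow_le_pow_left₀ zero_le h 2
  rw [mul_pow, ← ENNReal.rpow_natCast, ← ENNReal.rpow_natCast, ← ENNReal.rpow_natCast,
    ← ENNReal.rpow_mul, ← ENNReal.rpow_mul] at h2
  norm_num at h2
  rwa [mul_comm] at h2

lemma ENNReal.add_sq_le (a b : ℝ≥0∞) : (a + b) ^ 2 ≤ 2 * (a ^ 2 + b ^ 2) := by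
  have := ENNReal.sq_sum_le (Finset.univ : Finset (Fin 2)) ![a, b]
  simpa using this

lemma ENNReal.add_add_sq_le (a b c : ℝ≥0∞) : (a + b + c) ^ 2 ≤ 3 * (a ^ 2 + b ^ 2 + c ^ 2) := by
  have := ENNReal.sq_sum_le (Finset.univ : Finset (Fin 3)) ![a, b, c]
  simpa [Fin.sum_univ_three] using this

lemma MeasureTheory.sq_lintegral_le {α : Type*} [MeasurableSpace α] {ν : Measure α} {f : α → ℝ≥0∞}
    (hf : AEMeasurable f ν) : (∫⁻ a, f a ∂ν) ^ 2 ≤ ν Set.univ * ∫⁻ a, f a ^ 2 ∂ν := by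
  have h := ENNReal.lintegral_mul_le_Lp_mul_Lq ν Real.HolderConjugate.two_two hf
    (aemeasurable_const (b := 1))
  simp only [Pi.mul_apply, mul_one, ENNReal.one_rpow, lintegral_one] at h
  have h2 := pow_le_pow_left₀ zero_le h 2
  rw [mul_pow, ← ENNReal.rpow_natCast, ← ENNReal.rpow_natCast, ← ENNReal.rpow_natCast,
    ← ENNReal.rpow_mul, ← ENNReal.rpow_mul] at h2
  norm_num at h2
  rwa [mul_comm] at h2

lemma MeasureTheory.memLp_two_iff {α F : Type*} [MeasurableSpace α] [NormedAddCommGroup F]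
    {ν : Measure α} {f : α → F} (hf : AEStronglyMeasurable f ν) :
    MemLp f 2 ν ↔ ∫⁻ a, ‖f a‖ₑ ^ 2 ∂ν < ∞ := by
  rw [MemLp, eLpNorm_lt_top_iff_lintegral_rpow_enorm_lt_top two_ne_zero ENNReal.ofNat_ne_top]
  simp [hf]

namespace ImpulsiveSystem

variable {E V : Type*} [MeasurableSpace E] [NormedAddCommGroup V] [NormedSpace ℝ V]
  [CompleteSpace V] {Z : ImpulsiveSystem E V} {M : ℕ} {p : History E}

/-- Makes `norm_sol_le` uniform in `t ≤ T`: at most `M` jumps occur, so the exponent `M + 1`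
suffices, and the source and the impulses are taken over all of `[0, T]`. -/
lemma enorm_value_le (hp : IsPath M p)
    (hg : ∀ t : ℝ≥0, IntervalIntegrable (fun s : ℝ => Z.g (upTo s.toNNReal p) s) volume 0 t)
    {K : ℝ} (hK : 0 ≤ K) (hL : ∀ h, ‖Z.L h‖ ≤ K) (hD : ∀ h θ, ‖Z.D h θ‖ ≤ K) {t T : ℝ≥0}
    (htT : t ≤ T) : ‖Z.value M (upTo t p) t‖ₑ ≤
      ENNReal.ofReal ((Real.exp (T * K) * Real.exp (T * K) * (2 + K)) ^ (M + 1)) *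
        (‖Z.w₀‖ₑ + (∫⁻ s in Set.Icc (0 : ℝ) T, ‖Z.g (upTo s.toNNReal p) s‖ₑ) +
          ∑ k ∈ Finset.Icc 1 M, if (p k).1 ≤ T then
            ‖Z.j (trunc (k - 1) p) (time k p) (p k).2‖ₑ else 0) := by
  obtain ⟨n, h1, h2⟩ := hp.exists_mem t
  have hn : (p n).1 < ∞ := h1.trans_lt coe_lt_top
  have hnM : n ≤ M := hp.le_of_lt_top hn
  rw [value_upTo hp h1 h2]
  have h := norm_sol_le hp hg hK hL hD n t hn (ENNReal.toReal_mono coe_ne_top h1)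
    (by simpa using h2.le) (T := T) (by exact_mod_cast htT)
  have hbase : 1 ≤ Real.exp (T * K) * Real.exp (T * K) * (2 + K) := by
    have : 1 ≤ Real.exp (T * K) := Real.one_le_exp (by positivity)
    nlinarith
  have hpow : (Real.exp (T * K) * Real.exp (T * K) * (2 + K)) ^ (n + 1) ≤
      (Real.exp (T * K) * Real.exp (T * K) * (2 + K)) ^ (M + 1) :=
    pow_le_pow_right₀ hbase (by omega)
  have hint : 0 ≤ ∫ s in (0 : ℝ)..t, ‖Z.g (upTo s.toNNReal p) s‖ :=
    intervalIntegral.integral_nonneg (NNReal.coe_nonneg t) fun _ _ => norm_nonneg _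
  rw [← ofReal_norm]
  refine (ENNReal.ofReal_le_ofReal (h.trans (mul_le_mul_of_nonneg_right hpow ?_))).trans ?_
  · positivity
  rw [ENNReal.ofReal_mul (by positivity), ENNReal.ofReal_add (by positivity) (by positivity),
    ENNReal.ofReal_add (by positivity) hint, ofReal_norm]
  refine mul_le_mul_of_nonneg_left (add_le_add (add_le_add le_rfl ?_) ?_) zero_le
  · rw [intervalIntegral.integral_of_le (NNReal.coe_nonneg t),
      ofReal_integral_norm_eq_lintegral_enorm (hg t).1]
    refine lintegral_mono_set fun s hs => ⟨hs.1.le, hs.2.trans (by exact_mod_cast htT)⟩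
  · rw [ENNReal.ofReal_sum_of_nonneg fun _ _ => norm_nonneg _, ← hp.sum_jumps _ h1 h2]
    refine Finset.sum_le_sum fun k _ => ?_
    have htT' : (t : ℝ≥0∞) ≤ T := by exact_mod_cast htT
    by_cases hk : (p k).1 ≤ t
    · simp [hk, hk.trans htT', ofReal_norm]
    · simp [hk]

lemma enorm_value_sq_le (hp : IsPath M p)
    (hg : ∀ t : ℝ≥0, IntervalIntegrable (fun s : ℝ => Z.g (upTo s.toNNReal p) s) volume 0 t)
    {K : ℝ} (hK : 0 ≤ K) (hL : ∀ h, ‖Z.L h‖ ≤ K) (hD : ∀ h θ, ‖Z.D h θ‖ ≤ K) {t T : ℝ≥0}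
    (htT : t ≤ T) : ‖Z.value M (upTo t p) t‖ₑ ^ 2 ≤
      ENNReal.ofReal ((Real.exp (T * K) * Real.exp (T * K) * (2 + K)) ^ (M + 1)) ^ 2 *
        (3 * (‖Z.w₀‖ₑ ^ 2 + T * (∫⁻ s in Set.Icc (0 : ℝ) T, ‖Z.g (upTo s.toNNReal p) s‖ₑ ^ 2) +
          M * ∑ k ∈ Finset.Icc 1 M, if (p k).1 ≤ T then
            ‖Z.j (trunc (k - 1) p) (time k p) (p k).2‖ₑ ^ 2 else 0)) := by
  refine (pow_le_pow_left₀ zero_le (enorm_value_le hp hg hK hL hD htT) 2).trans ?_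
  rw [mul_pow]
  refine mul_le_mul_of_nonneg_left ((ENNReal.add_add_sq_le _ _ _).trans ?_) zero_le
  refine mul_le_mul_of_nonneg_left (add_le_add (add_le_add le_rfl ?_) ?_) zero_le
  · have hm : AEMeasurable (fun s : ℝ => ‖Z.g (upTo s.toNNReal p) s‖ₑ)
        (volume.restrict (Set.Icc (0 : ℝ) T)) := by
      rw [Measure.restrict_congr_set Ioc_ae_eq_Icc.symm]
      exact (hg T).1.aestronglyMeasurable.enorm
    refine (sq_lintegral_le hm).trans ?_
    simp
  · refine (ENNReal.sq_sum_le _ _).trans ?_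
    simp only [Nat.card_Icc, Nat.add_sub_cancel]
    refine mul_le_mul_of_nonneg_left (Finset.sum_le_sum fun k _ => ?_) zero_le
    split_ifs <;> simp

end ImpulsiveSystem

namespace SwitchProcess

variable {E : Type*} [Fintype E] [MeasurableSpace E] [MeasurableSingletonClass E]
  {c : JumpCharacteristics E} {γ₀ : E} {M : ℕ}
  {Ω : Type*} [MeasurableSpace Ω] {μ : Measure Ω} [IsProbabilityMeasure μ]
  (G : SwitchProcess c γ₀ M μ) {V : Type*} [NormedAddCommGroup V] [NormedSpace ℝ V]
  [CompleteSpace V]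

/-- The data of an impulsive system are bounded, resp. square integrable, along the switch process. -/
structure SqIntegrable (Z : ImpulsiveSystem E V) (K : ℝ) : Prop where
  meas : Z.IsMeasurable
  nonneg : 0 ≤ K
  L_le : ∀ h, ‖Z.L h‖ ≤ K
  D_le : ∀ h θ, ‖Z.D h θ‖ ≤ K
  g_lt : ∀ S : ℝ≥0, ∫⁻ ω, (∫⁻ s in Set.Icc (0 : ℝ) S,
    ‖Z.g (upTo s.toNNReal (G.path ω)) s‖ₑ ^ 2) ∂μ < ∞
  j_lt : ∀ S : ℝ≥0, ∫⁻ ω, (∑ k ∈ Finset.Icc 1 M, if G.time k ω ≤ S then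
    ‖Z.j (trunc (k - 1) (G.path ω)) (History.time k (G.path ω)) (G.mark k ω)‖ₑ ^ 2 else 0) ∂μ < ∞

@[fun_prop]
lemma measurable_upTo_path_prod :
    Measurable fun q : Ω × ℝ => upTo q.2.toNNReal (G.path q.1) :=
  measurable_upTo.comp (f := fun q : Ω × ℝ => (q.2.toNNReal, G.path q.1)) (by
    have := G.measurable_path; fun_prop)

/-- The law of time on `[0, T]` times the underlying probability. -/
noncomputable abbrev timeMeasure (_G : SwitchProcess c γ₀ M μ) (T : ℝ≥0) : Measure (Ω × ℝ) :=
  μ.prod (volume.restrict (Set.Icc (0 : ℝ) T))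

namespace SqIntegrable

variable {G} {Z : ImpulsiveSystem E V} {K : ℝ} (hZ : G.SqIntegrable Z K)
include hZ

lemma stronglyMeasurable_g :
    StronglyMeasurable fun q : Ω × ℝ => Z.g (upTo q.2.toNNReal (G.path q.1)) q.2 :=
  hZ.meas.g.comp_measurable (g := fun q : Ω × ℝ => (upTo q.2.toNNReal (G.path q.1), q.2)) (by fun_prop)

lemma stronglyMeasurable_value :
    StronglyMeasurable fun q : Ω × ℝ => Z.value M (upTo q.2.toNNReal (G.path q.1)) q.2 :=
  (hZ.meas.value M).comp_measurable
    (g := fun q : Ω × ℝ => (upTo q.2.toNNReal (G.path q.1), q.2)) (by fun_prop)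

/-- Finiteness in expectation gives, off one null set, square integrability on every integer horizon
at once, hence integrability on bounded intervals. On this event the path solutions exist. -/
lemma ae_intervalIntegrable : ∀ᵐ ω ∂μ, ∀ t : ℝ≥0, IntervalIntegrable
    (fun s : ℝ => Z.g (upTo s.toNNReal (G.path ω)) s) volume 0 t := by
  have h : ∀ n : ℕ, ∀ᵐ ω ∂μ, ∫⁻ s in Set.Icc (0 : ℝ) (n : ℝ≥0),
      ‖Z.g (upTo s.toNNReal (G.path ω)) s‖ₑ ^ 2 < ∞ := fun n =>
    ae_lt_top (Measurable.lintegral_prod_right' (f := fun q : Ω × ℝ =>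
      ‖Z.g (upTo q.2.toNNReal (G.path q.1)) q.2‖ₑ ^ 2)
      (hZ.stronglyMeasurable_g.enorm.pow_const 2)) (hZ.g_lt n).ne
  filter_upwards [ae_all_iff.2 h] with ω hω t
  obtain ⟨n, hn⟩ := exists_nat_ge t
  have hsm : StronglyMeasurable fun s : ℝ => Z.g (upTo s.toNNReal (G.path ω)) s :=
    hZ.stronglyMeasurable_g.comp_measurable (g := fun s : ℝ => (ω, s)) measurable_prodMk_left
  have h2 : MemLp (fun s : ℝ => Z.g (upTo s.toNNReal (G.path ω)) s) 2
      (volume.restrict (Set.Icc (0 : ℝ) (n : ℝ≥0))) :=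
    (memLp_two_iff hsm.aestronglyMeasurable).2 (hω n)
  have h3 : IntegrableOn (fun s : ℝ => Z.g (upTo s.toNNReal (G.path ω)) s)
      (Set.Icc (0 : ℝ) (n : ℝ≥0)) := h2.integrable one_le_two
  rw [intervalIntegrable_iff_integrableOn_Ioc_of_le (NNReal.coe_nonneg t)]
  exact h3.mono_set fun s hs => ⟨hs.1.le, hs.2.trans (by exact_mod_cast hn)⟩

lemma ae_solves : ∀ᵐ ω ∂μ, Z.Solves M (G.path ω) fun t => Z.value M (upTo t (G.path ω)) t := by
  filter_upwards [hZ.ae_intervalIntegrable] with ω hω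
  exact ImpulsiveSystem.solves_value (G.isPath ω) hω

/-- The pathwise bound on squares does not involve `t`, so its expectation is a bound uniform on
`[0, T]`. -/
lemma exists_bound (T : ℝ≥0) : ∃ D : ℝ≥0∞, D < ∞ ∧ ∀ t ≤ T,
    ∫⁻ ω, ‖Z.value M (upTo t (G.path ω)) t‖ₑ ^ 2 ∂μ ≤ D := by
  refine ⟨_, ?_, fun t ht => lintegral_mono_ae (hZ.ae_intervalIntegrable.mono fun ω hω =>
    ImpulsiveSystem.enorm_value_sq_le (G.isPath ω) hω hZ.nonneg hZ.L_le hZ.D_le ht)⟩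
  have hm : Measurable fun ω => ∫⁻ s in Set.Icc (0 : ℝ) T,
      ‖Z.g (upTo s.toNNReal (G.path ω)) s‖ₑ ^ 2 :=
    Measurable.lintegral_prod_right' (f := fun q : Ω × ℝ =>
      ‖Z.g (upTo q.2.toNNReal (G.path q.1)) q.2‖ₑ ^ 2) (hZ.stronglyMeasurable_g.enorm.pow_const 2)
  rw [lintegral_const_mul' _ _ (by simp), lintegral_const_mul' _ _ (by simp),
    lintegral_add_left ((hm.const_mul _).const_add _), lintegral_add_left measurable_const,
    lintegral_const_mul' _ _ (by simp), lintegral_const_mul' _ _ (by simp), lintegral_const]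
  refine ENNReal.mul_lt_top (by simp) (ENNReal.mul_lt_top (by simp) ?_)
  refine ENNReal.add_lt_top.2 ⟨ENNReal.add_lt_top.2 ⟨by simp, ?_⟩, ?_⟩
  · exact ENNReal.mul_lt_top (by simp) (hZ.g_lt T)
  · exact ENNReal.mul_lt_top (by simp) (hZ.j_lt T)

lemma memLp_value (T : ℝ≥0) :
    MemLp (fun q : Ω × ℝ => Z.value M (upTo q.2.toNNReal (G.path q.1)) q.2) 2 (G.timeMeasure T) := by
  rw [memLp_two_iff hZ.stronglyMeasurable_value.aestronglyMeasurable]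
  obtain ⟨D, hD, hb⟩ := hZ.exists_bound T
  rw [lintegral_prod_symm' _ (hZ.stronglyMeasurable_value.enorm.pow_const 2)]
  refine (setLIntegral_mono (g := fun _ => D) measurable_const fun s hs => ?_).trans_lt ?_
  · have := hb s.toNNReal (by rw [← NNReal.coe_le_coe, Real.coe_toNNReal s hs.1]; exact hs.2)
    rwa [Real.coe_toNNReal s hs.1] at this
  · simp [ENNReal.mul_lt_top, hD]

end SqIntegrable

/-! ### The compensation formula for real integrands -/

lemma measurable_jump (k : ℕ) : Measurable fun ω =>
    (trunc (k - 1) (G.path ω), History.time k (G.path ω), G.mark k ω) := by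
  have := G.measurable_path
  have := G.measurable_mark k
  fun_prop

lemma measurable_lam_upTo (θ : E) :
    Measurable fun q : Ω × ℝ => c.lam M (upTo q.2.toNNReal (G.path q.1)) θ :=
  (c.measurable_lam M θ).comp G.measurable_upTo_path_prod

/-- The integral of `f` against the jump measure. -/
noncomputable def jumpSum (f : History E × ℝ × E → ℝ) (ω : Ω) : ℝ :=
  ∑ k ∈ Finset.Icc 1 M, if G.time k ω < ∞ then
    f (trunc (k - 1) (G.path ω), History.time k (G.path ω), G.mark k ω) else 0

/-- The density of the integral of `f` against the compensator. -/
noncomputable def rateSum (f : History E × ℝ × E → ℝ) (q : Ω × ℝ) : ℝ :=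
  ∑ θ, (c.lam M (upTo q.2.toNNReal (G.path q.1)) θ : ℝ) *
    f (upTo q.2.toNNReal (G.path q.1), q.2, θ)

lemma integral_compensator_of_nonneg {f : History E × ℝ × E → ℝ} (hf : Measurable f)
    (h0 : ∀ q, 0 ≤ f q)
    (hfin : ∫⁻ ω, (∫⁻ s in Set.Ici (0 : ℝ), ∑ θ, (c.lam M (upTo s.toNNReal (G.path ω)) θ : ℝ≥0∞) *
      ‖f (upTo s.toNNReal (G.path ω), s, θ)‖ₑ) ∂μ < ∞) :
    Integrable (G.jumpSum f) μ ∧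
    Integrable (G.rateSum f) (μ.prod (volume.restrict (Set.Ici (0 : ℝ)))) ∧
    ∫ ω, G.jumpSum f ω ∂μ =
    ∫ q, G.rateSum f q ∂(μ.prod (volume.restrict (Set.Ici (0 : ℝ)))) := by
  set J : Ω → ℝ := G.jumpSum f with hJ
  set B : Ω × ℝ → ℝ := G.rateSum f with hB
  have hJ0 : ∀ ω, 0 ≤ J ω := fun ω => Finset.sum_nonneg fun k _ => by split_ifs <;> simp [h0]
  have hB0 : ∀ q, 0 ≤ B q := fun q => Finset.sum_nonneg fun θ _ =>
    mul_nonneg (NNReal.coe_nonneg _) (h0 _)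
  have hJm : Measurable J := Finset.measurable_fun_sum _ fun k _ =>
    Measurable.ite (G.measurableSet_time_lt_top k) (hf.comp (G.measurable_jump k)) measurable_const
  have hBm : Measurable B := Finset.measurable_fun_sum _ fun θ _ =>
    (measurable_coe_nnreal_real.comp (G.measurable_lam_upTo θ)).mul
      (hf.comp (f := fun q : Ω × ℝ => (upTo q.2.toNNReal (G.path q.1), q.2, θ)) (by fun_prop))
  have hJB : ∫⁻ ω, ENNReal.ofReal (J ω) ∂μ = ∫⁻ q, ENNReal.ofReal (B q)
      ∂(μ.prod (volume.restrict (Set.Ici (0 : ℝ)))) := by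
    rw [lintegral_prod _ hBm.ennreal_ofReal.aemeasurable]
    refine Eq.trans (Eq.trans (lintegral_congr fun ω => ?_)
      (G.lintegral_compensator (F := fun q => ENNReal.ofReal (f q)) hf.ennreal_ofReal))
      (lintegral_congr fun ω => lintegral_congr fun s => ?_)
    · rw [hJ, jumpSum, ENNReal.ofReal_sum_of_nonneg fun k _ => by split_ifs <;> simp [h0]]
      refine Finset.sum_congr rfl fun k _ => ?_
      split_ifs <;> simp
    · rw [hB, rateSum, ENNReal.ofReal_sum_of_nonneg fun θ _ => mul_nonneg (NNReal.coe_nonneg _) (h0 _)]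
      refine Finset.sum_congr rfl fun θ _ => ?_
      rw [ENNReal.ofReal_mul (NNReal.coe_nonneg _), ENNReal.ofReal_coe_nnreal]
  have hBfin : ∫⁻ q, ENNReal.ofReal (B q) ∂(μ.prod (volume.restrict (Set.Ici (0 : ℝ)))) < ∞ := by
    rw [lintegral_prod _ hBm.ennreal_ofReal.aemeasurable]
    refine lt_of_eq_of_lt (lintegral_congr fun ω => lintegral_congr fun s => ?_) hfin
    rw [hB, rateSum, ENNReal.ofReal_sum_of_nonneg fun θ _ => mul_nonneg (NNReal.coe_nonneg _) (h0 _)]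
    refine Finset.sum_congr rfl fun θ _ => ?_
    rw [ENNReal.ofReal_mul (NNReal.coe_nonneg _), ENNReal.ofReal_coe_nnreal,
      Real.enorm_of_nonneg (h0 _)]
  refine ⟨⟨hJm.aestronglyMeasurable, ?_⟩, ⟨hBm.aestronglyMeasurable, ?_⟩, ?_⟩
  · rw [hasFiniteIntegral_iff_ofReal (ae_of_all _ hJ0), hJB]
    exact hBfin
  · rw [hasFiniteIntegral_iff_ofReal (ae_of_all _ hB0)]
    exact hBfin
  · rw [integral_eq_lintegral_of_nonneg_ae (ae_of_all _ hJ0) hJm.aestronglyMeasurable,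
      integral_eq_lintegral_of_nonneg_ae (ae_of_all _ hB0) hBm.aestronglyMeasurable, hJB]

/-- The compensation formula for integrable integrands. -/
theorem integral_compensator {f : History E × ℝ × E → ℝ} (hf : Measurable f)
    (hfin : ∫⁻ ω, (∫⁻ s in Set.Ici (0 : ℝ), ∑ θ, (c.lam M (upTo s.toNNReal (G.path ω)) θ : ℝ≥0∞) *
      ‖f (upTo s.toNNReal (G.path ω), s, θ)‖ₑ) ∂μ < ∞) :
    Integrable (G.jumpSum f) μ ∧
    Integrable (G.rateSum f) (μ.prod (volume.restrict (Set.Ici (0 : ℝ)))) ∧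
    ∫ ω, G.jumpSum f ω ∂μ =
    ∫ q, G.rateSum f q ∂(μ.prod (volume.restrict (Set.Ici (0 : ℝ)))) := by
  have hp : ∀ g : History E × ℝ × E → ℝ, (∀ q, |g q| ≤ |f q|) →
      ∫⁻ ω, (∫⁻ s in Set.Ici (0 : ℝ), ∑ θ, (c.lam M (upTo s.toNNReal (G.path ω)) θ : ℝ≥0∞) *
        ‖g (upTo s.toNNReal (G.path ω), s, θ)‖ₑ) ∂μ < ∞ := by
    intro g hg
    have hg' : ∀ q, ‖g q‖ₑ ≤ ‖f q‖ₑ := fun q => by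
      rw [Real.enorm_eq_ofReal_abs, Real.enorm_eq_ofReal_abs]
      exact ENNReal.ofReal_le_ofReal (hg _)
    refine lt_of_le_of_lt ?_ hfin
    refine lintegral_mono fun ω => lintegral_mono fun s => ?_
    exact Finset.sum_le_sum fun θ _ => mul_le_mul_of_nonneg_left (hg' _) zero_le
  have hp1 := hp (fun q => max (f q) 0) fun q => by
    rw [abs_of_nonneg (le_max_right _ _)]; exact max_le (le_abs_self _) (abs_nonneg _)
  have hp2 := hp (fun q => max (-f q) 0) fun q => by
    rw [abs_of_nonneg (le_max_right _ _)]; exact max_le (neg_le_abs _) (abs_nonneg _)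
  have hm1 : Measurable fun q => max (f q) 0 := hf.max measurable_const
  have hm2 : Measurable fun q => max (-f q) 0 := hf.fun_neg.max measurable_const
  obtain ⟨a1, a2, a3⟩ := G.integral_compensator_of_nonneg hm1 (fun q => le_max_right _ _) hp1
  obtain ⟨b1, b2, b3⟩ := G.integral_compensator_of_nonneg hm2 (fun q => le_max_right _ _) hp2
  have hsub : ∀ q, f q = max (f q) 0 - max (-f q) 0 := fun q => by
    rcases le_total (f q) 0 with h | h
    · rw [max_eq_right h, max_eq_left (by linarith)]; ring
    · rw [max_eq_left h, max_eq_right (by linarith)]; ring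
  have e1 : G.jumpSum f = fun ω =>
      G.jumpSum (fun q => max (f q) 0) ω - G.jumpSum (fun q => max (-f q) 0) ω := by
    funext ω
    simp only [jumpSum]
    rw [← Finset.sum_sub_distrib]
    refine Finset.sum_congr rfl fun k _ => ?_
    split_ifs
    · exact hsub _
    · simp
  have e2 : G.rateSum f = fun q =>
      G.rateSum (fun q => max (f q) 0) q - G.rateSum (fun q => max (-f q) 0) q := by
    funext q
    simp only [rateSum]
    rw [← Finset.sum_sub_distrib]
    refine Finset.sum_congr rfl fun θ _ => ?_
    rw [← mul_sub, ← hsub]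
  rw [e1, e2, integral_sub a1 b1, integral_sub a2 b2, a3, b3]
  exact ⟨a1.sub b1, a2.sub b2, rfl⟩

end SwitchProcess

lemma MeasureTheory.MemLp.integrable_inner_two {α F : Type*} [MeasurableSpace α]
    [NormedAddCommGroup F] [InnerProductSpace ℝ F] {ν : Measure α} {f g : α → F}
    (hf : MemLp f 2 ν) (hg : MemLp g 2 ν) : Integrable (fun a => inner ℝ (f a) (g a)) ν := by
  refine (MemLp.integrable_mul hf.norm hg.norm).mono'
    (hf.aestronglyMeasurable.inner hg.aestronglyMeasurable) (ae_of_all _ fun a => ?_)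
  exact norm_inner_le_norm _ _

namespace SwitchProcess

variable {E : Type*} [Fintype E] [MeasurableSpace E] [MeasurableSingletonClass E]
  {c : JumpCharacteristics E} {γ₀ : E} {M : ℕ}
  {Ω : Type*} [MeasurableSpace Ω] {μ : Measure Ω} [IsProbabilityMeasure μ]
  (G : SwitchProcess c γ₀ M μ)

lemma time_le_iff (k : ℕ) (ω : Ω) (T : ℝ≥0) :
    G.time k ω ≤ T ↔ G.time k ω < ∞ ∧ History.time k (G.path ω) ≤ T := by
  constructor
  · intro h
    exact ⟨h.trans_lt coe_lt_top, ENNReal.toReal_mono coe_ne_top h⟩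
  · rintro ⟨h1, h2⟩
    rw [← ENNReal.coe_toNNReal h1.ne]
    exact_mod_cast h2

lemma setLIntegral_Ici_indicator (T : ℝ≥0) (f : ℝ → ℝ≥0∞) :
    ∫⁻ s in Set.Ici (0 : ℝ), (if s ≤ T then f s else 0) = ∫⁻ s in Set.Icc (0 : ℝ) T, f s := by
  have : (fun s : ℝ => if s ≤ T then f s else 0) = (Set.Iic (T : ℝ)).indicator f := by
    funext s; simp [Set.indicator_apply]
  rw [this, setLIntegral_indicator measurableSet_Iic, Set.inter_comm, Set.Ici_inter_Iic]

lemma lintegral_compensator_Icc {F : History E × ℝ × E → ℝ≥0∞} (hF : Measurable F) (T : ℝ≥0) :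
    ∫⁻ ω, (∑ k ∈ Finset.Icc 1 M, if G.time k ω ≤ T then
        F (trunc (k - 1) (G.path ω), History.time k (G.path ω), G.mark k ω) else 0) ∂μ =
      ∫⁻ ω, (∫⁻ s in Set.Icc (0 : ℝ) T, ∑ θ, (c.lam M (upTo s.toNNReal (G.path ω)) θ : ℝ≥0∞) *
        F (upTo s.toNNReal (G.path ω), s, θ)) ∂μ := by
  have h := G.lintegral_compensator (F := fun q => if q.2.1 ≤ T then F q else 0)
    (Measurable.ite (measurableSet_le (by fun_prop) measurable_const) hF measurable_const)
  simp only [time_le_iff, ite_and, ← setLIntegral_Ici_indicator]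
  rw [h]
  refine lintegral_congr fun ω => lintegral_congr fun s => ?_
  split_ifs <;> simp

/-- The compensation formula up to a fixed time. -/
theorem integral_compensator_Icc {f : History E × ℝ × E → ℝ} (hf : Measurable f) (T : ℝ≥0)
    (hint : ∀ θ, Integrable (fun q : Ω × ℝ => (c.lam M (upTo q.2.toNNReal (G.path q.1)) θ : ℝ) *
      f (upTo q.2.toNNReal (G.path q.1), q.2, θ)) (G.timeMeasure T)) :
    Integrable (fun ω => ∑ k ∈ Finset.Icc 1 M, if G.time k ω ≤ T then
        f (trunc (k - 1) (G.path ω), History.time k (G.path ω), G.mark k ω) else 0) μ ∧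
    ∫ ω, (∑ k ∈ Finset.Icc 1 M, if G.time k ω ≤ T then
        f (trunc (k - 1) (G.path ω), History.time k (G.path ω), G.mark k ω) else 0) ∂μ =
      ∫ q, G.rateSum f q ∂G.timeMeasure T := by
  -- Killing the integrand after `T` turns the sum over jumps up to `T` into a sum over all jumps,
  -- to which the formula on the half-line applies.
  set f' : History E × ℝ × E → ℝ := fun q => if q.2.1 ≤ T then f q else 0 with hf'
  have hfm' : Measurable f' :=
    Measurable.ite (measurableSet_le (by fun_prop) measurable_const) hf measurable_const
  have e1 : (fun ω => ∑ k ∈ Finset.Icc 1 M, if G.time k ω ≤ T then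
      f (trunc (k - 1) (G.path ω), History.time k (G.path ω), G.mark k ω) else 0) =
      G.jumpSum f' := by
    funext ω
    simp only [time_le_iff, ite_and, jumpSum, hf']
  have e2 : G.rateSum f' = (Set.univ ×ˢ Set.Iic (T : ℝ)).indicator (G.rateSum f) := by
    funext q
    by_cases hq : q.2 ≤ T <;> simp [rateSum, hf', hq]
  have hmeas : G.timeMeasure T = (μ.prod (volume.restrict (Set.Ici (0 : ℝ)))).restrict
      (Set.univ ×ˢ Set.Iic (T : ℝ)) := by
    rw [← Measure.prod_restrict, Measure.restrict_univ, Measure.restrict_restrict measurableSet_Iic,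
      Set.inter_comm, Set.Ici_inter_Iic]
  have hfin : ∫⁻ ω, (∫⁻ s in Set.Ici (0 : ℝ), ∑ θ, (c.lam M (upTo s.toNNReal (G.path ω)) θ : ℝ≥0∞) *
      ‖f' (upTo s.toNNReal (G.path ω), s, θ)‖ₑ) ∂μ < ∞ := by
    have e3 : ∀ ω, ∫⁻ s in Set.Ici (0 : ℝ), ∑ θ, (c.lam M (upTo s.toNNReal (G.path ω)) θ : ℝ≥0∞) *
        ‖f' (upTo s.toNNReal (G.path ω), s, θ)‖ₑ = ∫⁻ s in Set.Icc (0 : ℝ) T,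
        ∑ θ, ‖(c.lam M (upTo s.toNNReal (G.path ω)) θ : ℝ) *
          f (upTo s.toNNReal (G.path ω), s, θ)‖ₑ := by
      intro ω
      rw [← setLIntegral_Ici_indicator]
      refine lintegral_congr fun s => ?_
      by_cases hs : s ≤ T <;> simp [hf', hs, enorm_mul, Real.enorm_of_nonneg]
    simp_rw [e3]
    have hm : ∀ θ, Measurable fun q : Ω × ℝ => ‖(c.lam M (upTo q.2.toNNReal (G.path q.1)) θ : ℝ) *
          f (upTo q.2.toNNReal (G.path q.1), q.2, θ)‖ₑ := fun θ =>
      ((measurable_coe_nnreal_real.comp (G.measurable_lam_upTo θ)).mul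
        (hf.comp (f := fun q : Ω × ℝ => (upTo q.2.toNNReal (G.path q.1), q.2, θ))
          (by fun_prop))).enorm
    rw [← lintegral_prod (μ := μ) (ν := volume.restrict (Set.Icc (0 : ℝ) T)) (fun q : Ω × ℝ =>
      ∑ θ, ‖(c.lam M (upTo q.2.toNNReal (G.path q.1)) θ : ℝ) *
          f (upTo q.2.toNNReal (G.path q.1), q.2, θ)‖ₑ)
      (Finset.measurable_fun_sum _ fun θ _ => hm θ).aemeasurable,
      lintegral_finsetSum _ fun θ _ => hm θ]
    exact ENNReal.sum_lt_top.2 fun θ _ => (hint θ).2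
  obtain ⟨h1, h2, h3⟩ := G.integral_compensator hfm' hfin
  rw [e1]
  refine ⟨h1, ?_⟩
  rw [h3, e2, integral_indicator (MeasurableSet.univ.prod measurableSet_Iic), ← hmeas]

/-! ### Square integrability of the state and dual systems -/

variable {N d : ℕ} (S : SwitchCoefficients E N d)

lemma sqIntegrable_stateSystem {w : History E × ℝ≥0 → EuclideanSpace ℝ (Fin d)}
    (hw : StronglyMeasurable w)
    (hfin : ∀ T : ℝ≥0, ∫⁻ ω, (∫⁻ s in Set.Icc (0 : ℝ) T,
      ‖w (upTo s.toNNReal (G.path ω), s.toNNReal)‖ₑ ^ 2) ∂μ < ∞) (x : EuclideanSpace ℝ (Fin N)) :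
    G.SqIntegrable (S.stateSystem c M w x) (S.bound c) where
  meas := S.isMeasurable_stateSystem c M hw x
  nonneg := S.bound_nonneg c
  L_le := S.norm_stateSystem_L_le c M w x
  D_le := S.norm_stateSystem_D_le c M w x
  g_lt T := by
    have hle : ∀ ω (s : ℝ), ‖(S.stateSystem c M w x).g (upTo s.toNNReal (G.path ω)) s‖ₑ ^ 2 ≤
        ENNReal.ofReal (S.bound c) ^ 2 * ‖w (upTo s.toNNReal (G.path ω), s.toNNReal)‖ₑ ^ 2 := by
      intro ω s
      rw [← mul_pow]
      refine pow_le_pow_left₀ zero_le ?_ 2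
      rw [← ofReal_norm, ← ofReal_norm, ← ENNReal.ofReal_mul (S.bound_nonneg c)]
      exact ENNReal.ofReal_le_ofReal (((S.B _).le_opNorm _).trans
        (mul_le_mul_of_nonneg_right (S.norm_B_le c _) (norm_nonneg _)))
    refine (lintegral_mono fun ω => lintegral_mono fun s => hle ω s).trans_lt ?_
    simp_rw [lintegral_const_mul' (ENNReal.ofReal (S.bound c) ^ 2) _ (by simp)]
    exact ENNReal.mul_lt_top (by simp) (hfin T)
  j_lt T := by simp [SwitchCoefficients.stateSystem]

/-- Squaring produces two intensity factors. One is bounded by `maxRate`, the other is kept, because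
admissibility controls only the intensity-weighted square of the control. The factor `card E` comes
from Cauchy–Schwarz over the marks. -/
lemma enorm_dualSystem_g_sq_le (w : E → History E × ℝ≥0 → EuclideanSpace ℝ (Fin N))
    (y : EuclideanSpace ℝ (Fin N)) (h : History E) (s : ℝ) :
    ‖(S.dualSystem c M w y).g h s‖ₑ ^ 2 ≤
      (Fintype.card E * (c.maxRate * ENNReal.ofReal (1 + S.bound c) ^ 2)) *
        ∑ θ, (c.lam M h θ : ℝ≥0∞) * ‖w θ (h, s.toNNReal)‖ₑ ^ 2 := by
  have hterm : ∀ θ, ‖(c.lam M h θ : ℝ) • (w θ (h, s.toNNReal) +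
      (S.C (last M h) θ).adjoint (w θ (h, s.toNNReal)))‖ₑ ≤
      (c.lam M h θ : ℝ≥0∞) * (ENNReal.ofReal (1 + S.bound c) * ‖w θ (h, s.toNNReal)‖ₑ) := by
    intro θ
    rw [enorm_smul, Real.enorm_of_nonneg (NNReal.coe_nonneg _), ENNReal.ofReal_coe_nnreal]
    refine mul_le_mul_of_nonneg_left ?_ zero_le
    rw [← ofReal_norm, ← ofReal_norm, ← ENNReal.ofReal_mul (by linarith [S.bound_nonneg c])]
    refine ENNReal.ofReal_le_ofReal ((norm_add_le _ _).trans ?_)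
    rw [add_mul, one_mul]
    refine add_le_add le_rfl ((ContinuousLinearMap.le_opNorm _ _).trans ?_)
    rw [LinearIsometryEquiv.norm_map]
    exact mul_le_mul_of_nonneg_right (S.norm_C_le c _ _) (norm_nonneg _)
  have h1 : ‖(S.dualSystem c M w y).g h s‖ₑ ≤
      ∑ θ, (c.lam M h θ : ℝ≥0∞) * (ENNReal.ofReal (1 + S.bound c) * ‖w θ (h, s.toNNReal)‖ₑ) := by
    simp only [SwitchCoefficients.dualSystem, enorm_neg]
    exact (enorm_sum_le _ _).trans (Finset.sum_le_sum fun θ _ => hterm θ)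
  refine (pow_le_pow_left₀ zero_le h1 2).trans ((ENNReal.sq_sum_le _ _).trans ?_)
  rw [Finset.card_univ, mul_assoc]
  refine mul_le_mul_of_nonneg_left ?_ zero_le
  rw [Finset.mul_sum]
  refine Finset.sum_le_sum fun θ _ => ?_
  have : (c.lam M h θ : ℝ≥0∞) ≤ c.maxRate := by exact_mod_cast c.lam_le_maxRate h θ
  calc _ = (c.lam M h θ : ℝ≥0∞) * (ENNReal.ofReal (1 + S.bound c) ^ 2 *
        ((c.lam M h θ : ℝ≥0∞) * ‖w θ (h, s.toNNReal)‖ₑ ^ 2)) := by ring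
    _ ≤ (c.maxRate : ℝ≥0∞) * (ENNReal.ofReal (1 + S.bound c) ^ 2 *
        ((c.lam M h θ : ℝ≥0∞) * ‖w θ (h, s.toNNReal)‖ₑ ^ 2)) :=
        mul_le_mul_of_nonneg_right this zero_le
    _ = _ := by ring

lemma sqIntegrable_dualSystem {w : E → History E × ℝ≥0 → EuclideanSpace ℝ (Fin N)}
    (hw : ∀ θ, StronglyMeasurable (w θ))
    (hfin : ∀ T : ℝ≥0, ∫⁻ ω, (∫⁻ s in Set.Icc (0 : ℝ) T,
      ∑ θ, (c.lam M (upTo s.toNNReal (G.path ω)) θ : ℝ≥0∞) *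
        ‖w θ (upTo s.toNNReal (G.path ω), s.toNNReal)‖ₑ ^ 2) ∂μ < ∞) (y : EuclideanSpace ℝ (Fin N)) :
    G.SqIntegrable (S.dualSystem c M w y) (S.bound c) where
  meas := S.isMeasurable_dualSystem c M hw y
  nonneg := S.bound_nonneg c
  L_le := S.norm_dualSystem_L_le c M w y
  D_le := S.norm_dualSystem_D_le c M w y
  g_lt T := by
    obtain ⟨K, hK⟩ : ∃ K : ℝ≥0,
        (Fintype.card E * (c.maxRate * ENNReal.ofReal (1 + S.bound c) ^ 2) : ℝ≥0∞) = K :=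
      ⟨Fintype.card E * (c.maxRate * Real.toNNReal (1 + S.bound c) ^ 2), by
        push_cast; rfl⟩
    have hle : ∀ (ω : Ω) (s : ℝ), ‖(S.dualSystem c M w y).g (upTo s.toNNReal (G.path ω)) s‖ₑ ^ 2 ≤
        K * ∑ θ, (c.lam M (upTo s.toNNReal (G.path ω)) θ : ℝ≥0∞) *
        ‖w θ (upTo s.toNNReal (G.path ω), s.toNNReal)‖ₑ ^ 2 := fun ω s => by
      rw [← hK]
      exact enorm_dualSystem_g_sq_le S w y (upTo s.toNNReal (G.path ω)) s
    refine (lintegral_mono fun ω => lintegral_mono fun s => hle ω s).trans_lt ?_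
    simp_rw [lintegral_const_mul' _ _ (ENNReal.coe_ne_top (r := K))]
    exact ENNReal.mul_lt_top ENNReal.coe_lt_top (hfin T)
  j_lt T := by
    have hF : Measurable fun q : History E × ℝ × E => ‖(S.dualSystem c M w y).j q.1 q.2.1 q.2.2‖ₑ ^ 2 :=
      (S.isMeasurable_dualSystem c M hw y).j.enorm.pow_const 2
    -- The squared impulses are summed over actual jumps; compensation turns their mean into the
    -- weighted norm of the control.
    rw [G.lintegral_compensator_Icc hF T]
    exact hfin T

end SwitchProcess

/-! ### Feedback controls and duality in expectation -/

namespace SwitchProcess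

variable {E : Type*} [Fintype E] [MeasurableSpace E] [MeasurableSingletonClass E]
  {c : JumpCharacteristics E} {γ₀ : E} {M : ℕ}
  {Ω : Type*} [MeasurableSpace Ω] {μ : Measure Ω} [IsProbabilityMeasure μ]
  (G : SwitchProcess c γ₀ M μ) {N d : ℕ} (S : SwitchCoefficients E N d)

/-- A control of the state equation, as a function of the stopped history and time. -/
structure IsStateFeedback (w : History E × ℝ≥0 → EuclideanSpace ℝ (Fin d)) : Prop where
  meas : StronglyMeasurable w
  lt_top : ∀ T : ℝ≥0, ∫⁻ ω, (∫⁻ s in Set.Icc (0 : ℝ) T,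
      ‖w (upTo s.toNNReal (G.path ω), s.toNNReal)‖ₑ ^ 2) ∂μ < ∞

/-- A control of the dual equation, as a function of the history and time. -/
structure IsDualFeedback (w : E → History E × ℝ≥0 → EuclideanSpace ℝ (Fin N)) : Prop where
  meas : ∀ θ, StronglyMeasurable (w θ)
  lt_top : ∀ T : ℝ≥0, ∫⁻ ω, (∫⁻ s in Set.Icc (0 : ℝ) T,
      ∑ θ, (c.lam M (upTo s.toNNReal (G.path ω)) θ : ℝ≥0∞) *
        ‖w θ (upTo s.toNNReal (G.path ω), s.toNNReal)‖ₑ ^ 2) ∂μ < ∞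

variable {G}

lemma IsStateFeedback.sqIntegrable {w : History E × ℝ≥0 → EuclideanSpace ℝ (Fin d)}
    (hw : G.IsStateFeedback w) (x : EuclideanSpace ℝ (Fin N)) :
    G.SqIntegrable (S.stateSystem c M w x) (S.bound c) :=
  G.sqIntegrable_stateSystem S hw.meas hw.lt_top x

lemma IsDualFeedback.sqIntegrable {w : E → History E × ℝ≥0 → EuclideanSpace ℝ (Fin N)}
    (hw : G.IsDualFeedback w) (y : EuclideanSpace ℝ (Fin N)) :
    G.SqIntegrable (S.dualSystem c M w y) (S.bound c) :=
  G.sqIntegrable_dualSystem S hw.meas hw.lt_top y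

lemma IsStateFeedback.admissible {w : History E × ℝ≥0 → EuclideanSpace ℝ (Fin d)}
    (hw : G.IsStateFeedback w) : G.AdmissibleControl fun t ω => w (upTo t (G.path ω), t) :=
  ⟨G.isStronglyProgressive_of_upTo hw.meas, hw.lt_top⟩

lemma AdmissibleControl.exists_feedback {u : ℝ≥0 → Ω → EuclideanSpace ℝ (Fin d)}
    (hu : G.AdmissibleControl u) :
    ∃ w, G.IsStateFeedback w ∧ ∀ t ω, u t ω = w (upTo t (G.path ω), t) := by
  obtain ⟨w, hw, he⟩ := G.exists_eq_upTo hu.1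
  refine ⟨w, ⟨hw, fun T => ?_⟩, he⟩
  simp only [← he]
  exact hu.2 T

omit [MeasurableSingletonClass E] [IsProbabilityMeasure μ] in
lemma lintegral_intensity_eq (w : E → History E × ℝ≥0 → EuclideanSpace ℝ (Fin N)) (T : ℝ≥0) :
    ∫⁻ ω, (∫⁻ t in Set.Icc (0 : ℝ) T, ∑ θ, (G.intensity t.toNNReal ω θ : ℝ≥0∞) *
      ‖w θ (before t.toNNReal (G.path ω), t.toNNReal)‖ₑ ^ 2) ∂μ =
    ∫⁻ ω, (∫⁻ s in Set.Icc (0 : ℝ) T,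
      ∑ θ, (c.lam M (upTo s.toNNReal (G.path ω)) θ : ℝ≥0∞) *
        ‖w θ (upTo s.toNNReal (G.path ω), s.toNNReal)‖ₑ ^ 2) ∂μ := by
  refine lintegral_congr fun ω => setLIntegral_congr_fun_ae measurableSet_Icc ?_
  filter_upwards [G.ae_before_eq_upTo ω] with s hs hs'
  simp only [intensity_eq, hs hs'.1]

lemma IsDualFeedback.admissible {w : E → History E × ℝ≥0 → EuclideanSpace ℝ (Fin N)}
    (hw : G.IsDualFeedback w) :
    G.AdmissibleDualControl fun t ω θ => w θ (before t (G.path ω), t) := by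
  refine ⟨fun θ => G.isStronglyPredictable_of_before (hw.meas θ), fun T => ?_⟩
  rw [lintegral_intensity_eq]
  exact hw.lt_top T

lemma AdmissibleDualControl.exists_feedback {v : ℝ≥0 → Ω → E → EuclideanSpace ℝ (Fin N)}
    (hv : G.AdmissibleDualControl v) :
    ∃ w, G.IsDualFeedback w ∧ ∀ θ t ω, v t ω θ = w θ (before t (G.path ω), t) := by
  choose w hw he using fun θ => G.exists_eq_before (hv.1 θ)
  refine ⟨w, ⟨hw, fun T => ?_⟩, he⟩
  rw [← lintegral_intensity_eq]
  simp only [← he]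
  exact hv.2 T

/-- The solution of the state equation for a feedback control. -/
lemma IsStateFeedback.isStateSolution {w : History E × ℝ≥0 → EuclideanSpace ℝ (Fin d)}
    (hw : G.IsStateFeedback w) (x : EuclideanSpace ℝ (Fin N)) :
    G.IsStateSolution S x (fun t ω => w (upTo t (G.path ω), t))
      fun t ω => (S.stateSystem c M w x).value M (upTo t (G.path ω)) t :=
  (G.isStateSolution_iff S (fun _ _ => rfl) x _).2 (hw.sqIntegrable S x).ae_solves

/-- The solution of the dual equation for a feedback control. -/
lemma IsDualFeedback.isDualSolution {w : E → History E × ℝ≥0 → EuclideanSpace ℝ (Fin N)}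
    (hw : G.IsDualFeedback w) (y : EuclideanSpace ℝ (Fin N)) :
    G.IsDualSolution S y (fun t ω θ => w θ (before t (G.path ω), t))
      fun t ω => (S.dualSystem c M w y).value M (upTo t (G.path ω)) t :=
  (G.isDualSolution_iff S (fun _ _ _ => rfl) y _).2 (hw.sqIntegrable S y).ae_solves

lemma memLp_clm_apply {F₁ F₂ : Type*} [NormedAddCommGroup F₁] [NormedSpace ℝ F₁]
    [NormedAddCommGroup F₂] [NormedSpace ℝ F₂] {T : ℝ≥0} {f : Ω × ℝ → F₁} (L : E → F₁ →L[ℝ] F₂)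
    (hf : MemLp f 2 (G.timeMeasure T)) :
    MemLp (fun q : Ω × ℝ => L (last M (upTo q.2.toNNReal (G.path q.1))) (f q)) 2
      (G.timeMeasure T) := by
  have hL : StronglyMeasurable fun q : Ω × ℝ => L (last M (upTo q.2.toNNReal (G.path q.1))) :=
    (SwitchCoefficients.stronglyMeasurable_last M L).comp_measurable G.measurable_upTo_path_prod
  refine hf.of_le_mul (c := ∑ γ, ‖L γ‖) ?_ (ae_of_all _ fun q => ?_)
  · exact (isBoundedBilinearMap_apply (𝕜 := ℝ) (E := F₁) (F := F₂)).continuous.comp_aestronglyMeasurable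
      (hL.aestronglyMeasurable.prodMk hf.aestronglyMeasurable)
  · refine ((L _).le_opNorm _).trans (mul_le_mul_of_nonneg_right ?_ (norm_nonneg _))
    exact Finset.single_le_sum (f := fun γ => ‖L γ‖) (fun _ _ => norm_nonneg _) (Finset.mem_univ _)

lemma memLp_lam_smul {F : Type*} [NormedAddCommGroup F] [NormedSpace ℝ F] {T : ℝ≥0} {f : Ω × ℝ → F}
    (hf : MemLp f 2 (G.timeMeasure T)) (θ : E) :
    MemLp (fun q : Ω × ℝ => (c.lam M (upTo q.2.toNNReal (G.path q.1)) θ : ℝ) • f q) 2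
      (G.timeMeasure T) := by
  refine hf.of_le_mul (c := c.maxRate) ?_ (ae_of_all _ fun q => ?_)
  · exact ((measurable_coe_nnreal_real.comp
      (G.measurable_lam_upTo θ)).aestronglyMeasurable).smul hf.aestronglyMeasurable
  · rw [norm_smul, Real.norm_of_nonneg (NNReal.coe_nonneg _)]
    exact mul_le_mul_of_nonneg_right (by exact_mod_cast c.lam_le_maxRate _ θ) (norm_nonneg _)

lemma IsStateFeedback.memLp {w : History E × ℝ≥0 → EuclideanSpace ℝ (Fin d)}
    (hw : G.IsStateFeedback w) (T : ℝ≥0) :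
    MemLp (fun q : Ω × ℝ => w (upTo q.2.toNNReal (G.path q.1), q.2.toNNReal)) 2
      (G.timeMeasure T) := by
  have hm : StronglyMeasurable fun q : Ω × ℝ =>
      w (upTo q.2.toNNReal (G.path q.1), q.2.toNNReal) :=
    hw.meas.comp_measurable
      (g := fun q : Ω × ℝ => (upTo q.2.toNNReal (G.path q.1), q.2.toNNReal)) (by fun_prop)
  rw [memLp_two_iff hm.aestronglyMeasurable, lintegral_prod _ (hm.enorm.pow_const 2).aemeasurable]
  exact hw.lt_top T

/-- Only intensity times control can be expected in `L²`: the control is unconstrained where the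
intensity vanishes. One of the two intensity factors is again bounded by `maxRate`. -/
lemma IsDualFeedback.memLp {w : E → History E × ℝ≥0 → EuclideanSpace ℝ (Fin N)}
    (hw : G.IsDualFeedback w) (T : ℝ≥0) (θ : E) :
    MemLp (fun q : Ω × ℝ => (c.lam M (upTo q.2.toNNReal (G.path q.1)) θ : ℝ) •
      w θ (upTo q.2.toNNReal (G.path q.1), q.2.toNNReal)) 2 (G.timeMeasure T) := by
  have hm : StronglyMeasurable fun q : Ω × ℝ =>
      w θ (upTo q.2.toNNReal (G.path q.1), q.2.toNNReal) :=
    (hw.meas θ).comp_measurable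
      (g := fun q : Ω × ℝ => (upTo q.2.toNNReal (G.path q.1), q.2.toNNReal)) (by fun_prop)
  have hl := measurable_coe_nnreal_real.comp (G.measurable_lam_upTo θ)
  have hm' : StronglyMeasurable fun q : Ω × ℝ =>
      (c.lam M (upTo q.2.toNNReal (G.path q.1)) θ : ℝ) •
      w θ (upTo q.2.toNNReal (G.path q.1), q.2.toNNReal) := hl.stronglyMeasurable.smul hm
  rw [memLp_two_iff hm'.aestronglyMeasurable, lintegral_prod _ (hm'.enorm.pow_const 2).aemeasurable]
  have hle : ∀ (ω : Ω) (s : ℝ), ‖(c.lam M (upTo s.toNNReal (G.path ω)) θ : ℝ) •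
      w θ (upTo s.toNNReal (G.path ω), s.toNNReal)‖ₑ ^ 2 ≤ (c.maxRate : ℝ≥0∞) *
      ∑ θ, (c.lam M (upTo s.toNNReal (G.path ω)) θ : ℝ≥0∞) *
        ‖w θ (upTo s.toNNReal (G.path ω), s.toNNReal)‖ₑ ^ 2 := by
    intro ω s
    rw [enorm_smul, Real.enorm_of_nonneg (NNReal.coe_nonneg _), ENNReal.ofReal_coe_nnreal, mul_pow,
      pow_two (c.lam M _ θ : ℝ≥0∞), mul_assoc]
    refine mul_le_mul' (by exact_mod_cast c.lam_le_maxRate _ θ) ?_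
    exact Finset.single_le_sum (f := fun θ => (c.lam M (upTo s.toNNReal (G.path ω)) θ : ℝ≥0∞) *
        ‖w θ (upTo s.toNNReal (G.path ω), s.toNNReal)‖ₑ ^ 2) (fun _ _ => zero_le) (Finset.mem_univ θ)
  refine (lintegral_mono fun ω => lintegral_mono fun s => hle ω s).trans_lt ?_
  simp_rw [lintegral_const_mul' _ _ (ENNReal.coe_ne_top (r := c.maxRate))]
  exact ENNReal.mul_lt_top ENNReal.coe_lt_top (hw.lt_top T)

section Duality

variable {u : History E × ℝ≥0 → EuclideanSpace ℝ (Fin d)}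
  {v : E → History E × ℝ≥0 → EuclideanSpace ℝ (Fin N)}

lemma measurable_pairingJump (hu : StronglyMeasurable u) (hv : ∀ θ, StronglyMeasurable (v θ))
    (x y : EuclideanSpace ℝ (Fin N)) :
    Measurable fun q : History E × ℝ × E => S.pairingJump c M u v x y q.1 q.2.1 q.2.2 := by
  have hX : StronglyMeasurable fun q : History E × ℝ × E =>
      (S.stateSystem c M u x).value M q.1 q.2.1 :=
    ((S.isMeasurable_stateSystem c M hu x).value M).comp_measurable
      (g := fun q : History E × ℝ × E => (q.1, q.2.1)) (by fun_prop)
  have hY : StronglyMeasurable fun q : History E × ℝ × E =>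
      (S.dualSystem c M v y).value M q.1 q.2.1 :=
    ((S.isMeasurable_dualSystem c M hv y).value M).comp_measurable
      (g := fun q : History E × ℝ × E => (q.1, q.2.1)) (by fun_prop)
  have hC : StronglyMeasurable fun q : History E × ℝ × E => S.C (last M q.1) q.2.2 :=
    (S.isMeasurable_stateSystem c M hu x).D.comp_measurable
      (g := fun q : History E × ℝ × E => (q.1, q.2.2)) (by fun_prop)
  have hv' := (S.isMeasurable_dualSystem c M hv y).j
  have hCX := SwitchCoefficients.stronglyMeasurable_clm_apply hC hX
  exact ((hCX.inner hY).add ((hX.add hCX).inner hv')).measurable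

/-- The duality between the state and the dual equation. -/
theorem integral_inner_state_dual (hu : G.IsStateFeedback u) (hv : G.IsDualFeedback v)
    (x y : EuclideanSpace ℝ (Fin N)) (T : ℝ≥0) :
    ∫ ω, inner ℝ ((S.stateSystem c M u x).value M (upTo T (G.path ω)) T)
        ((S.dualSystem c M v y).value M (upTo T (G.path ω)) T) ∂μ =
      inner ℝ x y + ∫ q : Ω × ℝ, inner ℝ (S.B (last M (upTo q.2.toNNReal (G.path q.1)))
          (u (upTo q.2.toNNReal (G.path q.1), q.2.toNNReal)))
        ((S.dualSystem c M v y).value M (upTo q.2.toNNReal (G.path q.1)) q.2)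
        ∂G.timeMeasure T := by
  have hX := (hu.sqIntegrable S x).memLp_value T
  have hY := (hv.sqIntegrable S y).memLp_value T
  have hBu := memLp_clm_apply S.B (hu.memLp T)
  have hint := hBu.integrable_inner_two hY
  -- In each product the intensity is attached to the second factor, to the dual state in the first
  -- and to the control in the second, so that every factor is square integrable.
  have hjump : ∀ θ, Integrable (fun q : Ω × ℝ =>
      (c.lam M (upTo q.2.toNNReal (G.path q.1)) θ : ℝ) *
      S.pairingJump c M u v x y (upTo q.2.toNNReal (G.path q.1)) q.2 θ) (G.timeMeasure T) := by
    intro θ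
    have hCX := memLp_clm_apply (fun γ => S.C γ θ) hX
    have h1 := (hCX.integrable_inner_two (memLp_lam_smul hY θ)).add
      ((hX.add hCX).integrable_inner_two (hv.memLp T θ))
    refine h1.congr (ae_of_all _ fun q => ?_)
    simp only [SwitchCoefficients.pairingJump, Pi.add_apply, inner_smul_right]
    ring
  obtain ⟨c1, c2⟩ := G.integral_compensator_Icc
    (f := fun q => S.pairingJump c M u v x y q.1 q.2.1 q.2.2)
    (measurable_pairingJump S hu.meas hv.meas x y) T hjump
  have hrate : Integrable (G.rateSum fun q => S.pairingJump c M u v x y q.1 q.2.1 q.2.2)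
      (G.timeMeasure T) := integrable_finsetSum _ fun θ _ => hjump θ
  set φ : Ω × ℝ → ℝ := fun q => inner ℝ (S.B (last M (upTo q.2.toNNReal (G.path q.1)))
      (u (upTo q.2.toNNReal (G.path q.1), q.2.toNNReal)))
    ((S.dualSystem c M v y).value M (upTo q.2.toNNReal (G.path q.1)) q.2) with hφ
  set R : Ω × ℝ → ℝ := G.rateSum fun q => S.pairingJump c M u v x y q.1 q.2.1 q.2.2 with hR
  set P : Ω × ℝ → ℝ := fun q => φ q - R q with hP
  have hprod : Integrable P (G.timeMeasure T) := hint.sub hrate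
  have hpath : ∀ᵐ ω ∂μ, inner ℝ ((S.stateSystem c M u x).value M (upTo T (G.path ω)) T)
        ((S.dualSystem c M v y).value M (upTo T (G.path ω)) T) =
      (inner ℝ x y + ∫ s in Set.Icc (0 : ℝ) T, P (ω, s)) +
        ∑ k ∈ Finset.Icc 1 M, if G.time k ω ≤ T then
          S.pairingJump c M u v x y (trunc (k - 1) (G.path ω)) (History.time k (G.path ω))
            (G.mark k ω) else 0 := by
    filter_upwards [(hu.sqIntegrable S x).ae_intervalIntegrable,
      (hv.sqIntegrable S y).ae_intervalIntegrable] with ω h1 h2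
    rw [SwitchCoefficients.inner_state_dual (G.isPath ω) h1 h2 T, integral_Icc_eq_integral_Ioc,
      intervalIntegral.integral_of_le (NNReal.coe_nonneg T)]
    rfl
  have hc : Integrable (fun ω => inner ℝ x y + ∫ s in Set.Icc (0 : ℝ) T, P (ω, s)) μ :=
    (integrable_const _).add hprod.integral_prod_left
  simp only at c1 c2
  -- After taking means, the sum over the jumps equals the integral of `R` by compensation and
  -- cancels the `-R` inside `P`; the control term remains.
  rw [integral_congr_ae hpath, integral_add hc c1,
    integral_add (integrable_const _) hprod.integral_prod_left, integral_const, c2,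
    ← integral_prod _ hprod, hP, integral_sub hint hrate]
  simp only [probReal_univ, one_smul]
  ring

end Duality

end SwitchProcess

/-! ### Linearity of the dual state in its initial value and control -/

namespace SwitchCoefficients

variable {E : Type*} [Fintype E] {N d : ℕ} {S : SwitchCoefficients E N d}
  {c : JumpCharacteristics E} {M : ℕ} {p : History E}

lemma solves_dualSystem_add {v₁ v₂ : E → History E × ℝ≥0 → EuclideanSpace ℝ (Fin N)}
    {y₁ y₂ : EuclideanSpace ℝ (Fin N)} {W₁ W₂ : ℝ≥0 → EuclideanSpace ℝ (Fin N)}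
    (h₁ : (S.dualSystem c M v₁ y₁).Solves M p W₁) (h₂ : (S.dualSystem c M v₂ y₂).Solves M p W₂) :
    (S.dualSystem c M (v₁ + v₂) (y₁ + y₂)).Solves M p (W₁ + W₂) := by
  have hd : (S.dualSystem c M (v₁ + v₂) (y₁ + y₂)).drift p (W₁ + W₂) =
      fun s => (S.dualSystem c M v₁ y₁).drift p W₁ s + (S.dualSystem c M v₂ y₂).drift p W₂ s := by
    funext s
    simp only [ImpulsiveSystem.drift, dualSystem, Pi.add_apply, map_add, smul_add, neg_apply,
      Finset.sum_add_distrib]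
    abel
  intro t
  obtain ⟨i₁, e₁⟩ := h₁ t
  obtain ⟨i₂, e₂⟩ := h₂ t
  rw [hd]
  refine ⟨i₁.add i₂, ?_⟩
  have hj : (∑ k ∈ Finset.Icc 1 M, if (p k).1 ≤ t then
      (S.dualSystem c M (v₁ + v₂) (y₁ + y₂)).impulse p (W₁ + W₂) k else 0) =
      (∑ k ∈ Finset.Icc 1 M, if (p k).1 ≤ t then (S.dualSystem c M v₁ y₁).impulse p W₁ k else 0) +
      ∑ k ∈ Finset.Icc 1 M, if (p k).1 ≤ t then (S.dualSystem c M v₂ y₂).impulse p W₂ k else 0 := by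
    rw [← Finset.sum_add_distrib]
    refine Finset.sum_congr rfl fun k _ => ?_
    split_ifs <;> simp [ImpulsiveSystem.impulse, dualSystem]
  rw [intervalIntegral.integral_add i₁ i₂, hj, Pi.add_apply, e₁, e₂]
  simp only [dualSystem]
  abel

lemma solves_dualSystem_smul {v : E → History E × ℝ≥0 → EuclideanSpace ℝ (Fin N)}
    {y : EuclideanSpace ℝ (Fin N)} {W : ℝ≥0 → EuclideanSpace ℝ (Fin N)} (a : ℝ)
    (h : (S.dualSystem c M v y).Solves M p W) :
    (S.dualSystem c M (a • v) (a • y)).Solves M p (a • W) := by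
  have hd : (S.dualSystem c M (a • v) (a • y)).drift p (a • W) =
      fun s => a • (S.dualSystem c M v y).drift p W s := by
    funext s
    simp only [ImpulsiveSystem.drift, dualSystem, Pi.smul_apply, map_smul, smul_add, neg_apply,
      Finset.sum_add_distrib, smul_neg, Finset.smul_sum, smul_comm _ a]
  intro t
  obtain ⟨i, e⟩ := h t
  rw [hd]
  refine ⟨i.smul a, ?_⟩
  have hj : (∑ k ∈ Finset.Icc 1 M, if (p k).1 ≤ t then
      (S.dualSystem c M (a • v) (a • y)).impulse p (a • W) k else 0) =
      a • (∑ k ∈ Finset.Icc 1 M, if (p k).1 ≤ t then (S.dualSystem c M v y).impulse p W k else 0) := by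
    rw [Finset.smul_sum]
    refine Finset.sum_congr rfl fun k _ => ?_
    split_ifs <;> simp [ImpulsiveSystem.impulse, dualSystem]
  rw [intervalIntegral.integral_smul, hj, Pi.smul_apply, e]
  simp only [dualSystem, smul_add]

end SwitchCoefficients

namespace SwitchProcess

variable {E : Type*} [Fintype E] [MeasurableSpace E] [MeasurableSingletonClass E]
  {c : JumpCharacteristics E} {γ₀ : E} {M : ℕ}
  {Ω : Type*} [MeasurableSpace Ω] {μ : Measure Ω} [IsProbabilityMeasure μ]
  (G : SwitchProcess c γ₀ M μ) {N d : ℕ} (S : SwitchCoefficients E N d)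

@[fun_prop]
lemma measurable_historyTime :
    Measurable fun q : Ω × ℝ => (upTo q.2.toNNReal (G.path q.1), q.2.toNNReal) :=
  G.measurable_upTo_path_prod.prodMk (by fun_prop)

/-- The joint law of the stopped history and of time in `[0, T]`. -/
noncomputable def historyMeasure (T : ℝ≥0) : Measure (History E × ℝ≥0) :=
  (G.timeMeasure T).map fun q => (upTo q.2.toNNReal (G.path q.1), q.2.toNNReal)

lemma lintegral_historyMeasure (T : ℝ≥0) {f : History E × ℝ≥0 → ℝ≥0∞} (hf : Measurable f) :
    ∫⁻ q, f q ∂G.historyMeasure T =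
      ∫⁻ ω, (∫⁻ s in Set.Icc (0 : ℝ) T, f (upTo s.toNNReal (G.path ω), s.toNNReal)) ∂μ := by
  rw [historyMeasure, lintegral_map hf G.measurable_historyTime]
  exact lintegral_prod _ (hf.comp G.measurable_historyTime).aemeasurable

lemma ae_historyMeasure (T : ℝ≥0) {P : History E × ℝ≥0 → Prop} (hP : MeasurableSet {q | P q})
    (h : ∀ᵐ ω ∂μ, ∀ t : ℝ≥0, P (upTo t (G.path ω), t)) : ∀ᵐ q ∂G.historyMeasure T, P q := by
  rw [historyMeasure, ae_map_iff G.measurable_historyTime.aemeasurable hP]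
  filter_upwards [Measure.quasiMeasurePreserving_fst.ae h] with q hq
  exact hq _

lemma ae_timeMeasure_nonneg (T : ℝ≥0) : ∀ᵐ q ∂G.timeMeasure T, 0 ≤ q.2 := by
  have : ∀ᵐ s ∂(volume.restrict (Set.Icc (0 : ℝ) T)), 0 ≤ s :=
    (ae_restrict_mem measurableSet_Icc).mono fun s hs => hs.1
  exact Measure.quasiMeasurePreserving_snd.ae this

lemma integral_historyMeasure (T : ℝ≥0) {f : History E × ℝ≥0 → ℝ} (hf : StronglyMeasurable f) :
    ∫ q, f q ∂G.historyMeasure T =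
      ∫ q, f (upTo q.2.toNNReal (G.path q.1), q.2.toNNReal) ∂G.timeMeasure T :=
  integral_map G.measurable_historyTime.aemeasurable hf.aestronglyMeasurable

/-- The dual states as functions of history and time. -/
noncomputable def dualValue (c : JumpCharacteristics E) (M : ℕ) (y : EuclideanSpace ℝ (Fin N))
    (w : E → History E × ℝ≥0 → EuclideanSpace ℝ (Fin N)) (q : History E × ℝ≥0) :
    EuclideanSpace ℝ (Fin N) :=
  (S.dualSystem c M w y).value M q.1 q.2

variable {G}

lemma IsDualFeedback.stronglyMeasurable_dualValue
    {w : E → History E × ℝ≥0 → EuclideanSpace ℝ (Fin N)}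
    (hw : G.IsDualFeedback w) (y : EuclideanSpace ℝ (Fin N)) :
    StronglyMeasurable (dualValue S c M y w) :=
  ((S.isMeasurable_dualSystem c M hw.meas y).value M).comp_measurable
    (g := fun q : History E × ℝ≥0 => (q.1, (q.2 : ℝ))) (by fun_prop)

lemma stronglyMeasurable_clm_last {F₁ F₂ : Type*} [NormedAddCommGroup F₁] [NormedSpace ℝ F₁]
    [NormedAddCommGroup F₂] [NormedSpace ℝ F₂] (L : E → F₁ →L[ℝ] F₂) {f : History E × ℝ≥0 → F₁}
    (hf : StronglyMeasurable f) : StronglyMeasurable fun q => L (last M q.1) (f q) :=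
  SwitchCoefficients.stronglyMeasurable_clm_apply
    ((SwitchCoefficients.stronglyMeasurable_last M L).comp_measurable measurable_fst) hf

lemma memLp_clm_last {F₁ F₂ : Type*} [NormedAddCommGroup F₁] [NormedSpace ℝ F₁]
    [NormedAddCommGroup F₂] [NormedSpace ℝ F₂] {T : ℝ≥0} (L : E → F₁ →L[ℝ] F₂)
    {f : History E × ℝ≥0 → F₁} (hf : StronglyMeasurable f) (hf2 : MemLp f 2 (G.historyMeasure T)) :
    MemLp (fun q => L (last M q.1) (f q)) 2 (G.historyMeasure T) := by
  refine hf2.of_le_mul (c := ∑ γ, ‖L γ‖)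
    (stronglyMeasurable_clm_last L hf).aestronglyMeasurable (ae_of_all _ fun q => ?_)
  refine ((L _).le_opNorm _).trans (mul_le_mul_of_nonneg_right ?_ (norm_nonneg _))
  exact Finset.single_le_sum (f := fun γ => ‖L γ‖) (fun _ _ => norm_nonneg _) (Finset.mem_univ _)

lemma IsDualFeedback.memLp_dualValue {w : E → History E × ℝ≥0 → EuclideanSpace ℝ (Fin N)}
    (hw : G.IsDualFeedback w) (y : EuclideanSpace ℝ (Fin N)) (T : ℝ≥0) :
    MemLp (dualValue S c M y w) 2 (G.historyMeasure T) := by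
  rw [historyMeasure, memLp_map_measure_iff (hw.stronglyMeasurable_dualValue S y).aestronglyMeasurable
    G.measurable_historyTime.aemeasurable]
  refine ((hw.sqIntegrable S y).memLp_value T).ae_eq ?_
  filter_upwards [G.ae_timeMeasure_nonneg T] with q hq
  simp only [dualValue, Function.comp, Real.coe_toNNReal _ hq]

lemma IsDualFeedback.add {w₁ w₂ : E → History E × ℝ≥0 → EuclideanSpace ℝ (Fin N)}
    (h₁ : G.IsDualFeedback w₁) (h₂ : G.IsDualFeedback w₂) : G.IsDualFeedback (w₁ + w₂) := by
  refine ⟨fun θ => (h₁.meas θ).add (h₂.meas θ), fun T => ?_⟩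
  have hm : ∀ {w : E → History E × ℝ≥0 → EuclideanSpace ℝ (Fin N)}, G.IsDualFeedback w →
      Measurable fun q : Ω × ℝ => ∑ θ, (c.lam M (upTo q.2.toNNReal (G.path q.1)) θ : ℝ≥0∞) *
        ‖w θ (upTo q.2.toNNReal (G.path q.1), q.2.toNNReal)‖ₑ ^ 2 := fun hw =>
    Finset.measurable_fun_sum _ fun θ _ =>
      (measurable_coe_nnreal_ennreal.comp (G.measurable_lam_upTo θ)).mul
        ((((hw.meas θ).comp_measurable G.measurable_historyTime).enorm).pow_const 2)
  have hle : ∀ (ω : Ω) (s : ℝ), ∑ θ, (c.lam M (upTo s.toNNReal (G.path ω)) θ : ℝ≥0∞) *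
        ‖(w₁ + w₂) θ (upTo s.toNNReal (G.path ω), s.toNNReal)‖ₑ ^ 2 ≤
      2 * (∑ θ, (c.lam M (upTo s.toNNReal (G.path ω)) θ : ℝ≥0∞) *
        ‖w₁ θ (upTo s.toNNReal (G.path ω), s.toNNReal)‖ₑ ^ 2 +
        ∑ θ, (c.lam M (upTo s.toNNReal (G.path ω)) θ : ℝ≥0∞) *
        ‖w₂ θ (upTo s.toNNReal (G.path ω), s.toNNReal)‖ₑ ^ 2) := by
    intro ω s
    rw [← Finset.sum_add_distrib, Finset.mul_sum]
    refine Finset.sum_le_sum fun θ _ => ?_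
    rw [← mul_add, mul_left_comm]
    exact mul_le_mul_of_nonneg_left
      ((pow_le_pow_left₀ zero_le (enorm_add_le _ _) 2).trans (ENNReal.add_sq_le _ _)) zero_le
  refine (lintegral_mono fun ω => lintegral_mono fun s => hle ω s).trans_lt ?_
  simp_rw [lintegral_const_mul' (2 : ℝ≥0∞) _ (by simp)]
  have e : ∀ ω, ∫⁻ s in Set.Icc (0 : ℝ) T,
      (∑ θ, (c.lam M (upTo s.toNNReal (G.path ω)) θ : ℝ≥0∞) *
        ‖w₁ θ (upTo s.toNNReal (G.path ω), s.toNNReal)‖ₑ ^ 2 +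
        ∑ θ, (c.lam M (upTo s.toNNReal (G.path ω)) θ : ℝ≥0∞) *
        ‖w₂ θ (upTo s.toNNReal (G.path ω), s.toNNReal)‖ₑ ^ 2) =
      (∫⁻ s in Set.Icc (0 : ℝ) T, ∑ θ, (c.lam M (upTo s.toNNReal (G.path ω)) θ : ℝ≥0∞) *
        ‖w₁ θ (upTo s.toNNReal (G.path ω), s.toNNReal)‖ₑ ^ 2) +
      ∫⁻ s in Set.Icc (0 : ℝ) T, ∑ θ, (c.lam M (upTo s.toNNReal (G.path ω)) θ : ℝ≥0∞) *
        ‖w₂ θ (upTo s.toNNReal (G.path ω), s.toNNReal)‖ₑ ^ 2 := fun ω =>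
    lintegral_add_left ((hm h₁).comp (g := _) (f := fun s : ℝ => (ω, s)) measurable_prodMk_left) _
  simp_rw [e]
  rw [lintegral_add_left (hm h₁).lintegral_prod_right']
  exact ENNReal.mul_lt_top (by simp) (ENNReal.add_lt_top.2 ⟨h₁.lt_top T, h₂.lt_top T⟩)

lemma IsDualFeedback.smul {w : E → History E × ℝ≥0 → EuclideanSpace ℝ (Fin N)} (a : ℝ)
    (h : G.IsDualFeedback w) : G.IsDualFeedback (a • w) := by
  refine ⟨fun θ => (h.meas θ).const_smul a, fun T => ?_⟩
  have e : ∀ (ω : Ω) (s : ℝ), ∑ θ, (c.lam M (upTo s.toNNReal (G.path ω)) θ : ℝ≥0∞) *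
        ‖(a • w) θ (upTo s.toNNReal (G.path ω), s.toNNReal)‖ₑ ^ 2 =
      ‖a‖ₑ ^ 2 * ∑ θ, (c.lam M (upTo s.toNNReal (G.path ω)) θ : ℝ≥0∞) *
        ‖w θ (upTo s.toNNReal (G.path ω), s.toNNReal)‖ₑ ^ 2 := by
    intro ω s
    rw [Finset.mul_sum]
    refine Finset.sum_congr rfl fun θ _ => ?_
    rw [Pi.smul_apply, Pi.smul_apply, enorm_smul, mul_pow, mul_left_comm]
  simp_rw [e, lintegral_const_mul' (‖a‖ₑ ^ 2) _ (by simp)]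
  exact ENNReal.mul_lt_top (by simp) (h.lt_top T)

lemma isDualFeedback_zero : G.IsDualFeedback
    (0 : E → History E × ℝ≥0 → EuclideanSpace ℝ (Fin N)) :=
  ⟨fun _ => stronglyMeasurable_const, fun _ => by simp⟩

/-- Superposition followed by uniqueness. It holds almost everywhere only, since the path equations
are solved on the event where the sources are integrable; this suffices for a linear map into `L²`.
-/
lemma dualValue_add_ae {w₁ w₂ : E → History E × ℝ≥0 → EuclideanSpace ℝ (Fin N)}
    (h₁ : G.IsDualFeedback w₁) (h₂ : G.IsDualFeedback w₂) (y₁ y₂ : EuclideanSpace ℝ (Fin N))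
    (T : ℝ≥0) : ∀ᵐ q ∂G.historyMeasure T, dualValue S c M (y₁ + y₂) (w₁ + w₂) q =
      dualValue S c M y₁ w₁ q + dualValue S c M y₂ w₂ q := by
  refine G.ae_historyMeasure T (StronglyMeasurable.measurableSet_eq_fun
    ((h₁.add h₂).stronglyMeasurable_dualValue S _)
    ((h₁.stronglyMeasurable_dualValue S y₁).add (h₂.stronglyMeasurable_dualValue S y₂))) ?_
  filter_upwards [(h₁.sqIntegrable S y₁).ae_solves, (h₂.sqIntegrable S y₂).ae_solves] with ω e₁ e₂ t
  exact ((SwitchCoefficients.solves_dualSystem_add e₁ e₂).eq_value (G.isPath ω) t).symm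

lemma dualValue_smul_ae {w : E → History E × ℝ≥0 → EuclideanSpace ℝ (Fin N)} (a : ℝ)
    (h : G.IsDualFeedback w) (y : EuclideanSpace ℝ (Fin N)) (T : ℝ≥0) :
    ∀ᵐ q ∂G.historyMeasure T, dualValue S c M (a • y) (a • w) q = a • dualValue S c M y w q := by
  refine G.ae_historyMeasure T (StronglyMeasurable.measurableSet_eq_fun
    ((h.smul a).stronglyMeasurable_dualValue S _)
    ((h.stronglyMeasurable_dualValue S y).const_smul a)) ?_
  filter_upwards [(h.sqIntegrable S y).ae_solves] with ω e t
  exact ((SwitchCoefficients.solves_dualSystem_smul a e).eq_value (G.isPath ω) t).symm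

variable (G)

/-- The pairs of an initial value and a control of the dual equation. -/
def dualPairs (N : ℕ) : Submodule ℝ
    (EuclideanSpace ℝ (Fin N) × (E → History E × ℝ≥0 → EuclideanSpace ℝ (Fin N))) where
  carrier := {q | G.IsDualFeedback q.2}
  add_mem' h₁ h₂ := IsDualFeedback.add h₁ h₂
  zero_mem' := isDualFeedback_zero
  smul_mem' a _ h := IsDualFeedback.smul a h

/-- The observation of the dual state through mode-dependent operators, in `L²`. -/
noncomputable def dualObservation {F : Type*} [NormedAddCommGroup F] [NormedSpace ℝ F]
    (L : E → EuclideanSpace ℝ (Fin N) →L[ℝ] F) (T : ℝ≥0) :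
    G.dualPairs N →ₗ[ℝ] Lp F 2 (G.historyMeasure T) where
  toFun q := (memLp_clm_last L (IsDualFeedback.stronglyMeasurable_dualValue S q.2 q.1.1)
    (IsDualFeedback.memLp_dualValue S q.2 q.1.1 T)).toLp _
  map_add' q₁ q₂ := by
    rw [← MemLp.toLp_add]
    refine MemLp.toLp_congr _ _ ?_
    filter_upwards [dualValue_add_ae S q₁.2 q₂.2 q₁.1.1 q₂.1.1 T] with q hq
    rw [Pi.add_apply, ← map_add, ← hq]
    rfl
  map_smul' a q₁ := by
    rw [RingHom.id_apply, ← MemLp.toLp_const_smul]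
    refine MemLp.toLp_congr _ _ ?_
    filter_upwards [dualValue_smul_ae S a q₁.2 q₁.1.1 T] with q hq
    rw [Pi.smul_apply, ← map_smul, ← hq]
    rfl

end SwitchProcess

/-! ### Quotient seminorm of a linear map along a linear surjection -/

section QuotientGauge

variable {V P H : Type*} [AddCommGroup V] [Module ℝ V] [AddCommGroup P] [Module ℝ P]
  [NormedAddCommGroup H] [NormedSpace ℝ H] (π : P →ₗ[ℝ] V) (Φ : P →ₗ[ℝ] H)

/-- The smallest value of `‖Φ q‖²` over the fibre of `π` above `y`. -/
noncomputable def fibreCost (y : V) : ℝ≥0∞ := ⨅ (q : P) (_ : π q = y), ‖Φ q‖ₑ ^ 2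

/-- The quotient seminorm. -/
noncomputable def fibreGauge (y : V) : ℝ := Real.sqrt (fibreCost π Φ y).toReal

variable {π Φ}

lemma fibreCost_le {q : P} {y : V} (hq : π q = y) : fibreCost π Φ y ≤ ‖Φ q‖ₑ ^ 2 := iInf₂_le q hq

lemma fibreCost_ne_top (hπ : Function.Surjective π) (y : V) : fibreCost π Φ y ≠ ⊤ := by
  obtain ⟨q, hq⟩ := hπ y
  exact ((fibreCost_le hq).trans_lt (by simp)).ne

lemma fibreGauge_le {q : P} {y : V} (hq : π q = y) : fibreGauge π Φ y ≤ ‖Φ q‖ := by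
  rw [fibreGauge, Real.sqrt_le_left (norm_nonneg _)]
  have : fibreCost π Φ y ≤ ENNReal.ofReal (‖Φ q‖ ^ 2) := by
    rw [ENNReal.ofReal_pow (norm_nonneg _), ofReal_norm]
    exact fibreCost_le hq
  exact ENNReal.toReal_le_of_le_ofReal (by positivity) this

lemma exists_norm_lt_of_fibreGauge_lt (hπ : Function.Surjective π) {y : V} {r : ℝ}
    (h : fibreGauge π Φ y < r) : ∃ q, π q = y ∧ ‖Φ q‖ < r := by
  have hr : 0 < r := (Real.sqrt_nonneg _).trans_lt h
  rw [fibreGauge, Real.sqrt_lt' hr] at h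
  have h2 : fibreCost π Φ y < ENNReal.ofReal (r ^ 2) := by
    rw [← ENNReal.ofReal_toReal (fibreCost_ne_top (Φ := Φ) hπ y)]
    exact (ENNReal.ofReal_lt_ofReal_iff (by positivity)).2 h
  obtain ⟨q, hq⟩ := iInf_lt_iff.1 h2
  obtain ⟨hqy, hq⟩ := iInf_lt_iff.1 hq
  refine ⟨q, hqy, ?_⟩
  rw [← ofReal_norm, ← ENNReal.ofReal_pow (norm_nonneg _),
    ENNReal.ofReal_lt_ofReal_iff (by positivity)] at hq
  exact lt_of_pow_lt_pow_left₀ 2 hr.le hq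

theorem isPseudonorm_fibreGauge (hπ : Function.Surjective π) : IsPseudonorm (fibreGauge π Φ) where
  nonneg _ := Real.sqrt_nonneg _
  smul := by
    have hle : ∀ (a : ℝ) (y : V), fibreGauge π Φ (a • y) ≤ |a| * fibreGauge π Φ y := by
      intro a y
      rcases eq_or_ne a 0 with rfl | ha
      · refine (fibreGauge_le (q := 0) (by simp)).trans (by simp)
      · have ha' : 0 < |a| := abs_pos.2 ha
        rw [mul_comm, ← div_le_iff₀ ha']
        refine le_of_forall_gt fun r hr => ?_
        obtain ⟨q, hq, hqr⟩ := exists_norm_lt_of_fibreGauge_lt hπ hr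
        have := fibreGauge_le (π := π) (Φ := Φ) (q := a • q) (y := a • y) (by rw [map_smul, hq])
        rw [map_smul, norm_smul, Real.norm_eq_abs] at this
        rw [div_lt_iff₀ ha']
        nlinarith
    intro a y
    rcases eq_or_ne a 0 with rfl | ha
    · refine le_antisymm (hle 0 y) ?_
      simp only [abs_zero, zero_mul]
      exact Real.sqrt_nonneg _
    · refine le_antisymm (hle a y) ?_
      -- The reverse inequality is the inequality just proved, for the inverse scalar.
      have h := hle a⁻¹ (a • y)
      rw [inv_smul_smul₀ ha, abs_inv] at h
      have ha' : 0 < |a| := abs_pos.2 ha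
      rwa [inv_mul_eq_div, le_div_iff₀ ha', mul_comm] at h
  add_le y z := by
    refine le_of_forall_pos_le_add fun ε hε => ?_
    obtain ⟨q₁, h₁, hr₁⟩ := exists_norm_lt_of_fibreGauge_lt (Φ := Φ) hπ
      (show fibreGauge π Φ y < fibreGauge π Φ y + ε / 2 by linarith)
    obtain ⟨q₂, h₂, hr₂⟩ := exists_norm_lt_of_fibreGauge_lt (Φ := Φ) hπ
      (show fibreGauge π Φ z < fibreGauge π Φ z + ε / 2 by linarith)
    have h := fibreGauge_le (π := π) (Φ := Φ) (q := q₁ + q₂) (y := y + z) (by rw [map_add, h₁, h₂])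
    rw [map_add] at h
    linarith [norm_add_le (Φ q₁) (Φ q₂)]

end QuotientGauge

lemma MeasureTheory.enorm_toLp_sq {α F : Type*} [MeasurableSpace α] [NormedAddCommGroup F]
    {ν : Measure α} {f : α → F} (hf : MemLp f 2 ν) : ‖hf.toLp f‖ₑ ^ 2 = ∫⁻ a, ‖f a‖ₑ ^ 2 ∂ν := by
  rw [Lp.enorm_toLp]
  have := eLpNorm_nnreal_pow_eq_lintegral (f := f) (μ := ν) (p := 2) two_ne_zero
  simpa using this

/-! ### The dual cost as a quotient seminorm -/

namespace SwitchProcess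

variable {E : Type*} [Fintype E] [MeasurableSpace E] [MeasurableSingletonClass E]
  {c : JumpCharacteristics E} {γ₀ : E} {M : ℕ}
  {Ω : Type*} [MeasurableSpace Ω] {μ : Measure Ω} [IsProbabilityMeasure μ]
  (G : SwitchProcess c γ₀ M μ) {N d : ℕ} (S : SwitchCoefficients E N d)

/-- The initial value of a dual pair. -/
def dualInitial (N : ℕ) : G.dualPairs N →ₗ[ℝ] EuclideanSpace ℝ (Fin N) :=
  (LinearMap.fst ℝ _ _).comp (G.dualPairs N).subtype

/-- The zero control is admissible with every initial value; this is the source of finiteness of the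
infimum. -/
lemma dualInitial_surjective : Function.Surjective (G.dualInitial N) :=
  fun y => ⟨⟨(y, 0), isDualFeedback_zero⟩, rfl⟩

/-- The projection onto `(ker B*(γ))^⊥`. -/
noncomputable def _root_.SwitchCoefficients.projection (γ : E) :
    EuclideanSpace ℝ (Fin N) →L[ℝ] EuclideanSpace ℝ (Fin N) :=
  (LinearMap.ker (S.B γ).adjoint.toLinearMap)ᗮ.starProjection

lemma enorm_dualObservation_sq {F : Type*} [NormedAddCommGroup F] [NormedSpace ℝ F]
    (L : E → EuclideanSpace ℝ (Fin N) →L[ℝ] F) (T : ℝ≥0) (q : G.dualPairs N) :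
    ‖G.dualObservation S L T q‖ₑ ^ 2 = ∫⁻ ω, (∫⁻ s in Set.Icc (0 : ℝ) T,
      ‖L (last M (upTo s.toNNReal (G.path ω)))
        (dualValue S c M q.1.1 q.1.2 (upTo s.toNNReal (G.path ω), s.toNNReal))‖ₑ ^ 2) ∂μ := by
  have hm := stronglyMeasurable_clm_last (M := M) L
    (IsDualFeedback.stronglyMeasurable_dualValue S q.2 q.1.1)
  refine (enorm_toLp_sq (memLp_clm_last L (IsDualFeedback.stronglyMeasurable_dualValue S q.2 q.1.1)
    (IsDualFeedback.memLp_dualValue S q.2 q.1.1 T))).trans ?_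
  exact G.lintegral_historyMeasure T (hm.enorm.pow_const 2)

/-- Both infima range over the same costs. A feedback pair gives an admissible control together with
a solution; conversely an admissible control is a feedback, and any of its solutions coincides
almost surely with the explicit one. -/
theorem dualCost_eq (T : ℝ≥0) (y : EuclideanSpace ℝ (Fin N)) :
    G.dualCost S T y = fibreCost (G.dualInitial N) (G.dualObservation S S.projection T) y := by
  apply le_antisymm
  · refine le_iInf₂ fun q hq => ?_
    have hw : G.IsDualFeedback q.1.2 := q.2
    have hsol := hw.isDualSolution S y
    rw [enorm_dualObservation_sq]
    refine (iInf₂_le _ hw.admissible).trans ((iInf₂_le _ hsol).trans (le_of_eq ?_))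
    refine lintegral_congr fun ω => lintegral_congr fun s => ?_
    rw [← mode_eq, ← hq]
    rfl
  · refine le_iInf₂ fun v hv => le_iInf₂ fun Y hY => ?_
    obtain ⟨w, hw, he⟩ := hv.exists_feedback
    refine (fibreCost_le (q := (⟨(y, w), hw⟩ : G.dualPairs N)) rfl).trans (le_of_eq ?_)
    rw [enorm_dualObservation_sq]
    refine lintegral_congr_ae ?_
    filter_upwards [(G.isDualSolution_iff S he y Y).1 hY] with ω hω
    refine lintegral_congr fun s => ?_
    rw [hω.eq_value (G.isPath ω), ← mode_eq]
    rfl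

theorem dualGauge_eq (T : ℝ≥0) :
    G.dualGauge S T = fibreGauge (G.dualInitial N) (G.dualObservation S S.projection T) := by
  funext y
  rw [dualGauge, fibreGauge, dualCost_eq]

end SwitchProcess

/-! ### Functional analysis: representation, norm domination, projections -/

/-- A linear functional that is dominated by a linear map into a Hilbert space is represented by a
vector of that space. -/
lemma exists_inner_eq_of_le {P H : Type*} [AddCommGroup P] [Module ℝ P] [NormedAddCommGroup H]
    [InnerProductSpace ℝ H] [CompleteSpace H] (ℓ : P →ₗ[ℝ] ℝ) (Φ : P →ₗ[ℝ] H) {C : ℝ}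
    (h : ∀ q, |ℓ q| ≤ C * ‖Φ q‖) : ∃ u : H, ∀ q, inner ℝ u (Φ q) = ℓ q := by
  have hker : LinearMap.ker Φ ≤ LinearMap.ker ℓ := by
    intro q hq
    rw [LinearMap.mem_ker] at hq ⊢
    have := h q
    rw [hq, norm_zero, mul_zero] at this
    exact abs_nonpos_iff.1 this
  set f : LinearMap.range Φ →ₗ[ℝ] ℝ :=
    ((LinearMap.ker Φ).liftQ ℓ hker).comp Φ.quotKerEquivRange.symm.toLinearMap with hf
  have hfq : ∀ q, f ⟨Φ q, LinearMap.mem_range_self Φ q⟩ = ℓ q := by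
    intro q
    have : Φ.quotKerEquivRange.symm ⟨Φ q, LinearMap.mem_range_self Φ q⟩ =
        (LinearMap.ker Φ).mkQ q := Φ.quotKerEquivRange_symm_apply_image q _
    simp only [hf, LinearMap.comp_apply, LinearEquiv.coe_coe]
    rw [this]
    simp
  have hb : ∀ z, ‖f z‖ ≤ C * ‖z‖ := by
    rintro ⟨z, q, rfl⟩
    rw [hfq, Real.norm_eq_abs]
    exact h q
  -- The range of `Φ` need not be closed, so the functional is first extended by Hahn–Banach and
  -- only then represented by Riesz.
  obtain ⟨g, hg, -⟩ := exists_extension_norm_eq (LinearMap.range Φ) (f.mkContinuous C hb)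
  refine ⟨(InnerProductSpace.toDual ℝ H).symm g, fun q => ?_⟩
  rw [InnerProductSpace.toDual_symm_apply]
  exact (hg ⟨Φ q, LinearMap.mem_range_self Φ q⟩).trans (hfq q)

/-- A norm on a Euclidean space dominates the Euclidean norm. -/
lemma IsNormFunction.exists_norm_le {N : ℕ} {p : EuclideanSpace ℝ (Fin N) → ℝ}
    (hp : IsNormFunction p) : ∃ C, 0 ≤ C ∧ ∀ y, ‖y‖ ≤ C * p y := by
  set b := EuclideanSpace.basisFun (Fin N) ℝ with hb
  set K := ∑ i, p (b i) with hK
  have hle : ∀ y, p y ≤ K * ‖y‖ := by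
    intro y
    have h0 : p 0 = 0 := by simpa using hp.smul 0 0
    have hsum : ∀ s : Finset (Fin N), p (∑ i ∈ s, y i • b i) ≤ ∑ i ∈ s, ‖y‖ * p (b i) := by
      intro s
      induction s using Finset.cons_induction with
      | empty => simp [h0]
      | cons i s hi ih =>
        rw [Finset.sum_cons, Finset.sum_cons]
        refine (hp.add_le _ _).trans (add_le_add ?_ ih)
        rw [hp.smul]
        exact mul_le_mul_of_nonneg_right (PiLp.norm_apply_le y i) (hp.nonneg _)
    have := hsum Finset.univ
    rw [← Finset.mul_sum, mul_comm] at this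
    have e : ∑ i, y i • b i = y := by simpa [hb] using b.sum_repr y
    rwa [e] at this
  have hK0 : 0 ≤ K := Finset.sum_nonneg fun _ _ => hp.nonneg _
  -- Domination by a multiple of the Euclidean norm and the triangle inequality make `p` Lipschitz;
  -- it then attains a positive minimum on the compact unit sphere.
  have hcont : Continuous p := by
    refine (LipschitzWith.of_le_add_mul K.toNNReal fun x y => ?_).continuous
    have := hp.add_le y (x - y)
    rw [add_sub_cancel] at this
    rw [Real.coe_toNNReal _ hK0, dist_eq_norm]
    linarith [hle (x - y)]
  -- The sphere is empty when the space is trivial; every vector is then zero and any constant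
  -- works.
  rcases (Metric.sphere (0 : EuclideanSpace ℝ (Fin N)) 1).eq_empty_or_nonempty with he | hne
  · refine ⟨0, le_rfl, fun y => ?_⟩
    by_contra hy
    have hy0 : y ≠ 0 := by rintro rfl; simp at hy
    have : ‖y‖⁻¹ • y ∈ Metric.sphere (0 : EuclideanSpace ℝ (Fin N)) 1 := by
      simp [norm_smul, norm_ne_zero_iff.2 hy0]
    rw [he] at this
    exact this
  · obtain ⟨z, hz, hmin⟩ := (isCompact_sphere (0 : EuclideanSpace ℝ (Fin N)) 1).exists_isMinOn hne
      hcont.continuousOn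
    have hz1 : ‖z‖ = 1 := by simpa using hz
    have hpz : 0 < p z := lt_of_le_of_ne (hp.nonneg z) fun h => by
      rw [hp.eq_zero z h.symm] at hz1
      simp at hz1
    refine ⟨(p z)⁻¹, (inv_pos.2 hpz).le, fun y => ?_⟩
    rcases eq_or_ne y 0 with rfl | hy
    · simpa using mul_nonneg (inv_pos.2 hpz).le (hp.nonneg 0)
    · have hy' : 0 < ‖y‖ := norm_pos_iff.2 hy
      have hmem : ‖y‖⁻¹ • y ∈ Metric.sphere (0 : EuclideanSpace ℝ (Fin N)) 1 := by
        simp [norm_smul, hy'.ne']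
      have h := isMinOn_iff.1 hmin _ hmem
      rw [hp.smul, abs_inv, abs_norm, inv_mul_eq_div, le_div_iff₀ hy'] at h
      rw [inv_mul_eq_div, le_div_iff₀ hpz, mul_comm]
      exact h

namespace SwitchCoefficients

variable {E : Type*} [Fintype E] {N d : ℕ} (S : SwitchCoefficients E N d)

/-- The difference `z - Πz` lies in the double orthogonal complement of the kernel, which is the
kernel itself. -/
lemma adjoint_projection (γ : E) (z : EuclideanSpace ℝ (Fin N)) :
    (S.B γ).adjoint (S.projection γ z) = (S.B γ).adjoint z := by
  have h := Submodule.sub_starProjection_mem_orthogonal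
    (K := (LinearMap.ker (S.B γ).adjoint.toLinearMap)ᗮ) z
  rw [Submodule.orthogonal_orthogonal] at h
  have h2 : (S.B γ).adjoint (z - S.projection γ z) = 0 := LinearMap.mem_ker.1 h
  rw [map_sub, sub_eq_zero] at h2
  exact h2.symm

lemma norm_adjoint_le : ∃ K : ℝ, 0 ≤ K ∧ ∀ γ z, ‖(S.B γ).adjoint z‖ ≤ K * ‖S.projection γ z‖ := by
  refine ⟨∑ γ, ‖(S.B γ).adjoint‖, by positivity, fun γ z => ?_⟩
  rw [← S.adjoint_projection]
  refine ((S.B γ).adjoint.le_opNorm _).trans (mul_le_mul_of_nonneg_right ?_ (norm_nonneg _))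
  exact Finset.single_le_sum (f := fun γ => ‖(S.B γ).adjoint‖) (fun _ _ => norm_nonneg _)
    (Finset.mem_univ γ)

/-- The adjoint is injective on the orthogonal complement of its kernel, hence bounded below there
in finite dimension. Summing the constants over the modes makes the bound uniform. -/
lemma norm_projection_le :
    ∃ K : ℝ, 0 ≤ K ∧ ∀ γ z, ‖S.projection γ z‖ ≤ K * ‖(S.B γ).adjoint z‖ := by
  have h : ∀ γ, ∃ K : ℝ, 0 ≤ K ∧ ∀ z, ‖S.projection γ z‖ ≤ K * ‖(S.B γ).adjoint z‖ := by
    intro γ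
    set f : (LinearMap.ker (S.B γ).adjoint.toLinearMap)ᗮ →ₗ[ℝ] EuclideanSpace ℝ (Fin d) :=
      (S.B γ).adjoint.toLinearMap.domRestrict _ with hf
    have hker : LinearMap.ker f = ⊥ := by
      rw [LinearMap.ker_eq_bot']
      intro z hz
      have h1 : (z : EuclideanSpace ℝ (Fin N)) ∈ LinearMap.ker (S.B γ).adjoint.toLinearMap := hz
      have := Submodule.inner_right_of_mem_orthogonal h1 z.2
      exact Subtype.ext (inner_self_eq_zero.1 this)
    obtain ⟨K, -, hK⟩ := LinearMap.exists_antilipschitzWith f hker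
    refine ⟨K, K.2, fun z => ?_⟩
    have := hK.le_mul_dist ⟨S.projection γ z, Submodule.starProjection_apply_mem _ z⟩ 0
    rw [map_zero, dist_zero_right, dist_zero_right] at this
    rw [← S.adjoint_projection]
    exact this
  choose K hK0 hK using h
  refine ⟨∑ γ, K γ, Finset.sum_nonneg fun γ _ => hK0 γ, fun γ z => (hK γ z).trans ?_⟩
  exact mul_le_mul_of_nonneg_right (Finset.single_le_sum (fun γ _ => hK0 γ) (Finset.mem_univ γ))
    (norm_nonneg _)

end SwitchCoefficients

/-! ### Necessity, and the candidate control for sufficiency -/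

namespace SwitchProcess

variable {E : Type*} [Fintype E] [MeasurableSpace E] [MeasurableSingletonClass E]
  {c : JumpCharacteristics E} {γ₀ : E} {M : ℕ}
  {Ω : Type*} [MeasurableSpace Ω] {μ : Measure Ω} [IsProbabilityMeasure μ]
  {G : SwitchProcess c γ₀ M μ} {N d : ℕ} (S : SwitchCoefficients E N d)

lemma norm_dualObservation_le {F₁ F₂ : Type*} [NormedAddCommGroup F₁] [NormedSpace ℝ F₁]
    [NormedAddCommGroup F₂] [NormedSpace ℝ F₂] {L₁ : E → EuclideanSpace ℝ (Fin N) →L[ℝ] F₁}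
    {L₂ : E → EuclideanSpace ℝ (Fin N) →L[ℝ] F₂} {K : ℝ} (h : ∀ γ z, ‖L₁ γ z‖ ≤ K * ‖L₂ γ z‖)
    (T : ℝ≥0) (q : G.dualPairs N) :
    ‖G.dualObservation S L₁ T q‖ ≤ K * ‖G.dualObservation S L₂ T q‖ := by
  refine Lp.norm_le_mul_norm_of_ae_le_mul ?_
  filter_upwards [MemLp.coeFn_toLp (memLp_clm_last L₁
    (IsDualFeedback.stronglyMeasurable_dualValue S q.2 q.1.1)
    (IsDualFeedback.memLp_dualValue S q.2 q.1.1 T)), MemLp.coeFn_toLp (memLp_clm_last L₂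
    (IsDualFeedback.stronglyMeasurable_dualValue S q.2 q.1.1)
    (IsDualFeedback.memLp_dualValue S q.2 q.1.1 T))] with a h₁ h₂
  simp only [dualObservation, LinearMap.coe_mk, AddHom.coe_mk]
  rw [h₁, h₂]
  exact h _ _

lemma IsStateFeedback.memLp_historyMeasure {w : History E × ℝ≥0 → EuclideanSpace ℝ (Fin d)}
    (hw : G.IsStateFeedback w) (T : ℝ≥0) : MemLp w 2 (G.historyMeasure T) := by
  rw [memLp_two_iff hw.meas.aestronglyMeasurable,
    G.lintegral_historyMeasure T (hw.meas.enorm.pow_const 2)]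
  exact hw.lt_top T

/-- The duality between the state and the dual equation, in terms of the observation `B* Y`. -/
theorem integral_inner_eq {w : History E × ℝ≥0 → EuclideanSpace ℝ (Fin d)}
    (hw : G.IsStateFeedback w) (x : EuclideanSpace ℝ (Fin N)) (T : ℝ≥0) (q : G.dualPairs N) :
    ∫ ω, inner ℝ ((S.stateSystem c M w x).value M (upTo T (G.path ω)) T)
        (dualValue S c M q.1.1 q.1.2 (upTo T (G.path ω), T)) ∂μ =
      inner ℝ x (G.dualInitial N q) + inner ℝ ((hw.memLp_historyMeasure T).toLp w)
        (G.dualObservation S (fun γ => (S.B γ).adjoint) T q) := by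
  have hq : G.IsDualFeedback q.1.2 := q.2
  have hm := hq.stronglyMeasurable_dualValue S q.1.1
  refine (integral_inner_state_dual S hw hq x q.1.1 T).trans ?_
  congr 1
  have hsm : StronglyMeasurable fun a : History E × ℝ≥0 =>
      inner ℝ (w a) ((S.B (last M a.1)).adjoint (dualValue S c M q.1.1 q.1.2 a)) :=
    hw.meas.inner (stronglyMeasurable_clm_last (fun γ => (S.B γ).adjoint) hm)
  have e : inner ℝ ((hw.memLp_historyMeasure T).toLp w)
      (G.dualObservation S (fun γ => (S.B γ).adjoint) T q) = ∫ a,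
        inner ℝ (w a) ((S.B (last M a.1)).adjoint (dualValue S c M q.1.1 q.1.2 a))
        ∂G.historyMeasure T := by
    rw [L2.inner_def]
    refine integral_congr_ae ?_
    filter_upwards [(hw.memLp_historyMeasure T).coeFn_toLp, MemLp.coeFn_toLp
      (memLp_clm_last (fun γ => (S.B γ).adjoint) hm (hq.memLp_dualValue S q.1.1 T))] with a h₁ h₂
    simp only [dualObservation, LinearMap.coe_mk, AddHom.coe_mk]
    rw [h₁, h₂]
  rw [e, G.integral_historyMeasure T hsm]
  refine integral_congr_ae ?_
  filter_upwards [G.ae_timeMeasure_nonneg T] with a ha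
  rw [ContinuousLinearMap.adjoint_inner_right]
  simp only [dualValue, Real.coe_toNNReal _ ha]

/-- Null-controllability makes the gauge definite. -/
theorem eq_zero_of_dualGauge_eq_zero {T : ℝ≥0} (hc : G.ExactlyNullControllable S T)
    {y : EuclideanSpace ℝ (Fin N)} (hy : G.dualGauge S T y = 0) : y = 0 := by
  -- The initial state is taken to be `y` itself, so that the duality produces `‖y‖ ^ 2`.
  obtain ⟨u, hu, X, hX, hXT⟩ := hc y
  obtain ⟨w, hw, he⟩ := hu.exists_feedback
  obtain ⟨K, hK0, hK⟩ := S.norm_adjoint_le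
  have hval : ∀ᵐ ω ∂μ, (S.stateSystem c M w y).value M (upTo T (G.path ω)) T = 0 := by
    filter_upwards [(G.isStateSolution_iff S he y X).1 hX, hXT] with ω h₁ h₂
    rw [← h₁.eq_value (G.isPath ω), h₂]
  have hzero : ∀ q : G.dualPairs N, G.dualInitial N q = y → ‖y‖ ^ 2 ≤
      ‖(hw.memLp_historyMeasure T).toLp w‖ * (K * ‖G.dualObservation S S.projection T q‖) := by
    intro q hq
    have h := integral_inner_eq S hw y T q
    rw [integral_eq_zero_of_ae (hval.mono fun ω h => by rw [h, inner_zero_left]; rfl), hq,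
      real_inner_self_eq_norm_sq] at h
    have h2 := abs_real_inner_le_norm ((hw.memLp_historyMeasure T).toLp w)
      (G.dualObservation S (fun γ => (S.B γ).adjoint) T q)
    have h3 := mul_le_mul_of_nonneg_left (norm_dualObservation_le S hK T q)
      (norm_nonneg ((hw.memLp_historyMeasure T).toLp w))
    linarith [neg_abs_le (inner ℝ ((hw.memLp_historyMeasure T).toLp w)
      (G.dualObservation S (fun γ => (S.B γ).adjoint) T q))]
  set R := ‖(hw.memLp_historyMeasure T).toLp w‖ * K with hR
  have hR0 : 0 ≤ R := mul_nonneg (norm_nonneg _) hK0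
  have hle : ‖y‖ ^ 2 ≤ 0 := by
    refine le_of_forall_pos_le_add fun ε hε => ?_
    rw [dualGauge_eq] at hy
    -- The infimum need not be attained, so a nearly optimal pair is used. The denominator `R + 1`
    -- stays positive even if `R = 0`, and `R * ε / (R + 1) ≤ ε`.
    obtain ⟨q, hq, hqr⟩ := exists_norm_lt_of_fibreGauge_lt (r := ε / (R + 1))
      G.dualInitial_surjective (hy.trans_lt (by positivity))
    refine (hzero q hq).trans ?_
    rw [← mul_assoc, ← hR, zero_add]
    rw [lt_div_iff₀ (by positivity)] at hqr
    nlinarith [norm_nonneg (G.dualObservation S S.projection T q)]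
  have : ‖y‖ = 0 := by nlinarith [norm_nonneg y]
  exact norm_eq_zero.1 this

/-- If the gauge is a norm, some control makes the terminal state orthogonal to all the terminal
states of the dual equation. -/
theorem exists_integral_inner_eq_zero {T : ℝ≥0} (hp : IsNormFunction (G.dualGauge S T))
    (x : EuclideanSpace ℝ (Fin N)) : ∃ w : History E × ℝ≥0 → EuclideanSpace ℝ (Fin d),
      G.IsStateFeedback w ∧ ∀ q : G.dualPairs N,
        ∫ ω, inner ℝ ((S.stateSystem c M w x).value M (upTo T (G.path ω)) T)
          (dualValue S c M q.1.1 q.1.2 (upTo T (G.path ω), T)) ∂μ = 0 := by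
  obtain ⟨C, hC0, hC⟩ := hp.exists_norm_le
  obtain ⟨K, hK0, hK⟩ := S.norm_projection_le
  -- The functional `-⟪x, y⟫` is prescribed so that the control term of the duality cancels `⟪x,
  -- y⟫`. The constant collects Cauchy–Schwarz, `‖y‖ ≤ C * p y`, and the passage from the projection
  -- of `Y` to `B* Y`.
  obtain ⟨u, hu⟩ := exists_inner_eq_of_le (-((innerₛₗ ℝ x).comp (G.dualInitial N)))
    (G.dualObservation S (fun γ => (S.B γ).adjoint) T) (C := ‖x‖ * (C * K)) fun q => by
      rw [LinearMap.neg_apply, abs_neg, LinearMap.comp_apply, innerₛₗ_apply_apply]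
      refine (abs_real_inner_le_norm _ _).trans ?_
      rw [mul_assoc]
      refine mul_le_mul_of_nonneg_left ?_ (norm_nonneg x)
      rw [mul_assoc]
      refine (hC _).trans (mul_le_mul_of_nonneg_left ?_ hC0)
      rw [dualGauge_eq]
      exact (fibreGauge_le rfl).trans (norm_dualObservation_le S hK T q)
  -- The representing element is controlled on `[0, T]` only; switching it off afterwards gives
  -- square integrability on every horizon without changing its class over `[0, T]`.
  set w : History E × ℝ≥0 → EuclideanSpace ℝ (Fin d) := {q | q.2 ≤ T}.indicator u with hwdef
  have hS : MeasurableSet {q : History E × ℝ≥0 | q.2 ≤ T} :=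
    measurableSet_le measurable_snd measurable_const
  have hum : StronglyMeasurable u := Lp.stronglyMeasurable u
  have hw : G.IsStateFeedback w := by
    refine ⟨hum.indicator hS, fun T' => ?_⟩
    have hfin := (memLp_two_iff hum.aestronglyMeasurable).1 (Lp.memLp u)
    rw [G.lintegral_historyMeasure T (hum.enorm.pow_const 2)] at hfin
    refine lt_of_le_of_lt (lintegral_mono fun ω => ?_) hfin
    rw [← lintegral_indicator measurableSet_Icc, ← lintegral_indicator measurableSet_Icc]
    refine lintegral_mono fun s => ?_
    by_cases h1 : s ∈ Set.Icc (0 : ℝ) T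
    · simp only [h1, Set.indicator_of_mem, hwdef]
      refine (Set.indicator_le_self _ _ _).trans ?_
      refine pow_le_pow_left₀ zero_le ?_ 2
      by_cases h2 : s.toNNReal ≤ T <;> simp [h2]
    · by_cases h2 : s ∈ Set.Icc (0 : ℝ) T'
      · have h3 : ¬ s.toNNReal ≤ T := by
          rw [Real.toNNReal_le_iff_le_coe]
          exact fun h => h1 ⟨h2.1, h⟩
        simp [h1, h2, hwdef, h3]
      · simp [h1, h2]
  have hwu : (hw.memLp_historyMeasure T).toLp w = u := by
    refine Lp.ext ?_
    have hT : ∀ᵐ q ∂G.historyMeasure T, q.2 ≤ T := by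
      rw [historyMeasure, ae_map_iff G.measurable_historyTime.aemeasurable hS]
      have : ∀ᵐ s ∂(volume.restrict (Set.Icc (0 : ℝ) T)), s.toNNReal ≤ T :=
        (ae_restrict_mem measurableSet_Icc).mono fun s hs => Real.toNNReal_le_iff_le_coe.2 hs.2
      exact Measure.quasiMeasurePreserving_snd.ae this
    filter_upwards [(hw.memLp_historyMeasure T).coeFn_toLp, hT] with q h₁ h₂
    rw [h₁, hwdef]
    exact Set.indicator_of_mem (s := {q : History E × ℝ≥0 | q.2 ≤ T}) h₂ _
  refine ⟨w, hw, fun q => ?_⟩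
  rw [integral_inner_eq S hw x T q, hwu, hu]
  simp

end SwitchProcess

/-! ### The backward equation and steering of the dual state -/

namespace History

variable {E : Type*}

/-- Add a jump to a history. -/
noncomputable def addJump (M : ℕ) (h : History E) (s : ℝ) (θ : E) : History E :=
  fun k => if k = count M h + 1 then (ENNReal.ofReal s, θ) else h k

/-- The truncated history has exactly `n` jumps, so the added entry goes to index `n + 1` and
restores the actual path there. -/
lemma addJump_trunc {M : ℕ} {p : History E} (hp : IsPath M p) {n : ℕ} (hn : (p (n + 1)).1 < ∞) :
    addJump M (trunc n p) (time (n + 1) p) (p (n + 1)).2 = trunc (n + 1) p := by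
  have hn' : (p n).1 < ∞ := (hp.mono n.le_succ).trans_lt hn
  funext k
  simp only [addJump, hp.count_trunc hn', trunc]
  by_cases hk : k = n + 1
  · subst hk
    simp only [if_true, le_rfl, time, ENNReal.ofReal_toReal hn.ne]
  · by_cases hk' : k ≤ n
    · simp [hk, hk', hk'.trans n.le_succ]
    · have : ¬ k ≤ n + 1 := by omega
      simp [hk, hk', this]

lemma measurable_addJump [MeasurableSpace E] (M : ℕ) (θ : E) :
    Measurable fun q : History E × ℝ => addJump M q.1 q.2 θ := by
  refine measurable_pi_iff.2 fun k => ?_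
  unfold addJump
  refine Measurable.ite ?_ (by fun_prop) (by fun_prop)
  have : Measurable fun q : History E × ℝ => count M q.1 + 1 := by fun_prop
  exact measurableSet_eq_fun measurable_const this

end History

lemma MeasureTheory.StronglyMeasurable.intervalIntegrable_of_bounded {V : Type*} [NormedAddCommGroup V]
    {g : ℝ → V} (hg : StronglyMeasurable g) {C T : ℝ} (hC : ∀ s ∈ Set.Icc 0 T, ‖g s‖ ≤ C) {a b : ℝ}
    (ha : a ∈ Set.Icc 0 T) (hb : b ∈ Set.Icc 0 T) : IntervalIntegrable g volume a b := by
  rw [intervalIntegrable_iff]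
  refine Measure.integrableOn_of_bounded (M := C) (by simp) hg.aestronglyMeasurable ?_
  refine (ae_restrict_iff' measurableSet_uIoc).2 (ae_of_all _ fun s hs => hC s ?_)
  have := Set.uIoc_subset_uIcc hs
  exact (Set.uIcc_subset_Icc ha hb) this

namespace SwitchCoefficients

variable {E : Type*} [Fintype E] {N d : ℕ} (S : SwitchCoefficients E N d)
  (c : JumpCharacteristics E) (M : ℕ)

/-- The operator through which a control of the dual equation enters the drift. -/
noncomputable def coupling (h : History E) (θ : E) :
    EuclideanSpace ℝ (Fin N) →L[ℝ] EuclideanSpace ℝ (Fin N) :=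
  (c.lam M h θ : ℝ) • (1 + (S.C (last M h) θ).adjoint)

/-- The drift operator of the backward equation. -/
noncomputable def backwardDrift (h : History E) :
    EuclideanSpace ℝ (Fin N) →L[ℝ] EuclideanSpace ℝ (Fin N) :=
  -(S.A (last M h)).adjoint + ∑ θ, S.coupling c M h θ

/-- The solution of the backward equation with terminal value `f` at time `T`, when at most `i`
jumps remain, the last of which leads to the value `0`. -/
noncomputable def backward (T : ℝ) (f : History E → EuclideanSpace ℝ (Fin N)) :
    ℕ → History E → ℝ → EuclideanSpace ℝ (Fin N)
  | 0, _, _ => 0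
  | i + 1, h, t => linearFlow (S.backwardDrift c M h) T (f h)
      (fun s => -∑ θ, S.coupling c M h θ (backward T f i (addJump M h s θ) s)) t

variable {c M} {T : ℝ} {f : History E → EuclideanSpace ℝ (Fin N)}

lemma dualSystem_g_eq (v : E → History E × ℝ≥0 → EuclideanSpace ℝ (Fin N))
    (y : EuclideanSpace ℝ (Fin N)) (h : History E) (s : ℝ) :
    (S.dualSystem c M v y).g h s = -∑ θ, S.coupling c M h θ (v θ (h, s.toNNReal)) := rfl

/-- One constant, uniform in the history: the recursion evaluates the backward solution at
hypothetical histories with an added jump, so bounds along actual paths would not suffice. -/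
lemma exists_norm_coupling_le : ∃ K, 0 ≤ K ∧ (∀ h θ, ‖S.coupling c M h θ‖ ≤ K) ∧
    ∀ h, ‖S.backwardDrift c M h‖ ≤ K := by
  have hb := S.bound_nonneg c
  set R : ℝ := c.maxRate * (1 + S.bound c) with hR
  have hR0 : 0 ≤ R := mul_nonneg (NNReal.coe_nonneg _) (by linarith)
  have h1 : ∀ h θ, ‖S.coupling c M h θ‖ ≤ R := by
    intro h θ
    rw [coupling, norm_smul, Real.norm_of_nonneg (NNReal.coe_nonneg _)]
    refine mul_le_mul (by exact_mod_cast c.lam_le_maxRate h θ) ?_ (norm_nonneg _)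
      (NNReal.coe_nonneg _)
    refine (norm_add_le _ _).trans (add_le_add ContinuousLinearMap.norm_id_le ?_)
    rw [LinearIsometryEquiv.norm_map]
    exact S.norm_C_le c _ _
  refine ⟨S.bound c + (1 + Fintype.card E) * R, by positivity, fun h θ => (h1 h θ).trans ?_, fun h => ?_⟩
  · nlinarith [mul_nonneg (Nat.cast_nonneg (α := ℝ) (Fintype.card E)) hR0]
  · refine (norm_add_le _ _).trans ?_
    have h2 : ‖∑ θ, S.coupling c M h θ‖ ≤ Fintype.card E * R := by
      refine (norm_sum_le _ _).trans ((Finset.sum_le_sum fun θ _ => h1 h θ).trans ?_)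
      simp
    have h3 : ‖-(S.A (last M h)).adjoint‖ ≤ S.bound c := S.norm_dualSystem_L_le c M 0 0 h
    nlinarith

section Measurability

variable [MeasurableSpace E] [MeasurableSingletonClass E]

lemma stronglyMeasurable_coupling (θ : E) :
    StronglyMeasurable fun h : History E => S.coupling c M h θ :=
  (stronglyMeasurable_lam c M θ).smul
    (stronglyMeasurable_last M fun γ => 1 + (S.C γ θ).adjoint)

lemma stronglyMeasurable_backwardDrift : StronglyMeasurable (S.backwardDrift c M) :=
  (stronglyMeasurable_last M fun γ => -(S.A γ).adjoint).add
    (Finset.stronglyMeasurable_fun_sum _ fun θ _ => S.stronglyMeasurable_coupling θ)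

lemma stronglyMeasurable_backwardSource {β : History E → ℝ → EuclideanSpace ℝ (Fin N)}
    (hβ : StronglyMeasurable fun q : History E × ℝ => β q.1 q.2) :
    StronglyMeasurable fun q : History E × ℝ =>
      -∑ θ, S.coupling c M q.1 θ (β (addJump M q.1 q.2 θ) q.2) := by
  refine StronglyMeasurable.fun_neg (Finset.stronglyMeasurable_fun_sum _ fun θ _ => ?_)
  refine stronglyMeasurable_clm_apply
    ((S.stronglyMeasurable_coupling θ).comp_measurable measurable_fst) ?_
  exact hβ.comp_measurable (g := fun q : History E × ℝ => (addJump M q.1 q.2 θ, q.2))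
    ((measurable_addJump M θ).prodMk measurable_snd)

lemma stronglyMeasurable_backward (hf : StronglyMeasurable f) (i : ℕ) :
    StronglyMeasurable fun q : History E × ℝ => S.backward c M T f i q.1 q.2 := by
  induction i with
  | zero => exact stronglyMeasurable_const
  | succ i ih =>
    simp only [backward]
    refine stronglyMeasurable_linearFlow
      (S.stronglyMeasurable_backwardDrift.comp_measurable measurable_fst) measurable_const
      measurable_snd (hf.comp_measurable measurable_fst) ?_
    exact (S.stronglyMeasurable_backwardSource ih).comp_measurable
      (g := fun q : (History E × ℝ) × ℝ => (q.1.1, q.2)) (by fun_prop)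

variable (hf : StronglyMeasurable f) (hb : ∀ h, ‖f h‖ ≤ 1) (hT : 0 ≤ T)
include hf hb hT

/-- Induction on the number of remaining jumps: the previous level bounds the source, and variation
of constants over a length at most `T` bounds the next level, uniformly in the history. -/
lemma exists_norm_backward_le (i : ℕ) :
    ∃ C, 0 ≤ C ∧ ∀ h, ∀ t ∈ Set.Icc 0 T, ‖S.backward c M T f i h t‖ ≤ C := by
  obtain ⟨K, hK0, hK, hK'⟩ := S.exists_norm_coupling_le (c := c) (M := M)
  induction i with
  | zero => exact ⟨0, le_rfl, fun h t _ => by simp [backward]⟩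
  | succ i ih =>
    obtain ⟨C, hC0, hC⟩ := ih
    have hg : ∀ h, ∀ s ∈ Set.Icc 0 T,
        ‖-∑ θ, S.coupling c M h θ (S.backward c M T f i (addJump M h s θ) s)‖ ≤
          Fintype.card E * (K * C) := by
      intro h s hs
      rw [norm_neg]
      refine (norm_sum_le _ _).trans ((Finset.sum_le_sum (g := fun _ => K * C) fun θ _ => ?_).trans (by simp))
      exact (ContinuousLinearMap.le_opNorm _ _).trans
        (mul_le_mul (hK h θ) (hC _ s hs) (norm_nonneg _) hK0)
    refine ⟨Real.exp (T * K) * (1 + Real.exp (T * K) * (Fintype.card E * (K * C) * T)),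
      by positivity, fun h t ht => ?_⟩
    have hm : StronglyMeasurable fun s : ℝ =>
        -∑ θ, S.coupling c M h θ (S.backward c M T f i (addJump M h s θ) s) :=
      (S.stronglyMeasurable_backwardSource (S.stronglyMeasurable_backward hf i)).comp_measurable
        (g := fun s : ℝ => (h, s)) measurable_prodMk_left
    have hTT : T ∈ Set.Icc 0 T := ⟨hT, le_rfl⟩
    have habs : |t - T| ≤ T := by rw [abs_le]; constructor <;> linarith [ht.1, ht.2]
    refine (norm_linearFlow_le _ (hK' h) (f h)
      (hm.intervalIntegrable_of_bounded (hg h) hTT ht) habs).trans ?_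
    refine mul_le_mul_of_nonneg_left (add_le_add (hb h) ?_) (Real.exp_pos _).le
    refine mul_le_mul_of_nonneg_left ?_ (Real.exp_pos _).le
    have := intervalIntegral.norm_integral_le_of_norm_le_const (a := T) (b := t)
      (f := fun s => ‖-∑ θ, S.coupling c M h θ (S.backward c M T f i (addJump M h s θ) s)‖)
      (C := Fintype.card E * (K * C)) fun s hs => by
        rw [norm_norm]
        exact hg h s (Set.uIcc_subset_Icc hTT ht (Set.uIoc_subset_uIcc hs))
    refine this.trans (mul_le_mul_of_nonneg_left habs (by positivity))

/-- Variation of constants is anchored at the terminal time `T`; the difference of its values at `b`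
and `a` gives the same equation read forward from `a`. -/
lemma backward_eq (i : ℕ) (h : History E) {a : ℝ} (ha : a ∈ Set.Icc 0 T) :
    IntervalIntegrable (fun s => S.backwardDrift c M h (S.backward c M T f (i + 1) h s) +
        -∑ θ, S.coupling c M h θ (S.backward c M T f i (addJump M h s θ) s)) volume a T ∧
      ∀ b ∈ Set.Icc a T, S.backward c M T f (i + 1) h b = S.backward c M T f (i + 1) h a +
        ∫ s in a..b, (S.backwardDrift c M h (S.backward c M T f (i + 1) h s) +
          -∑ θ, S.coupling c M h θ (S.backward c M T f i (addJump M h s θ) s)) := by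
  obtain ⟨C, hC0, hC⟩ := S.exists_norm_backward_le (c := c) (M := M) hf hb hT i
  obtain ⟨K, hK0, hK, -⟩ := S.exists_norm_coupling_le (c := c) (M := M)
  have hg : ∀ s ∈ Set.Icc 0 T,
      ‖-∑ θ, S.coupling c M h θ (S.backward c M T f i (addJump M h s θ) s)‖ ≤
        Fintype.card E * (K * C) := by
    intro s hs
    rw [norm_neg]
    refine (norm_sum_le _ _).trans ((Finset.sum_le_sum (g := fun _ => K * C) fun θ _ => ?_).trans (by simp))
    exact (ContinuousLinearMap.le_opNorm _ _).trans
      (mul_le_mul (hK h θ) (hC _ s hs) (norm_nonneg _) hK0)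
  have hm : StronglyMeasurable fun s : ℝ =>
      -∑ θ, S.coupling c M h θ (S.backward c M T f i (addJump M h s θ) s) :=
    (S.stronglyMeasurable_backwardSource (S.stronglyMeasurable_backward hf i)).comp_measurable
      (g := fun s : ℝ => (h, s)) measurable_prodMk_left
  have hTT : T ∈ Set.Icc 0 T := ⟨hT, le_rfl⟩
  have key : ∀ b ∈ Set.Icc 0 T, _ := fun b hb' => linearFlow_eq (S.backwardDrift c M h) (f h)
    (hm.intervalIntegrable_of_bounded hg hTT hb')
  refine ⟨(key a ha).1.symm, fun b hb' => ?_⟩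
  have hb2 : b ∈ Set.Icc 0 T := ⟨ha.1.trans hb'.1, hb'.2⟩
  have e1 := (key a ha).2
  have e2 := (key b hb2).2
  simp only [backward] at e1 e2 ⊢
  rw [e2]
  rw [e1]
  rw [add_assoc, intervalIntegral.integral_add_adjacent_intervals (key a ha).1
    ((key a ha).1.symm.trans (key b hb2).1)]

end Measurability

/-- The feedback control that steers the dual state to `f` at time `T`. -/
noncomputable def steering (c : JumpCharacteristics E) (M : ℕ) (T : ℝ)
    (f : History E → EuclideanSpace ℝ (Fin N)) (θ : E)
    (q : History E × ℝ≥0) : EuclideanSpace ℝ (Fin N) :=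
  if (q.2 : ℝ) ≤ T then
    S.backward c M T f (M - count M q.1) (addJump M q.1 q.2 θ) q.2 -
      S.backward c M T f (M - count M q.1 + 1) q.1 q.2
  else 0

section Steering

variable [MeasurableSpace E] [MeasurableSingletonClass E] {p : History E}
  (hf : StronglyMeasurable f) (hb : ∀ h, ‖f h‖ ≤ 1) (hT : 0 ≤ T) (hp : IsPath M p)

include hf in
lemma stronglyMeasurable_steering (θ : E) : StronglyMeasurable (S.steering c M T f θ) := by
  have hcount : ∀ {β : ℕ → History E × ℝ≥0 → EuclideanSpace ℝ (Fin N)},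
      (∀ i, StronglyMeasurable (β i)) → Measurable fun q : History E × ℝ≥0 =>
        β (M - count M q.1) q := by
    intro β hβ
    have h1 : Measurable fun q : ℕ × (History E × ℝ≥0) => β q.1 q.2 :=
      measurable_from_prod_countable_right fun i => (hβ i).measurable
    have h2 : Measurable fun q : History E × ℝ≥0 => M - count M q.1 :=
      (measurable_of_countable fun n : ℕ => M - n).comp ((measurable_count M).comp measurable_fst)
    exact h1.comp (h2.prodMk measurable_id)
  refine Measurable.stronglyMeasurable (Measurable.ite
    (measurableSet_le (by fun_prop) measurable_const) (Measurable.sub ?_ ?_) measurable_const)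
  · refine hcount (β := fun i q => S.backward c M T f i (addJump M q.1 q.2 θ) q.2) fun i => ?_
    refine (S.stronglyMeasurable_backward hf i).comp_measurable
      (g := fun q : History E × ℝ≥0 => (addJump M q.1 (q.2 : ℝ) θ, (q.2 : ℝ))) ?_
    exact ((measurable_addJump M θ).comp (g := fun q : History E × ℝ => addJump M q.1 q.2 θ)
      (f := fun q : History E × ℝ≥0 => (q.1, (q.2 : ℝ))) (by fun_prop)).prodMk (by fun_prop)
  · refine hcount (β := fun i q => S.backward c M T f (i + 1) q.1 q.2) fun i => ?_
    exact (S.stronglyMeasurable_backward hf (i + 1)).comp_measurable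
      (g := fun q : History E × ℝ≥0 => (q.1, (q.2 : ℝ))) (by fun_prop)

include hf hb hT in
lemma exists_norm_steering_le : ∃ C, ∀ θ q, ‖S.steering c M T f θ q‖ ≤ C := by
  choose C hC0 hC using S.exists_norm_backward_le (c := c) (M := M) hf hb hT
  refine ⟨∑ i ∈ Finset.range (M + 1), (C i + C (i + 1)),
    fun θ q => ?_⟩
  have h0 : 0 ≤ ∑ i ∈ Finset.range (M + 1), (C i + C (i + 1)) :=
    Finset.sum_nonneg fun i _ => add_nonneg (hC0 _) (hC0 _)
  unfold steering
  split_ifs with h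
  · have hq : (q.2 : ℝ) ∈ Set.Icc 0 T := ⟨NNReal.coe_nonneg _, h⟩
    refine (norm_sub_le _ _).trans ((add_le_add (hC _ _ _ hq) (hC _ _ _ hq)).trans ?_)
    exact Finset.single_le_sum (f := fun i => C i + C (i + 1))
      (fun i _ => add_nonneg (hC0 _) (hC0 _)) (Finset.mem_range.2 (by omega))
  · simpa using h0

-- After `n` jumps the current level is `M - n + 1`, and a further jump lowers it by one; the
-- control is the difference between the target after a jump to `θ` and the present value. The level
-- 0 reached beyond `M` jumps is immaterial, since no such jump occurs.
include hp in
lemma steering_trunc {n : ℕ} (hn : (p n).1 < ∞) {s : ℝ} (hs : s ∈ Set.Icc 0 T) (θ : E) :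
    S.steering c M T f θ (trunc n p, s.toNNReal) =
      S.backward c M T f (M - n) (addJump M (trunc n p) s θ) s -
        S.backward c M T f (M - n + 1) (trunc n p) s := by
  simp only [steering, Real.coe_toNNReal _ hs.1, hs.2, if_true, hp.count_trunc hn]

include hf hb hT hp

/-- Substituting the steering control into the dual drift turns it into the backward drift: the
present value in the control contributes the `coupling` sum of `backwardDrift`, the value after a
jump contributes the source. Uniqueness for the linear flow concludes. -/
lemma sol_steering_of_start {n : ℕ} {y : EuclideanSpace ℝ (Fin N)} (hn : (p n).1 < ∞)
    (hstart : (S.dualSystem c M (S.steering c M T f) y).sol n p (time n p) =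
      S.backward c M T f (M - n + 1) (trunc n p) (time n p)) {b : ℝ} (hnb : time n p ≤ b)
    (hbT : b ≤ T) : (S.dualSystem c M (S.steering c M T f) y).sol n p b =
      S.backward c M T f (M - n + 1) (trunc n p) b := by
  have h0 : 0 ≤ time n p := time_nonneg n p
  obtain ⟨hi, he⟩ := S.backward_eq (c := c) (M := M) hf hb hT (M - n) (trunc n p)
    (a := time n p) ⟨h0, hnb.trans hbT⟩
  have hdrift : ∀ s ∈ Set.Icc 0 T,
      S.backwardDrift c M (trunc n p) (S.backward c M T f (M - n + 1) (trunc n p) s) +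
        -∑ θ, S.coupling c M (trunc n p) θ
          (S.backward c M T f (M - n) (addJump M (trunc n p) s θ) s) =
      (S.dualSystem c M (S.steering c M T f) y).L (trunc n p)
          (S.backward c M T f (M - n + 1) (trunc n p) s) +
        (S.dualSystem c M (S.steering c M T f) y).g (trunc n p) s := by
    intro s hs
    rw [dualSystem_g_eq]
    simp only [S.steering_trunc hp hn hs, map_sub, Finset.sum_sub_distrib, backwardDrift, add_apply,
      sum_apply, dualSystem]
    abel
  have hmem : ∀ {r}, r ∈ Set.Icc (time n p) b → ∀ s ∈ Set.uIcc (time n p) r, s ∈ Set.Icc 0 T := by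
    intro r hr s hs
    rw [Set.uIcc_of_le hr.1] at hs
    exact ⟨h0.trans hs.1, hs.2.trans (hr.2.trans hbT)⟩
  have hbb : b ∈ Set.Icc (time n p) b := ⟨hnb, le_rfl⟩
  have := linearFlow_unique ((S.dualSystem c M (S.steering c M T f) y).L (trunc n p))
    (w := S.backward c M T f (M - n + 1) (trunc n p))
    (g := (S.dualSystem c M (S.steering c M T f) y).g (trunc n p)) (a := time n p) (b := b)
    ((hi.mono_set (by
      rw [Set.uIcc_of_le hnb, Set.uIcc_of_le (hnb.trans hbT)]
      exact Set.Icc_subset_Icc_right hbT)).congr fun s hs =>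
        hdrift s (hmem hbb s (Set.uIoc_subset_uIcc hs))) (fun r hr => by
      rw [Set.uIcc_of_le hnb] at hr
      rw [he r ⟨hr.1, hr.2.trans hbT⟩]
      congr 1
      exact intervalIntegral.integral_congr fun s hs => hdrift s (hmem hr s hs))
  rw [ImpulsiveSystem.sol_eq_linearFlow, hstart, ← this]

/-- Induction over the jumps. The dual impulse is additive, so adding the control replaces the value
before the jump by the backward value of the enlarged history, one level lower: `M - n = M - (n + 1)
+ 1`. -/
lemma sol_steering_start {y : EuclideanSpace ℝ (Fin N)}
    (hy : y = S.backward c M T f (M + 1) (trunc 0 p) 0) : ∀ {n : ℕ}, (p n).1 < ∞ →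
      time n p ≤ T → (S.dualSystem c M (S.steering c M T f) y).sol n p (time n p) =
        S.backward c M T f (M - n + 1) (trunc n p) (time n p) := by
  intro n
  induction n with
  | zero =>
    intro _ _
    rw [ImpulsiveSystem.sol_zero_time, hp.time_zero]
    exact hy
  | succ n ih =>
    intro hn hnT
    have hn' : (p n).1 < ∞ := (hp.mono n.le_succ).trans_lt hn
    have hlt := ImpulsiveSystem.time_le_of_lt_top hp hn
    have hnM : n + 1 ≤ M := hp.le_of_lt_top hn
    have h := S.sol_steering_of_start hf hb hT hp hn' (ih hn' (hlt.le.trans hnT)) hlt.le hnT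
    rw [ImpulsiveSystem.sol_succ_time, h]
    have hj : (S.dualSystem c M (S.steering c M T f) y).j (trunc n p) (time (n + 1) p) (p (n + 1)).2 =
        S.backward c M T f (M - n) (trunc (n + 1) p) (time (n + 1) p) -
          S.backward c M T f (M - n + 1) (trunc n p) (time (n + 1) p) := by
      refine (S.steering_trunc hp hn' ⟨time_nonneg _ _, hnT⟩ _).trans ?_
      rw [addJump_trunc hp hn]
    rw [hj, show M - (n + 1) + 1 = M - n by omega]
    simp [dualSystem]

/-- The steering control steers the dual state to `f` at time `T`. -/
theorem value_steering {y : EuclideanSpace ℝ (Fin N)}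
    (hy : y = S.backward c M T f (M + 1) (trunc 0 p) 0) {t : ℝ≥0} (ht : (t : ℝ) = T) :
    (S.dualSystem c M (S.steering c M T f) y).value M (upTo t p) T = f (upTo t p) := by
  obtain ⟨n, h1, h2⟩ := hp.exists_mem t
  have hn : (p n).1 < ∞ := h1.trans_lt coe_lt_top
  have hnT : time n p ≤ T := by rw [← ht]; exact ENNReal.toReal_mono coe_ne_top h1
  rw [ImpulsiveSystem.value_upTo hp h1 h2, S.sol_steering_of_start hf hb hT hp hn
    (S.sol_steering_start hf hb hT hp hy hn hnT) hnT le_rfl, hp.upTo_eq h1 h2, backward,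
    linearFlow_self]

end Steering

end SwitchCoefficients

/-! ### Sufficiency and conclusion -/

namespace SwitchProcess

variable {E : Type*} [Fintype E] [MeasurableSpace E] [MeasurableSingletonClass E]
  {c : JumpCharacteristics E} {γ₀ : E} {M : ℕ}
  {Ω : Type*} [MeasurableSpace Ω] {μ : Measure Ω} [IsProbabilityMeasure μ]
  {G : SwitchProcess c γ₀ M μ} {N d : ℕ} (S : SwitchCoefficients E N d)

lemma isDualFeedback_of_bounded {w : E → History E × ℝ≥0 → EuclideanSpace ℝ (Fin N)}
    (hw : ∀ θ, StronglyMeasurable (w θ)) {C : ℝ} (hC : ∀ θ q, ‖w θ q‖ ≤ C) :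
    G.IsDualFeedback w := by
  refine ⟨hw, fun T => ?_⟩
  have hle : ∀ (ω : Ω) (s : ℝ), ∑ θ, (c.lam M (upTo s.toNNReal (G.path ω)) θ : ℝ≥0∞) *
      ‖w θ (upTo s.toNNReal (G.path ω), s.toNNReal)‖ₑ ^ 2 ≤
      ∑ _θ : E, ((c.maxRate * C.toNNReal ^ 2 : ℝ≥0) : ℝ≥0∞) := by
    intro ω s
    refine Finset.sum_le_sum fun θ _ => ?_
    push_cast
    refine mul_le_mul' (by exact_mod_cast c.lam_le_maxRate _ θ) (pow_le_pow_left₀ zero_le ?_ 2)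
    rw [← ofReal_norm]
    exact ENNReal.ofReal_le_ofReal (hC _ _)
  refine (lintegral_mono fun ω => lintegral_mono fun s => hle ω s).trans_lt ?_
  simp only [lintegral_const, Finset.sum_const, nsmul_eq_mul]
  finiteness

/-- Every bounded function of the history is the terminal value of a solution of the dual
equation. -/
theorem exists_dualValue_eq {f : History E → EuclideanSpace ℝ (Fin N)} (hf : StronglyMeasurable f)
    (hb : ∀ h, ‖f h‖ ≤ 1) (T : ℝ≥0) : ∃ q : G.dualPairs N, ∀ ω,
      dualValue S c M q.1.1 q.1.2 (upTo T (G.path ω), T) = f (upTo T (G.path ω)) := by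
  have hT : 0 ≤ (T : ℝ) := NNReal.coe_nonneg T
  obtain ⟨C, hC⟩ := S.exists_norm_steering_le (c := c) (M := M) hf hb hT
  -- The initial value must be a constant vector: it is the backward solution at time 0 evaluated at
  -- the history with no jump yet, which is the same for every `ω`.
  refine ⟨⟨(S.backward c M T f (M + 1) (fun k => if k = 0 then (0, γ₀) else (∞, γ₀)) 0,
    S.steering c M T f),
    isDualFeedback_of_bounded (S.stronglyMeasurable_steering hf) hC⟩, fun ω => ?_⟩
  refine S.value_steering hf hb hT (G.isPath ω) ?_ rfl
  have h := G.upTo_zero_path ω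
  rw [(G.isPath ω).upTo_eq (n := 0) (by simp [(G.isPath ω).zero])
    (by simpa [(G.isPath ω).zero] using (G.isPath ω).lt 0 (by simp [(G.isPath ω).zero]))] at h
  rw [h]

/-- If the gauge is a norm, the system is exactly null-controllable. -/
theorem exactlyNullControllable_of_isNormFunction {T : ℝ≥0}
    (hp : IsNormFunction (G.dualGauge S T)) : G.ExactlyNullControllable S T := by
  intro x
  obtain ⟨w, hw, h⟩ := exists_integral_inner_eq_zero S hp x
  refine ⟨_, hw.admissible, _, hw.isStateSolution S x, ?_⟩
  set ξ : History E → EuclideanSpace ℝ (Fin N) := fun p => (S.stateSystem c M w x).value M p T with hξ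
  have hξm : StronglyMeasurable ξ := ((hw.sqIntegrable S x).meas.value M).comp_measurable
    (g := fun p : History E => (p, (T : ℝ))) (by fun_prop)
  have hpos : ∀ p, 0 < 1 + ‖ξ p‖ ^ 2 := fun p => by positivity
  -- The terminal state `ξ` need not be bounded, whereas steering is available for bounded targets.
  -- This rescaling has norm at most 1, and its inner product with `ξ`, equal to `‖ξ‖² / (1 +
  -- ‖ξ‖²)`, is nonnegative and vanishes only where `ξ` does.
  set f : History E → EuclideanSpace ℝ (Fin N) := fun p => (1 + ‖ξ p‖ ^ 2)⁻¹ • ξ p with hf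
  have hfm : StronglyMeasurable f :=
    ((hξm.norm.measurable.pow_const 2).const_add 1).inv.stronglyMeasurable.smul hξm
  have hfb : ∀ p, ‖f p‖ ≤ 1 := fun p => by
    rw [hf, norm_smul, norm_inv, Real.norm_of_nonneg (hpos p).le, inv_mul_eq_div,
      div_le_one (hpos p)]
    nlinarith [sq_nonneg (‖ξ p‖ - 1)]
  obtain ⟨q, hq⟩ := exists_dualValue_eq (G := G) S hfm hfb T
  have hint := h q
  have e : ∀ ω, inner ℝ ((S.stateSystem c M w x).value M (upTo T (G.path ω)) T)
      (dualValue S c M q.1.1 q.1.2 (upTo T (G.path ω), T)) =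
      (1 + ‖ξ (upTo T (G.path ω))‖ ^ 2)⁻¹ * ‖ξ (upTo T (G.path ω))‖ ^ 2 := by
    intro ω
    rw [hq, hf]
    simp only
    rw [inner_smul_right, ← real_inner_self_eq_norm_sq]
  simp_rw [e] at hint
  have hmeas : StronglyMeasurable fun ω =>
      (1 + ‖ξ (upTo T (G.path ω))‖ ^ 2)⁻¹ * ‖ξ (upTo T (G.path ω))‖ ^ 2 := by
    have h1 : Measurable fun ω => ‖ξ (upTo T (G.path ω))‖ :=
      hξm.norm.measurable.comp
        (measurable_upTo.comp (measurable_const.prodMk G.measurable_path))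
    exact (((h1.pow_const 2).const_add 1).inv.mul (h1.pow_const 2)).stronglyMeasurable
  have hnn : ∀ ω, 0 ≤ (1 + ‖ξ (upTo T (G.path ω))‖ ^ 2)⁻¹ * ‖ξ (upTo T (G.path ω))‖ ^ 2 :=
    fun ω => by positivity
  have hI : Integrable (fun ω =>
      (1 + ‖ξ (upTo T (G.path ω))‖ ^ 2)⁻¹ * ‖ξ (upTo T (G.path ω))‖ ^ 2) μ := by
    refine Integrable.of_bound hmeas.aestronglyMeasurable 1 (ae_of_all _ fun ω => ?_)
    rw [Real.norm_of_nonneg (hnn ω), inv_mul_eq_div, div_le_one (hpos _)]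
    linarith
  rw [integral_eq_zero_iff_of_nonneg hnn hI] at hint
  filter_upwards [hint] with ω hω
  simp only [Pi.zero_apply, mul_eq_zero, inv_eq_zero, (hpos _).ne', false_or,
    pow_eq_zero_iff two_ne_zero, norm_eq_zero] at hω
  exact hω

end SwitchProcess

theorem proposition3p2 {E : Type*} [Fintype E] [MeasurableSpace E] [MeasurableSingletonClass E]
    (c : JumpCharacteristics E) (γ₀ : E) (M : ℕ)
    {Ω : Type*} [MeasurableSpace Ω] (μ : Measure Ω) [IsProbabilityMeasure μ]
    (G : SwitchProcess c γ₀ M μ) {N d : ℕ} (S : SwitchCoefficients E N d)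
    (T : ℝ≥0) (hT : 0 < T) :
    (∀ y, G.dualCost S T y ≠ ⊤) ∧
    IsPseudonorm (G.dualGauge S T) ∧
    (G.ExactlyNullControllable S T ↔ IsNormFunction (G.dualGauge S T)) := by
  have hps : IsPseudonorm (G.dualGauge S T) := by
    rw [SwitchProcess.dualGauge_eq]
    exact isPseudonorm_fibreGauge G.dualInitial_surjective
  refine ⟨fun y => ?_, hps, fun h => ?_, SwitchProcess.exactlyNullControllable_of_isNormFunction S⟩
  · rw [SwitchProcess.dualCost_eq]
    exact fibreCost_ne_top G.dualInitial_surjective y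
  · exact { hps with eq_zero := fun y hy => SwitchProcess.eq_zero_of_dualGauge_eq_zero S h hy }
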